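/- Let $d,k\in\mathbb N=\{1,2,\dots\}$ and $R>0$. Let $h\in C^\infty(\mathbb R^d)$ be real-valued and radially symmetric with $h(0)<0$, $|\partial h(\xi)|<1$ and $\partial^2h(\xi)$ positive semidefinite for all $\xi\in\mathbb R^d$. Let $\mathbb B^d_R=\{|\xi|<R\}$ and let $C^\infty(\overline{\mathbb B^d_R})$ be the space of complex-valued functions that are smooth up to the boundary (equivalently, smooth in $\mathbb B^d_R$ with bounded derivatives of all orders). With the summation convention put $$c=\xi^i\partial_ih-h,\qquad w=1-\partial^ih\,\partial_ih,\qquad c_0=1,\qquad c_i=-\partial_ih\quad(i=1,\dots,d),$$ and for $\mathbf f=(f_1,f_2)\in C^\infty(\overline{\mathbb B^d_R})^2$ and $\mu=0,1,\dots,d$ $$\mathbf L_\chi\mathbf f=\begin{bmatrix}-\xi^i\partial_if_1+cf_2\\ \frac cw\partial^i\partial_if_1-\big(1+\frac cw\partial^i\partial_ih\big)f_2-\big(\xi^i+2\frac cw\partial^ih\big)\partial_if_2\end{bmatrix},$$ $$\mathbf D_\mu\mathbf f=\begin{bmatrix}\delta_\mu{}^i\partial_if_1+c_\mu f_2\\ \frac{c_\mu}w\partial^i\partial_if_1-\frac{c_\mu}w(\partial^i\partial_ih)f_2+\big(\delta_\mu{}^i-2\frac{c_\mu}w\partial^ih\big)\partial_if_2\end{bmatrix}.$$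 For real parameters $\varepsilon_j$, $1\le j<\frac d2+1$, define recursively $$(\mathbf f|\mathbf g)_{\mathfrak E^1}=\int_{\mathbb B^d_R}\overline{\partial^if_1}\,\partial_ig_1+\int_{\mathbb B^d_R}\overline{f_2}\,g_2\,w+\frac{2\varepsilon_1}R\int_{\partial\mathbb B^d_R}\overline{f_1}\,g_1,$$ $$(\mathbf f|\mathbf g)_{\mathfrak E^k}=\sum_{\mu=0}^d(\mathbf D_\mu\mathbf f|\mathbf D_\mu\mathbf g)_{\mathfrak E^{k-1}}+\begin{cases}\frac{2\varepsilon_k}R\int_{\partial\mathbb B^d_R}\overline{f_1}\,g_1,&2\le k<\frac d2+1,\\(\mathbf f|\mathbf g)_{\mathfrak E^{k-1}},&k\ge2,\ k\ge\frac d2+1,\end{cases}$$ and $\|\mathbf f\|_{\mathfrak E^k}=\sqrt{(\mathbf f|\mathbf f)_{\mathfrak E^k}}$. (i) If $\varepsilon_j>0$ for all $1\le j<\frac d2+1$, then $(\cdot|\cdot)_{\mathfrak E^k}$ is an inner product on $C^\infty(\overline{\mathbb B^d_R})^2$, and there are constants $C_1,C_2>0$ such that for all $\mathbf f\in C^\infty(\overline{\mathbb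 B^d_R})^2$ $$\|\mathbf f\|_{\mathfrak E^k}\le C_1\|(f_1,f_2)\|_{H^k(\mathbb B^d_R)\times H^{k-1}(\mathbb B^d_R)},\qquad \|(f_1,f_2)\|_{H^k(\mathbb B^d_R)\times H^{k-1}(\mathbb B^d_R)}\le C_2\|\mathbf f\|_{\mathfrak E^k}.$$ (ii) Let $R_0>0$ be the (unique) positive number with $h(\xi)^2=R_0^2$ for $|\xi|=R_0$, and suppose $R\ge R_0$. Let $0<\varepsilon_1\le\frac12$ and use $$\varepsilon_j=\varepsilon_1\prod_{i=1}^{j-1}\frac{(\frac d2-i-\varepsilon_1)\,\varepsilon_1}{R^2}\qquad(1\le j<\tfrac d2+1)$$ as parameters in $(\cdot|\cdot)_{\mathfrak E^k}$. Then $\varepsilon_j\ge0$ for all these $j$, and $\varepsilon_j>0$ if $\varepsilon_1<\frac12$ or $2j\ne d+1$. Moreover, for all $\mathbf f\in C^\infty(\overline{\mathbb B^d_R})^2$, $$\operatorname{Re}(\mathbf L_\chi\mathbf f|\mathbf f)_{\mathfrak E^k}\le\Big(\frac d2-k\Big)\|\mathbf f\|_{\mathfrak E^k}^2+\Big(-\frac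 d2+k+\varepsilon_1\Big)\frac{2\varepsilon_k}R\int_{\partial\mathbb B^d_R}|f_1|^2\qquad\text{if }k<\tfrac d2+1,$$ $$\operatorname{Re}(\mathbf L_\chi\mathbf f|\mathbf f)_{\mathfrak E^k}\le\varepsilon_1\|\mathbf f\|_{\mathfrak E^k}^2\qquad\text{if }k\ge\tfrac d2+1.$$ -/

import Mathlib

open scoped ContDiff ComplexConjugate

noncomputable section

namespace WaveFlow

/-- Euclidean space `ℝ^d`. -/
abbrev E (d : ℕ) : Type := EuclideanSpace ℝ (Fin d)

/-- Pairs `f = (f₁, f₂)` of complex-valued functions. -/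
abbrev Pair (d : ℕ) : Type := (E d → ℂ) × (E d → ℂ)

/-! ### Derivatives -/

/-- The `i`-th partial derivative of a real function on `ℝ^d`. -/
def partialR {d : ℕ} (i : Fin d) (u : E d → ℝ) (x : E d) : ℝ :=
  fderiv ℝ u x (EuclideanSpace.single i 1)

/-- The Laplacian of a real function on `ℝ^d`. -/
def laplacianR {d : ℕ} (u : E d → ℝ) (x : E d) : ℝ :=
  ∑ i, partialR i (partialR i u) x

/-- The `i`-th partial derivative of a complex function on the closed ball of radius `R`; in the
interior this is the ordinary partial derivative, on the boundary it is its continuous extension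
when the function is smooth up to the boundary. -/
def partialB {d : ℕ} (R : ℝ) (i : Fin d) (u : E d → ℂ) (x : E d) : ℂ :=
  fderivWithin ℝ u (Metric.closedBall 0 R) x (EuclideanSpace.single i 1)

/-- The Laplacian of a complex function on the closed ball of radius `R`. -/
def laplacianB {d : ℕ} (R : ℝ) (u : E d → ℂ) (x : E d) : ℂ :=
  ∑ i, partialB R i (partialB R i u) x

/-- The partial derivative `∂^α` for a multi-index `α`. -/
def multiPartialB {d : ℕ} (R : ℝ) (α : Fin d → ℕ) (u : E d → ℂ) : E d → ℂ :=
  (List.finRange d).foldr (fun i v => (partialB R i)^[α i] v) u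

/-- `f ∈ C^∞(closed ball)²`: both components are smooth up to the boundary. Values outside the
closed ball play no role. -/
def SmoothPair {d : ℕ} (R : ℝ) (f : Pair d) : Prop :=
  ContDiffOn ℝ ∞ f.1 (Metric.closedBall 0 R) ∧ ContDiffOn ℝ ∞ f.2 (Metric.closedBall 0 R)

/-! ### Sobolev norms -/

/-- The square of the Sobolev norm `H^k` of the ball of radius `R`, that is, the sum over all
multi-indices of order at most `k` of the squared `L²` norms of `∂^α u`. -/
def sobolevNormSq {d : ℕ} (R : ℝ) (k : ℕ) (u : E d → ℂ) : ℝ :=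
  ∑ j ∈ Finset.range (k + 1), ∑ α ∈ Finset.piAntidiag (Finset.univ : Finset (Fin d)) j,
    ∫ x in Metric.ball (0 : E d) R, ‖multiPartialB R α u x‖ ^ 2

/-- The norm of `(f₁, f₂)` in `H^k × H^(k-1)`, for `k ≥ 1`. -/
def sobolevPairNorm {d : ℕ} (R : ℝ) (k : ℕ) (f : Pair d) : ℝ :=
  Real.sqrt (sobolevNormSq R k f.1 + sobolevNormSq R (k - 1) f.2)

/-! ### Height functions -/

/-- Radial smooth height functions with `h(0) < 0`, `|∂h| < 1` and positive semidefinite Hessian. -/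
structure IsHeightFunction {d : ℕ} (h : E d → ℝ) : Prop where
  smooth : ContDiff ℝ ∞ h
  radial : ∀ x y : E d, ‖x‖ = ‖y‖ → h x = h y
  neg_at_zero : h 0 < 0
  gradient_lt_one : ∀ x : E d, ‖gradient h x‖ < 1
  hessian_nonneg : ∀ (x : E d) (v : Fin d → ℝ),
    0 ≤ ∑ i, ∑ j, v i * v j * partialR i (partialR j h) x

/-- `R₀ > 0` is the zero of `ρ ↦ h(ρ)² - ρ²`, where `h(ρ)` is the radial profile of `h`. -/
def IsLightConeRadius {d : ℕ} (h : E d → ℝ) (R₀ : ℝ) : Prop :=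
  0 < R₀ ∧ ∀ x : E d, ‖x‖ = R₀ → h x ^ 2 - R₀ ^ 2 = 0

/-- `c(ξ) = ξ^i ∂_i h(ξ) - h(ξ)`. -/
def coeffC {d : ℕ} (h : E d → ℝ) (x : E d) : ℝ := ∑ i, x i * partialR i h x - h x

/-- `w(ξ) = 1 - ∂^i h(ξ) ∂_i h(ξ)`. -/
def coeffW {d : ℕ} (h : E d → ℝ) (x : E d) : ℝ := 1 - ∑ i, partialR i h x * partialR i h x

/-- `c_0 = 1` and `c_i = - ∂_i h` for `i = 1, …, d`. -/
def coeffMu {d : ℕ} (h : E d → ℝ) (μ : Fin (d + 1)) (x : E d) : ℝ :=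
  Fin.cases 1 (fun i => - partialR i h x) μ

/-- `δ_μ^i ∂_i u`: this is `0` for `μ = 0` and `∂_i u` for `μ = i = 1, …, d`. -/
def spatialPartial {d : ℕ} (R : ℝ) (μ : Fin (d + 1)) (u : E d → ℂ) (x : E d) : ℂ :=
  Fin.cases 0 (fun i => partialB R i u x) μ

/-! ### The wave evolution operator and the operators `D_μ` -/

/-- The wave evolution operator `L_χ` in similarity coordinates with height function `h`. -/
def waveOp {d : ℕ} (h : E d → ℝ) (R : ℝ) (f : Pair d) : Pair d :=
  (fun x => - (∑ i, (x i : ℂ) * partialB R i f.1 x) + (coeffC h x : ℂ) * f.2 x,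
   fun x => ((coeffC h x / coeffW h x : ℝ) : ℂ) * laplacianB R f.1 x
      - ((1 + coeffC h x / coeffW h x * laplacianR h x : ℝ) : ℂ) * f.2 x
      - ∑ i, ((x i + 2 * (coeffC h x / coeffW h x) * partialR i h x : ℝ) : ℂ)
          * partialB R i f.2 x)

/-- The operators `D_μ`, `μ = 0, 1, …, d`. -/
def commOp {d : ℕ} (h : E d → ℝ) (R : ℝ) (μ : Fin (d + 1)) (f : Pair d) : Pair d :=
  (fun x => spatialPartial R μ f.1 x + (coeffMu h μ x : ℂ) * f.2 x,
   fun x => ((coeffMu h μ x / coeffW h x : ℝ) : ℂ) * laplacianB R f.1 x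
      - ((coeffMu h μ x / coeffW h x * laplacianR h x : ℝ) : ℂ) * f.2 x
      + (spatialPartial R μ f.2 x
          - ∑ i, ((2 * (coeffMu h μ x / coeffW h x) * partialR i h x : ℝ) : ℂ)
              * partialB R i f.2 x))

/-! ### The inner products -/

/-- The surface integral over the sphere of radius `R` in `ℝ^d`, `d ≥ 1`, with respect to the
standard surface measure (for `d = 1`, the counting measure on `{-R, R}`). -/
def sphereIntegral {d : ℕ} {F : Type} [NormedAddCommGroup F] [NormedSpace ℝ F]
    (R : ℝ) (u : E d → F) : F :=
  R ^ (d - 1) • ∫ y : Metric.sphere (0 : E d) 1, u (R • (y : E d))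
    ∂((MeasureTheory.volume : MeasureTheory.Measure (E d)).toSphere)

/-- The sesquilinear forms `(f | g)_{E^k}`, `k ≥ 1`, antilinear in the first argument, with
parameters `ε 1, ε 2, …` (the value at `k = 0` is irrelevant). -/
def energyForm {d : ℕ} (h : E d → ℝ) (R : ℝ) (ε : ℕ → ℝ) : ℕ → Pair d → Pair d → ℂ
  | 0, _, _ => 0
  | 1, f, g =>
      (∫ x in Metric.ball (0 : E d) R, ∑ i, conj (partialB R i f.1 x) * partialB R i g.1 x)
      + (∫ x in Metric.ball (0 : E d) R, conj (f.2 x) * g.2 x * (coeffW h x : ℂ))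
      + ((2 * ε 1 / R : ℝ) : ℂ) * sphereIntegral R (fun x => conj (f.1 x) * g.1 x)
  | k + 2, f, g =>
      (∑ μ, energyForm h R ε (k + 1) (commOp h R μ f) (commOp h R μ g))
      + if ((k + 2 : ℕ) : ℝ) < (d : ℝ) / 2 + 1 then
          ((2 * ε (k + 2) / R : ℝ) : ℂ) * sphereIntegral R (fun x => conj (f.1 x) * g.1 x)
        else energyForm h R ε (k + 1) f g

/-- The induced quadratic form `‖f‖_{E^k} = √(f | f)_{E^k}`. -/
def energyNorm {d : ℕ} (h : E d → ℝ) (R : ℝ) (ε : ℕ → ℝ) (k : ℕ) (f : Pair d) : ℝ :=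
  Real.sqrt (energyForm h R ε k f f).re

/-- `B` is an inner product (linear in the second argument) on `C^∞(closed ball)²`. -/
structure IsInnerProduct {d : ℕ} (R : ℝ) (B : Pair d → Pair d → ℂ) : Prop where
  conj_symm : ∀ f g, SmoothPair R f → SmoothPair R g → conj (B f g) = B g f
  add_right : ∀ f g g', SmoothPair R f → SmoothPair R g → SmoothPair R g' →
    B f (g + g') = B f g + B f g'
  smul_right : ∀ (a : ℂ) (f g), SmoothPair R f → SmoothPair R g → B f (a • g) = a * B f g
  nonneg : ∀ f, SmoothPair R f → 0 ≤ (B f f).re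
  definite : ∀ f, SmoothPair R f → B f f = 0 →
    ∀ x ∈ Metric.closedBall (0 : E d) R, f.1 x = 0 ∧ f.2 x = 0

/-- The special parameters
`ε_k = ε₁ ∏_{i=1}^{k-1} (d/2 - i - ε₁) ε₁ / R²`, used for `1 ≤ k < d/2 + 1`. -/
def epsSeq (d : ℕ) (R ε₁ : ℝ) (k : ℕ) : ℝ :=
  ε₁ * ∏ i ∈ Finset.Icc 1 (k - 1), (((d : ℝ) / 2 - i - ε₁) * ε₁ / R ^ 2)

end WaveFlow

end

open WaveFlow

/-! ### Integration on the ball: polar coordinates, radial fields, functions vanishing on the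
boundary. -/

noncomputable section

namespace WaveFlow

open MeasureTheory Set Metric

/-! In similarity coordinates `t = T + e^{-τ} h(ξ)`, `x = e^{-τ} ξ`, a wave is recorded by its value
`f₁` and its rescaled time derivative `f₂`. The operator `L` is then `∂_τ`, and the `D_μ` are the
rescaled Cartesian derivatives `∂_t`, `∂_{x^i}`. These commute with the wave equation, and `∂_τ`
generates a scaling, so `D_μ L = L D_μ - D_μ`: each order of differentiation gains a unit of decay.
These identities are purely algebraic (`DT_L`, `DX_L`), and they are proved in a commutative ring
with commuting derivations (`HeightAlgebra`).

Dissipation at `k = 1`: the density of the energy obeys an exact identity, `d - 2` times the density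
plus the divergence of a flux (`density_L`). The divergence theorem (`ballInt_der`) leaves a
boundary integral which, with the `ε₁` term added, is bounded by `4ε₁²|f₁|²` after completing a
square (`flux_boundary_le`). This needs `|h| ≤ R` on the sphere, which holds for `R ≥ R₀` since `h`
is 1-Lipschitz, and it needs the gradient of `h` to be radial.

Dissipation at higher `k`: induction through the commutators. While `k < d/2`, the estimate for `D_μ
f` carries a boundary integral of nonpositive coefficient. It pays for the new boundary term because
`(L f)₁` is a combination of the `(D_μ f)₁` on the sphere (`sum_bdry_Dμ_le`), and the recursion for
`epsSeq` is what makes the two balance. From `k ≥ d/2` on, the surviving boundary term is bounded by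
the energy itself, which gives the rate `ε₁`; beyond `d/2 + 1` no boundary term is added.

Equivalence with Sobolev norms: the upper bound is the product rule plus a trace inequality. For the
lower bound, `f₂ = (D_0 f)₁` and `∂_i f₁ = (D_i f)₁ + ∂_i h f₂` recover all derivatives from the
`D_μ f`, while `f₁` itself is controlled by its boundary values through a Poincaré inequality, or by
the energy one order lower (`sobPair_le_energyA`). -/

instance nontrivial_euclidean {d : ℕ} [NeZero d] : Nontrivial (E d) := by
  have : Nonempty (Fin d) := ⟨0⟩
  infer_instance

/-- Integration in polar coordinates. -/
theorem integral_polar {d : ℕ} [NeZero d] (G : E d → ℂ) (hG : Integrable G) :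
    ∫ x, G x = ∫ y : sphere (0 : E d) 1, (∫ r in Ioi (0 : ℝ), r ^ (d - 1) • G (r • (y : E d)))
      ∂((volume : Measure (E d)).toSphere) := by
  have hmp := (volume : Measure (E d)).measurePreserving_homeomorphUnitSphereProd
  have hdim : Module.finrank ℝ (E d) = d := finrank_euclideanSpace_fin
  rw [hdim] at hmp
  have hemb := Homeomorph.measurableEmbedding (homeomorphUnitSphereProd (E d))
  let H : sphere (0 : E d) 1 × Ioi (0 : ℝ) → ℂ := fun p => G ((p.2 : ℝ) • (p.1 : E d))
  have hcomp : ∀ x : ({(0)}ᶜ : Set (E d)), H (homeomorphUnitSphereProd (E d) x) = G x := by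
    intro x
    have hx : ‖(x : E d)‖ ≠ 0 := norm_ne_zero_iff.2 x.2
    simp only [H, homeomorphUnitSphereProd_apply_snd_coe, homeomorphUnitSphereProd_apply_fst_coe]
    rw [smul_smul, mul_inv_cancel₀ hx, one_smul]
  have hint : Integrable H
      ((volume : Measure (E d)).toSphere.prod (Measure.volumeIoiPow (d - 1))) := by
    rw [← hmp.integrable_comp_emb hemb]
    have : (H ∘ homeomorphUnitSphereProd (E d)) = G ∘ Subtype.val := funext hcomp
    rw [this, ← integrableOn_iff_comap_subtypeVal (measurableSet_singleton _).compl]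
    exact hG.integrableOn
  calc ∫ x, G x = ∫ x : ({(0)}ᶜ : Set (E d)), G x.1 ∂((volume : Measure (E d)).comap (↑)) := by
        rw [integral_subtype_comap (measurableSet_singleton _).compl G, restrict_compl_singleton]
    _ = ∫ p, H p ∂(volume : Measure (E d)).toSphere.prod (Measure.volumeIoiPow (d - 1)) := by
        rw [← hmp.integral_comp hemb]
        exact integral_congr_ae (Filter.Eventually.of_forall fun x => (hcomp x).symm)
    _ = ∫ y, ∫ r, H (y, r) ∂(Measure.volumeIoiPow (d - 1))
          ∂(volume : Measure (E d)).toSphere := integral_prod _ hint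
    _ = _ := by
        congr 1
        ext y
        simp only [Measure.volumeIoiPow, ENNReal.ofReal]
        rw [integral_withDensity_eq_integral_smul
          ((measurable_subtype_coe.pow_const _).real_toNNReal),
          integral_subtype_comap measurableSet_Ioi
            fun a => Real.toNNReal (a ^ (d - 1)) • G (a • (y : E d)),
          setIntegral_congr_fun measurableSet_Ioi fun x hx => ?_]
        simp only [NNReal.smul_def]
        rw [Real.coe_toNNReal _ (pow_nonneg (le_of_lt hx) _)]

/-- Integration over a ball in polar coordinates. -/
theorem integral_ball_polar {d : ℕ} [NeZero d] {R : ℝ} (hR : 0 < R) (G : E d → ℂ)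
    (hG : IntegrableOn G (ball 0 R)) :
    ∫ x in ball (0 : E d) R, G x = ∫ y : sphere (0 : E d) 1,
      (∫ r in (0 : ℝ)..R, r ^ (d - 1) • G (r • (y : E d))) ∂((volume : Measure (E d)).toSphere) := by
  rw [← integral_indicator measurableSet_ball,
    integral_polar _ ((integrable_indicator_iff measurableSet_ball).2 hG)]
  congr 1
  ext y
  have hy : ‖(y : E d)‖ = 1 := by simp
  rw [intervalIntegral.integral_of_le hR.le, integral_Ioc_eq_integral_Ioo,
    ← Ioi_inter_Iio, ← setIntegral_indicator measurableSet_Iio]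
  refine setIntegral_congr_fun measurableSet_Ioi fun r hr => ?_
  have hr' : (0 : ℝ) < r := hr
  by_cases h : r < R
  · have h1 : r • (y : E d) ∈ ball (0 : E d) R := by
      simpa [norm_smul, hy, abs_of_pos hr'] using h
    have h2 : r ∈ Iio R := h
    simp only [indicator_of_mem h1, indicator_of_mem h2]
  · have h1 : r • (y : E d) ∉ ball (0 : E d) R := by
      simpa [norm_smul, hy, abs_of_pos hr'] using h
    have h2 : r ∉ Iio R := h
    simp only [indicator_of_notMem h1, indicator_of_notMem h2, smul_zero]

theorem uniqueDiffOn_closedBall {d : ℕ} {R : ℝ} (hR : 0 < R) :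
    UniqueDiffOn ℝ (closedBall (0 : E d) R) :=
  uniqueDiffOn_convex (convex_closedBall _ _) (by
    rw [interior_closedBall _ hR.ne']
    exact ⟨0, mem_ball_self hR⟩)

theorem integrableOn_ball_of_continuousOn {d : ℕ} {R : ℝ} {F : Type*} [NormedAddCommGroup F]
    {u : E d → F} (hu : ContinuousOn u (closedBall 0 R)) : IntegrableOn u (ball 0 R) :=
  (hu.integrableOn_compact (isCompact_closedBall _ _)).mono_set ball_subset_closedBall

theorem continuousOn_fderivWithin_apply_self {d : ℕ} {R : ℝ} (hR : 0 < R) {u : E d → ℂ}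
    (hu : ContDiffOn ℝ 1 u (closedBall 0 R)) :
    ContinuousOn (fun x => fderivWithin ℝ u (closedBall 0 R) x x) (closedBall 0 R) :=
  (hu.continuousOn_fderivWithin (uniqueDiffOn_closedBall hR) le_rfl).clm_apply continuousOn_id

/-- The divergence theorem for the radial vector field `u(x) x`. -/
theorem integral_ball_radial {d : ℕ} [NeZero d] {R : ℝ} (hR : 0 < R) {u : E d → ℂ}
    (hu : ContDiffOn ℝ 1 u (closedBall 0 R)) :
    ∫ x in ball (0 : E d) R, ((d : ℂ) * u x + fderivWithin ℝ u (closedBall 0 R) x x)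
      = (R : ℂ) * sphereIntegral R u := by
  have hd : d - 1 + 1 = d := Nat.succ_pred_eq_of_pos (NeZero.pos d)
  have hcont : ContinuousOn (fun x => (d : ℂ) * u x + fderivWithin ℝ u (closedBall 0 R) x x)
      (closedBall 0 R) :=
    (continuousOn_const.mul hu.continuousOn).add (continuousOn_fderivWithin_apply_self hR hu)
  rw [integral_ball_polar hR _ (integrableOn_ball_of_continuousOn hcont)]
  -- The integrand is the derivative of `r ^ d u(r y)` in `r`, so each ray contributes only its
  -- endpoint on the sphere.
  have key : ∀ y : sphere (0 : E d) 1, ∫ r in (0 : ℝ)..R, r ^ (d - 1) •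
      ((d : ℂ) * u (r • (y : E d))
        + fderivWithin ℝ u (closedBall 0 R) (r • (y : E d)) (r • (y : E d)))
      = (R ^ d : ℝ) • u (R • (y : E d)) := by
    intro y
    have hy : ‖(y : E d)‖ = 1 := by simp
    have hmaps : MapsTo (fun r : ℝ => r • (y : E d)) (Icc 0 R) (closedBall 0 R) := by
      intro r hr
      simpa [norm_smul, hy, abs_of_nonneg hr.1] using hr.2
    have hline : ContinuousOn (fun r : ℝ => r • (y : E d)) (Icc 0 R) := by fun_prop
    have := intervalIntegral.integral_eq_sub_of_hasDerivAt_of_le hR.le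
      (f := fun r : ℝ => (r ^ d : ℝ) • u (r • (y : E d)))
      (f' := fun r : ℝ => r ^ (d - 1) • ((d : ℂ) * u (r • (y : E d))
        + fderivWithin ℝ u (closedBall 0 R) (r • (y : E d)) (r • (y : E d)))) ?_ ?_ ?_
    · rw [this]
      simp [NeZero.ne d]
    · exact (by fun_prop : Continuous fun r : ℝ => r ^ d).continuousOn.smul
        (hu.continuousOn.comp hline hmaps)
    · intro r hr
      have hmem : closedBall (0 : E d) R ∈ nhds (r • (y : E d)) := by
        refine closedBall_mem_nhds_of_mem ?_
        simpa [norm_smul, hy, abs_of_pos hr.1] using hr.2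
      have hdu : HasFDerivAt u (fderivWithin ℝ u (closedBall 0 R) (r • (y : E d)))
          (r • (y : E d)) :=
        ((hu.differentiableOn (by simp)) _ (mem_of_mem_nhds hmem)).hasFDerivWithinAt.hasFDerivAt hmem
      have hl : HasDerivAt (fun r : ℝ => r • (y : E d)) (y : E d) r := by
        simpa using (hasDerivAt_id r).smul_const (y : E d)
      have h1 := (hasDerivAt_pow d r).smul (hdu.comp_hasDerivAt r hl)
      refine h1.congr_deriv ?_
      simp only [Function.comp, map_smul, Complex.real_smul, smul_add]
      obtain ⟨n, rfl⟩ : ∃ n, d = n + 1 := ⟨d - 1, hd.symm⟩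
      simp only [Nat.add_sub_cancel]
      push_cast
      ring
    · refine ContinuousOn.intervalIntegrable_of_Icc hR.le ?_
      exact (by fun_prop : Continuous fun r : ℝ => r ^ (d - 1)).continuousOn.smul
        (hcont.comp hline hmaps)
  simp_rw [key]
  have hpow : R ^ d = R ^ (d - 1) * R := by rw [← pow_succ, hd]
  rw [integral_smul, sphereIntegral, hpow]
  simp only [Complex.real_smul]
  push_cast
  ring

/-- The extension by zero of a `C¹` function on the closed ball vanishing on the boundary is
Lipschitz. -/
theorem exists_lipschitzWith_indicator {d : ℕ} {R : ℝ} {u : E d → ℝ}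
    (hu : ContDiffOn ℝ 1 u (closedBall 0 R)) (h0 : ∀ x, ‖x‖ = R → u x = 0) :
    ∃ K, LipschitzWith K ((closedBall (0 : E d) R).indicator u) := by
  obtain ⟨K, hK⟩ := hu.exists_lipschitzOnWith one_ne_zero (convex_closedBall _ _)
    (isCompact_closedBall _ _)
  refine ⟨K, ?_⟩
  have mixed : ∀ x ∈ closedBall (0 : E d) R, ∀ y ∉ closedBall (0 : E d) R,
      dist (u x) 0 ≤ K * dist x y := by
    intro x hx y hy
    have hx' : ‖x‖ ≤ R := by simpa using hx
    have hy' : R ≤ ‖y‖ := by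
      have : R < ‖y‖ := by simpa using hy
      exact this.le
    -- The segment from `x` to `y` meets the sphere, where `u` vanishes, at a point no farther from
    -- `x` than `y`.
    have hc : ContinuousOn (fun t : ℝ => ‖x + t • (y - x)‖) (Icc 0 1) := by fun_prop
    obtain ⟨t, ht, htR⟩ : R ∈ (fun t : ℝ => ‖x + t • (y - x)‖) '' Icc 0 1 := by
      apply intermediate_value_Icc zero_le_one hc
      simpa using ⟨hx', hy'⟩
    have hz : x + t • (y - x) ∈ closedBall (0 : E d) R := by
      simpa using le_of_eq htR
    have := hK.dist_le_mul x hx _ hz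
    rw [h0 _ htR] at this
    refine this.trans ?_
    gcongr
    rw [dist_self_add_right, norm_smul, dist_comm, dist_eq_norm, Real.norm_of_nonneg ht.1]
    exact mul_le_of_le_one_left (norm_nonneg _) ht.2
  refine LipschitzWith.of_dist_le_mul fun x y => ?_
  by_cases hx : x ∈ closedBall (0 : E d) R <;> by_cases hy : y ∈ closedBall (0 : E d) R
  · rw [indicator_of_mem hx, indicator_of_mem hy]
    exact hK.dist_le_mul x hx y hy
  · rw [indicator_of_mem hx, indicator_of_notMem hy]
    exact mixed x hx y hy
  · rw [indicator_of_notMem hx, indicator_of_mem hy, dist_comm, dist_comm x]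
    exact mixed y hy x hx
  · rw [indicator_of_notMem hx, indicator_of_notMem hy, dist_self]
    positivity

theorem integral_ball_fderivWithin_eq_zero_real {d : ℕ} [NeZero d] {R : ℝ} {u : E d → ℝ}
    (hu : ContDiffOn ℝ 1 u (closedBall 0 R)) (h0 : ∀ x, ‖x‖ = R → u x = 0) (v : E d) :
    ∫ x in ball (0 : E d) R, fderivWithin ℝ u (closedBall 0 R) x v = 0 := by
  obtain ⟨K, hK⟩ := exists_lipschitzWith_indicator hu h0
  set g := (closedBall (0 : E d) R).indicator u with hg
  have hsupp : HasCompactSupport g := by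
    refine HasCompactSupport.intro (isCompact_closedBall (0 : E d) R) fun x hx => ?_
    exact indicator_of_notMem hx u
  -- Integration by parts against the constant `1`. It asks only for a Lipschitz function of compact
  -- support, so the corner of the zero extension along the sphere is harmless.
  have h1 := (LipschitzWith.const (1 : ℝ) (α := E d)).integral_lineDeriv_mul_eq
    (μ := (volume : Measure (E d))) hK hsupp (-v)
  have hconst : ∀ x : E d, lineDeriv ℝ (fun _ : E d => (1 : ℝ)) x (-v) = 0 := fun x => by
    simp [lineDeriv]
  simp only [hconst, zero_mul, integral_zero, neg_neg, mul_one] at h1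
  rw [← integral_indicator measurableSet_ball, h1]
  refine integral_congr_ae ?_
  have hs : ∀ᵐ x ∂(volume : Measure (E d)), x ∉ sphere (0 : E d) R :=
    measure_eq_zero_iff_ae_notMem.1 (Measure.addHaar_sphere _ _ _)
  filter_upwards [hs] with x hx
  by_cases hb : x ∈ ball (0 : E d) R
  · rw [indicator_of_mem hb]
    have hmem : closedBall (0 : E d) R ∈ nhds x := closedBall_mem_nhds_of_mem hb
    have hev : g =ᶠ[nhds x] u := by
      filter_upwards [hmem] with z hz using indicator_of_mem hz u
    have hdu : HasFDerivAt u (fderivWithin ℝ u (closedBall 0 R) x) x :=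
      ((hu.differentiableOn (by simp)) _ (mem_of_mem_nhds hmem)).hasFDerivWithinAt.hasFDerivAt hmem
    exact ((hdu.congr_of_eventuallyEq hev).hasLineDerivAt v).lineDeriv.symm
  · rw [indicator_of_notMem hb]
    have hmem : (closedBall (0 : E d) R)ᶜ ∈ nhds x := by
      refine isClosed_closedBall.isOpen_compl.mem_nhds fun hc => ?_
      simp only [mem_sphere, mem_ball, mem_closedBall] at hx hb hc
      exact hb (lt_of_le_of_ne hc hx)
    have hev : g =ᶠ[nhds x] fun _ => (0 : ℝ) := by
      filter_upwards [hmem] with z hz using indicator_of_notMem hz u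
    exact (((hasFDerivAt_const (0 : ℝ) x).congr_of_eventuallyEq hev).hasLineDerivAt v).lineDeriv.symm

/-- A directional derivative of a function vanishing on the boundary has mean zero. -/
theorem integral_ball_fderivWithin_eq_zero {d : ℕ} [NeZero d] {R : ℝ} (hR : 0 < R) {u : E d → ℂ}
    (hu : ContDiffOn ℝ 1 u (closedBall 0 R)) (h0 : ∀ x, ‖x‖ = R → u x = 0) (v : E d) :
    ∫ x in ball (0 : E d) R, fderivWithin ℝ u (closedBall 0 R) x v = 0 := by
  have hun := uniqueDiffOn_closedBall (d := d) hR
  have hint : IntegrableOn (fun x => fderivWithin ℝ u (closedBall 0 R) x v) (ball 0 R) :=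
    integrableOn_ball_of_continuousOn
      ((hu.continuousOn_fderivWithin hun le_rfl).clm_apply continuousOn_const)
  have main : ∀ L : ℂ →L[ℝ] ℝ,
      L (∫ x in ball (0 : E d) R, fderivWithin ℝ u (closedBall 0 R) x v) = 0 := by
    intro L
    rw [← L.integral_comp_comm hint, ← integral_ball_fderivWithin_eq_zero_real
      (u := fun x => L (u x)) (L.contDiff.comp_contDiffOn hu) (fun x hx => by simp [h0 x hx]) v]
    refine setIntegral_congr_fun measurableSet_ball fun x hx => ?_
    have hx' := ball_subset_closedBall hx
    have := (L.hasFDerivAt.comp_hasFDerivWithinAt x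
      ((hu.differentiableOn (by simp)) x hx').hasFDerivWithinAt).fderivWithin (hun x hx')
    simp only [Function.comp_def] at this
    simp only [this]
    rfl
  exact Complex.ext (main Complex.reCLM) (main Complex.imCLM)

end WaveFlow
end

/-! ### The ring of functions smooth up to the boundary, with its derivations and conjugation. -/

noncomputable section

namespace WaveFlow

open MeasureTheory Set Metric Filter

/-- The algebra of complex functions on the closed ball that are smooth up to the boundary. -/
def smoothSubalgebra (d : ℕ) (R : ℝ) : Subalgebra ℂ (closedBall (0 : E d) R → ℂ) where
  carrier := {u | ContDiffOn ℝ ∞ (Function.extend Subtype.val u 0) (closedBall 0 R)}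
  mul_mem' {a b} ha hb := (ha.mul hb).congr fun x hx => by
    lift x to closedBall (0 : E d) R using hx
    simp
  add_mem' {a b} ha hb := (ha.add hb).congr fun x hx => by
    lift x to closedBall (0 : E d) R using hx
    simp
  algebraMap_mem' r := (contDiffOn_const (c := r)).congr fun x hx => by
    lift x to closedBall (0 : E d) R using hx
    simp

/-- Complex functions on the closed ball that are smooth up to the boundary. -/
def SmoothBall (d : ℕ) (R : ℝ) : Type := smoothSubalgebra d R

namespace SmoothBall

instance {d : ℕ} {R : ℝ} : CommRing (SmoothBall d R) :=
  inferInstanceAs (CommRing (smoothSubalgebra d R))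

instance {d : ℕ} {R : ℝ} : Algebra ℂ (SmoothBall d R) :=
  inferInstanceAs (Algebra ℂ (smoothSubalgebra d R))

variable {d : ℕ} {R : ℝ}

/-- The extension by zero of a smooth function on the closed ball. -/
def toFun (u : SmoothBall d R) : E d → ℂ := Function.extend Subtype.val u.1 0

instance : CoeFun (SmoothBall d R) fun _ => E d → ℂ := ⟨toFun⟩

theorem toFun_apply (u : SmoothBall d R) {x : E d} (hx : x ∈ closedBall (0 : E d) R) :
    u x = u.1 ⟨x, hx⟩ := Subtype.val_injective.extend_apply u.1 0 ⟨x, hx⟩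

theorem contDiffOn (u : SmoothBall d R) : ContDiffOn ℝ ∞ u (closedBall 0 R) := u.2

theorem contDiffOn_one (u : SmoothBall d R) : ContDiffOn ℝ 1 u (closedBall 0 R) :=
  u.contDiffOn.of_le (by exact_mod_cast le_top)

theorem continuousOn (u : SmoothBall d R) : ContinuousOn u (closedBall 0 R) :=
  u.contDiffOn.continuousOn

theorem differentiableOn (u : SmoothBall d R) : DifferentiableOn ℝ u (closedBall 0 R) :=
  u.contDiffOn.differentiableOn (by simp)

/-- The restriction to the closed ball of a function that is smooth there. -/
def mk (u : E d → ℂ) (hu : ContDiffOn ℝ ∞ u (closedBall 0 R)) : SmoothBall d R :=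
  ⟨fun x => u x, hu.congr fun x hx => by
    lift x to closedBall (0 : E d) R using hx
    simp⟩

theorem mk_apply {u : E d → ℂ} (hu : ContDiffOn ℝ ∞ u (closedBall 0 R)) {x : E d}
    (hx : x ∈ closedBall (0 : E d) R) : mk u hu x = u x := by
  rw [toFun_apply _ hx]
  rfl

theorem ext {u v : SmoothBall d R} (huv : ∀ x ∈ closedBall (0 : E d) R, u x = v x) : u = v := by
  apply Subtype.ext
  funext x
  have := huv x x.2
  rwa [toFun_apply _ x.2, toFun_apply _ x.2] at this

theorem mk_congr {u v : E d → ℂ} (hu : ContDiffOn ℝ ∞ u (closedBall 0 R))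
    (hv : ContDiffOn ℝ ∞ v (closedBall 0 R)) (h : EqOn u v (closedBall 0 R)) :
    mk u hu = mk v hv :=
  ext fun x hx => by rw [mk_apply _ hx, mk_apply _ hx, h hx]

theorem add_apply (u v : SmoothBall d R) {x : E d} (hx : x ∈ closedBall (0 : E d) R) :
    (u + v) x = u x + v x := by simp only [toFun_apply _ hx]; rfl
theorem sub_apply (u v : SmoothBall d R) {x : E d} (hx : x ∈ closedBall (0 : E d) R) :
    (u - v) x = u x - v x := by simp only [toFun_apply _ hx]; rfl
theorem neg_apply (u : SmoothBall d R) {x : E d} (hx : x ∈ closedBall (0 : E d) R) :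
    (-u) x = -u x := by simp only [toFun_apply _ hx]; rfl
theorem mul_apply (u v : SmoothBall d R) {x : E d} (hx : x ∈ closedBall (0 : E d) R) :
    (u * v) x = u x * v x := by simp only [toFun_apply _ hx]; rfl
theorem smul_apply (a : ℂ) (u : SmoothBall d R) {x : E d} (hx : x ∈ closedBall (0 : E d) R) :
    (a • u) x = a * u x := by simp only [toFun_apply _ hx]; rfl
theorem one_apply {x : E d} (hx : x ∈ closedBall (0 : E d) R) :
    (1 : SmoothBall d R) x = 1 := by simp only [toFun_apply _ hx]; rfl
theorem zero_apply {x : E d} (hx : x ∈ closedBall (0 : E d) R) :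
    (0 : SmoothBall d R) x = 0 := by simp only [toFun_apply _ hx]; rfl

/-- Evaluation at a point of the closed ball. -/
def evalHom (x : E d) (hx : x ∈ closedBall (0 : E d) R) : SmoothBall d R →ₐ[ℂ] ℂ :=
  (Pi.evalAlgHom ℂ (fun _ : closedBall (0 : E d) R => ℂ) ⟨x, hx⟩).comp (smoothSubalgebra d R).val

theorem evalHom_apply {x : E d} (hx : x ∈ closedBall (0 : E d) R) (u : SmoothBall d R) :
    evalHom x hx u = u x := (toFun_apply u hx).symm

theorem sum_apply {ι : Type*} (s : Finset ι) (u : ι → SmoothBall d R) {x : E d}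
    (hx : x ∈ closedBall (0 : E d) R) : (∑ i ∈ s, u i : SmoothBall d R) x = ∑ i ∈ s, u i x := by
  simp only [← evalHom_apply hx, map_sum]

theorem pow_apply (u : SmoothBall d R) (n : ℕ) {x : E d}
    (hx : x ∈ closedBall (0 : E d) R) : (u ^ n) x = u x ^ n := by
  simp only [← evalHom_apply hx, map_pow]

theorem contDiffOn_partialB (hR : 0 < R) (i : Fin d) {u : E d → ℂ}
    (hu : ContDiffOn ℝ ∞ u (closedBall 0 R)) : ContDiffOn ℝ ∞ (partialB R i u) (closedBall 0 R) :=
  (hu.fderivWithin (uniqueDiffOn_closedBall hR) (by simp)).clm_apply contDiffOn_const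

theorem partialB_congr {i : Fin d} {u v : E d → ℂ} (h : EqOn u v (closedBall 0 R)) :
    EqOn (partialB R i u) (partialB R i v) (closedBall 0 R) := fun x hx => by
  rw [partialB, partialB, fderivWithin_congr h (h hx)]

theorem two_le_infty : (2 : WithTop ℕ∞) ≤ ∞ :=
  WithTop.coe_le_coe.2 (le_top : (2 : ℕ∞) ≤ ⊤)

theorem contDiffOn_conj (u : SmoothBall d R) :
    ContDiffOn ℝ ∞ (fun x => conj (u x)) (closedBall 0 R) :=
  Complex.conjCLE.contDiff.comp_contDiffOn u.contDiffOn

variable [hR : Fact (0 < R)]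

/-- The partial derivatives as derivations. -/
def der (i : Fin d) : Derivation ℂ (SmoothBall d R) (SmoothBall d R) :=
  Derivation.mk'
    { toFun := fun u => mk (partialB R i u) (contDiffOn_partialB hR.out i u.contDiffOn)
      map_add' := fun u v => ext fun x hx => by
        rw [add_apply _ _ hx, mk_apply _ hx, mk_apply _ hx, mk_apply _ hx,
          partialB_congr (v := fun x => u x + v x) (fun y hy => add_apply u v hy) hx]
        simp only [partialB]
        rw [fderivWithin_fun_add (uniqueDiffOn_closedBall hR.out x hx) (u.differentiableOn x hx)
          (v.differentiableOn x hx)]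
        rfl
      map_smul' := fun a u => ext fun x hx => by
        rw [RingHom.id_apply, smul_apply _ _ hx, mk_apply _ hx, mk_apply _ hx,
          partialB_congr (v := fun x => a • u x) (fun y hy => smul_apply a u hy) hx]
        simp only [partialB]
        rw [fderivWithin_fun_const_smul (uniqueDiffOn_closedBall hR.out x hx)
          (u.differentiableOn x hx)]
        rfl }
    (fun u v => ext fun x hx => by
      simp only [LinearMap.coe_mk, AddHom.coe_mk, smul_eq_mul]
      rw [add_apply _ _ hx, mul_apply _ _ hx, mul_apply _ _ hx, mk_apply _ hx, mk_apply _ hx,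
        mk_apply _ hx, partialB_congr (v := fun x => u x * v x) (fun y hy => mul_apply u v hy) hx]
      simp only [partialB]
      rw [fderivWithin_fun_mul (uniqueDiffOn_closedBall hR.out x hx) (u.differentiableOn x hx)
          (v.differentiableOn x hx)]
      rfl)

theorem der_apply (i : Fin d) (u : SmoothBall d R) {x : E d} (hx : x ∈ closedBall (0 : E d) R) :
    der i u x = partialB R i u x :=
  mk_apply (contDiffOn_partialB hR.out i u.contDiffOn) hx

theorem der_mk (i : Fin d) {u : E d → ℂ} (hu : ContDiffOn ℝ ∞ u (closedBall 0 R)) :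
    der i (mk u hu) = mk (partialB R i u) (contDiffOn_partialB hR.out i hu) :=
  mk_congr (contDiffOn_partialB hR.out i (mk u hu).contDiffOn) _
    (partialB_congr fun _ hx => mk_apply hu hx)

/-- Symmetry of the second derivative survives on the sphere because every point of the closed ball
is in the closure of the interior. -/
theorem der_comm (i j : Fin d) (u : SmoothBall d R) : der i (der j u) = der j (der i u) := by
  have hun := uniqueDiffOn_closedBall (d := d) hR.out
  have key : ∀ i j : Fin d, ∀ x ∈ closedBall (0 : E d) R, der i (der j u) x =
      fderivWithin ℝ (fderivWithin ℝ u (closedBall 0 R)) (closedBall 0 R) x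
        (EuclideanSpace.single i 1) (EuclideanSpace.single j 1) := by
    intro i j x hx
    rw [der_apply _ _ hx, partialB_congr (fun y hy => der_apply j u hy) hx]
    have hd : DifferentiableWithinAt ℝ (fderivWithin ℝ u (closedBall 0 R)) (closedBall 0 R) x :=
      ((u.contDiffOn.fderivWithin (m := 1) hun
        (one_add_one_eq_two.trans_le two_le_infty)).differentiableOn
        (by simp)) x hx
    simp only [partialB]
    rw [fderivWithin_clm_apply (hun x hx) hd (differentiableWithinAt_const _)]
    simp
  refine ext fun x hx => ?_
  rw [key i j x hx, key j i x hx]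
  refine ((u.contDiffOn x hx).isSymmSndFDerivWithinAt (by simpa using two_le_infty) hun ?_ hx) _ _
  rw [interior_closedBall _ hR.out.ne', closure_ball _ hR.out.ne']
  exact hx

/-- Complex conjugation. -/
def cj : SmoothBall d R →+* SmoothBall d R where
  toFun u := mk (fun x => conj (u x)) u.contDiffOn_conj
  map_one' := ext fun x hx => by rw [mk_apply _ hx, one_apply hx, map_one]
  map_zero' := ext fun x hx => by rw [mk_apply _ hx, zero_apply hx, map_zero]
  map_mul' u v := ext fun x hx => by
    rw [mul_apply _ _ hx, mk_apply _ hx, mk_apply _ hx, mk_apply _ hx, mul_apply _ _ hx, map_mul]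
  map_add' u v := ext fun x hx => by
    rw [add_apply _ _ hx, mk_apply _ hx, mk_apply _ hx, mk_apply _ hx, add_apply _ _ hx, map_add]

omit hR in
theorem cj_apply (u : SmoothBall d R) {x : E d} (hx : x ∈ closedBall (0 : E d) R) :
    cj u x = conj (u x) :=
  mk_apply u.contDiffOn_conj hx

omit hR in
theorem cj_cj (u : SmoothBall d R) : cj (cj u) = u :=
  ext fun x hx => by rw [cj_apply _ hx, cj_apply _ hx, Complex.conj_conj]

theorem der_cj (i : Fin d) (u : SmoothBall d R) : der i (cj u) = cj (der i u) := by
  refine ext fun x hx => ?_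
  rw [cj_apply _ hx, der_apply _ _ hx, der_apply _ _ hx,
    partialB_congr (v := fun x => conj (u x)) (fun y hy => cj_apply u hy) hx]
  have := (Complex.conjCLE.toContinuousLinearMap.hasFDerivAt.comp_hasFDerivWithinAt x
    (u.differentiableOn x hx).hasFDerivWithinAt).fderivWithin
      (uniqueDiffOn_closedBall hR.out x hx)
  simp only [partialB]
  simp only [Function.comp_def] at this
  erw [this]
  rfl

end SmoothBall
end WaveFlow
end

/-! ### Ball and sphere integrals as linear functionals; the divergence theorem. -/

noncomputable section

namespace WaveFlow

open MeasureTheory Set Metric Filter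

namespace SmoothBall

variable {d : ℕ} {R : ℝ}

theorem integrableOn (u : SmoothBall d R) : IntegrableOn u (ball 0 R) :=
  integrableOn_ball_of_continuousOn u.continuousOn

/-- The integral over the ball. -/
def ballInt : SmoothBall d R →ₗ[ℂ] ℂ where
  toFun u := ∫ x in ball (0 : E d) R, u x
  map_add' u v := by
    rw [← integral_add u.integrableOn v.integrableOn]
    exact setIntegral_congr_fun measurableSet_ball fun x hx =>
      add_apply u v (ball_subset_closedBall hx)
  map_smul' a u := by
    rw [RingHom.id_apply, smul_eq_mul, ← integral_const_mul]
    exact setIntegral_congr_fun measurableSet_ball fun x hx =>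
      smul_apply a u (ball_subset_closedBall hx)

theorem ballInt_apply (u : SmoothBall d R) : ballInt u = ∫ x in ball (0 : E d) R, u x := rfl

theorem ballInt_congr {u : SmoothBall d R} {v : E d → ℂ}
    (h : ∀ x ∈ closedBall (0 : E d) R, u x = v x) : ∫ x in ball (0 : E d) R, v x = ballInt u :=
  setIntegral_congr_fun measurableSet_ball fun x hx => (h x (ball_subset_closedBall hx)).symm

theorem ballInt_cj (u : SmoothBall d R) : ballInt (cj u) = conj (ballInt u) := by
  rw [ballInt_apply, ballInt_apply, ← integral_conj]
  exact setIntegral_congr_fun measurableSet_ball fun x hx =>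
    cj_apply u (ball_subset_closedBall hx)

theorem ballInt_re (u : SmoothBall d R) :
    (ballInt u).re = ∫ x in ball (0 : E d) R, (u x).re :=
  (integral_re (𝕜 := ℂ) u.integrableOn).symm

theorem ballInt_re_mono {u v : SmoothBall d R}
    (h : ∀ x ∈ closedBall (0 : E d) R, (u x).re ≤ (v x).re) :
    (ballInt u).re ≤ (ballInt v).re := by
  rw [ballInt_re, ballInt_re]
  exact setIntegral_mono_on u.integrableOn.re v.integrableOn.re measurableSet_ball
    fun x hx => h x (ball_subset_closedBall hx)

variable [hR : Fact (0 < R)]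

omit hR in
theorem mem_closedBall_of_norm_eq {x : E d} (hx : ‖x‖ = R) : x ∈ closedBall (0 : E d) R := by
  simp [hx]

theorem norm_smul_sphere (y : sphere (0 : E d) 1) : ‖R • (y : E d)‖ = R := by
  simp [norm_smul, abs_of_pos hR.out]

theorem integrable_sphere (u : SmoothBall d R) :
    Integrable (fun y : sphere (0 : E d) 1 => u (R • (y : E d)))
      ((volume : Measure (E d)).toSphere) := by
  refine Continuous.integrable_of_hasCompactSupport ?_ (HasCompactSupport.of_compactSpace _)
  rw [← continuousOn_univ]
  exact u.continuousOn.comp (by fun_prop)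
    fun y _ => mem_closedBall_of_norm_eq (norm_smul_sphere y)

theorem sphereIntegral_congr {F : Type} [NormedAddCommGroup F] [NormedSpace ℝ F]
    {u v : E d → F} (h : ∀ x, ‖x‖ = R → u x = v x) :
    sphereIntegral R u = sphereIntegral R v := by
  rw [sphereIntegral, sphereIntegral]
  congr 2
  ext y
  exact h _ (norm_smul_sphere y)

/-- The integral over the boundary of the ball. -/
def sphereInt : SmoothBall d R →ₗ[ℂ] ℂ where
  toFun u := sphereIntegral R u
  map_add' u v := by
    rw [sphereIntegral_congr (v := fun x => u x + v x)
      (fun x hx => add_apply u v (mem_closedBall_of_norm_eq hx)), sphereIntegral, sphereIntegral,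
      sphereIntegral, ← smul_add, ← integral_add u.integrable_sphere v.integrable_sphere]
  map_smul' a u := by
    rw [sphereIntegral_congr (v := fun x => a * u x)
      (fun x hx => smul_apply a u (mem_closedBall_of_norm_eq hx)), sphereIntegral, sphereIntegral,
      integral_const_mul, RingHom.id_apply, smul_eq_mul, mul_smul_comm]

theorem sphereInt_apply (u : SmoothBall d R) : sphereInt u = sphereIntegral R u := rfl

theorem sphereInt_congr {u : SmoothBall d R} {v : E d → ℂ}
    (h : ∀ x, ‖x‖ = R → u x = v x) : sphereIntegral R v = sphereInt u :=
  sphereIntegral_congr fun x hx => (h x hx).symm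

theorem sphereInt_eq {u v : SmoothBall d R}
    (h : ∀ x, ‖x‖ = R → u x = v x) : sphereInt u = sphereInt v :=
  sphereIntegral_congr h

theorem sphereInt_cj (u : SmoothBall d R) : sphereInt (cj u) = conj (sphereInt u) := by
  rw [sphereInt_apply, sphereInt_apply,
    sphereIntegral_congr (fun x hx => cj_apply u (mem_closedBall_of_norm_eq hx)),
    sphereIntegral, sphereIntegral, integral_conj, Complex.real_smul, Complex.real_smul, map_mul,
    Complex.conj_ofReal]

theorem sphereInt_re (u : SmoothBall d R) :
    (sphereInt u).re = sphereIntegral R (fun x => (u x).re) := by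
  rw [sphereInt_apply, sphereIntegral, sphereIntegral, Complex.smul_re]
  congr 1
  exact (integral_re (𝕜 := ℂ) u.integrable_sphere).symm

theorem sphereInt_re_mono {u v : SmoothBall d R}
    (h : ∀ x, ‖x‖ = R → (u x).re ≤ (v x).re) :
    (sphereInt u).re ≤ (sphereInt v).re := by
  rw [sphereInt_re, sphereInt_re, sphereIntegral, sphereIntegral]
  refine smul_le_smul_of_nonneg_left ?_ (pow_nonneg hR.out.le _)
  exact integral_mono u.integrable_sphere.re v.integrable_sphere.re
    fun y => h _ (norm_smul_sphere y)

omit hR in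
theorem contDiffOn_coord (i : Fin d) :
    ContDiffOn ℝ ∞ (fun x : E d => ((x i : ℝ) : ℂ)) (closedBall 0 R) :=
  (Complex.ofRealCLM.contDiff.comp
    (EuclideanSpace.proj i : E d →L[ℝ] ℝ).contDiff).contDiffOn

/-- The coordinate functions. -/
def coord (i : Fin d) : SmoothBall d R := mk (fun x => ((x i : ℝ) : ℂ)) (contDiffOn_coord i)

omit hR in
theorem coord_apply (i : Fin d) {x : E d} (hx : x ∈ closedBall (0 : E d) R) :
    (coord i : SmoothBall d R) x = ((x i : ℝ) : ℂ) := mk_apply (contDiffOn_coord i) hx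

theorem der_coord (i j : Fin d) : der i (coord j : SmoothBall d R) = if i = j then 1 else 0 := by
  refine ext fun x hx => ?_
  rw [coord, der_mk, mk_apply _ hx, partialB]
  have := ((Complex.ofRealCLM.comp (EuclideanSpace.proj j : E d →L[ℝ] ℝ)).hasFDerivAt (x := x)).hasFDerivWithinAt.fderivWithin
      (uniqueDiffOn_closedBall hR.out x hx)
  have h2 := DFunLike.congr_fun this (EuclideanSpace.single i 1)
  refine h2.trans ?_
  by_cases h : i = j
  · simp [h, one_apply hx]
  · simp [h, zero_apply hx]

omit hR in
theorem cj_coord (i : Fin d) : cj (coord i : SmoothBall d R) = coord i :=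
  ext fun x hx => by rw [cj_apply _ hx, coord_apply _ hx, Complex.conj_ofReal]

/-- The Euler operator `ξ^i ∂_i`. -/
def euler (u : SmoothBall d R) : SmoothBall d R := ∑ i, coord i * der i u

theorem euler_mul (u v : SmoothBall d R) : euler (u * v) = u * euler v + v * euler u := by
  simp only [euler, Derivation.leibniz, smul_eq_mul, mul_add, Finset.sum_add_distrib,
    Finset.mul_sum]
  congr 1 <;> exact Finset.sum_congr rfl fun i _ => by ring

theorem euler_apply (u : SmoothBall d R) {x : E d} (hx : x ∈ closedBall (0 : E d) R) :
    euler u x = fderivWithin ℝ u (closedBall 0 R) x x := by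
  have hsum : x = ∑ i, x i • EuclideanSpace.single i (1 : ℝ) := by
    conv_lhs => rw [← (EuclideanSpace.basisFun (Fin d) ℝ).sum_repr x]
    simp
  rw [euler, sum_apply _ _ hx]
  conv_rhs => enter [2]; rw [hsum]
  rw [map_sum]
  refine Finset.sum_congr rfl fun i _ => ?_
  rw [map_smul, mul_apply _ _ hx, coord_apply _ hx, der_apply _ _ hx, Complex.real_smul]
  rfl

variable [NeZero d]

theorem ballInt_radial (u : SmoothBall d R) :
    ballInt ((d : ℂ) • u + euler u) = R * sphereInt u := by
  rw [sphereInt_apply, ← integral_ball_radial hR.out u.contDiffOn_one]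
  refine (ballInt_congr fun x hx => ?_).symm
  rw [add_apply _ _ hx, smul_apply _ _ hx, euler_apply _ hx]

theorem ballInt_der_eq_zero (i : Fin d) (u : SmoothBall d R) (h0 : ∀ x, ‖x‖ = R → u x = 0) :
    ballInt (der i u) = 0 := by
  rw [← integral_ball_fderivWithin_eq_zero hR.out u.contDiffOn_one h0 (EuclideanSpace.single i 1)]
  exact (ballInt_congr fun x hx => der_apply i u hx).symm

/-- The function `|ξ|² / R²`. -/
def radSq : SmoothBall d R := ((R : ℂ) ^ 2)⁻¹ • ∑ i, coord i ^ 2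

omit hR [NeZero d] in
theorem radSq_apply {x : E d} (hx : x ∈ closedBall (0 : E d) R) :
    (radSq : SmoothBall d R) x = ((‖x‖ ^ 2 / R ^ 2 : ℝ) : ℂ) := by
  rw [radSq, smul_apply _ _ hx, sum_apply _ _ hx, EuclideanSpace.norm_sq_eq]
  simp only [pow_apply _ _ hx, coord_apply _ hx, Real.norm_eq_abs, sq_abs]
  push_cast
  rw [inv_mul_eq_div]

omit [NeZero d] in
theorem der_radSq (i : Fin d) :
    der i (radSq : SmoothBall d R) = ((R : ℂ) ^ 2)⁻¹ • ((2 : ℂ) • coord i) := by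
  rw [radSq, Derivation.map_smul, map_sum]
  congr 1
  have : ∀ j, der i ((coord j : SmoothBall d R) ^ 2) = if i = j then (2 : ℂ) • coord i else 0 := by
    intro j
    rw [Derivation.leibniz_pow, der_coord]
    by_cases h : i = j
    · subst h
      simp [two_smul]
    · simp [h]
  simp [this]

omit [NeZero d] in
theorem euler_radSq : euler (radSq : SmoothBall d R) = (2 : ℂ) • radSq := by
  simp only [euler, der_radSq]
  rw [radSq, smul_comm, Finset.smul_sum, Finset.smul_sum]
  refine Finset.sum_congr rfl fun i _ => ?_
  rw [Algebra.mul_smul_comm, Algebra.mul_smul_comm, sq (coord i)]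

omit [NeZero d] in
theorem euler_radSq_pow (n : ℕ) :
    euler ((radSq : SmoothBall d R) ^ n) = (2 * n : ℂ) • radSq ^ n := by
  induction n with
  | zero => simp [euler]
  | succ n ih =>
    rw [pow_succ, euler_mul, ih, euler_radSq, Algebra.mul_smul_comm, Algebra.mul_smul_comm,
      mul_comm radSq, ← add_smul]
    congr 1
    push_cast
    ring

-- Dominated convergence: `radSq < 1` in the open ball. This lets the powers of `radSq` serve as
-- cutoffs concentrating on the sphere.
omit [NeZero d] in
theorem tendsto_ballInt_radSq_pow (u : SmoothBall d R) :
    Tendsto (fun n : ℕ => ballInt (radSq ^ n * u)) atTop (nhds 0) := by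
  have h := tendsto_integral_of_dominated_convergence (μ := volume.restrict (ball (0 : E d) R))
    (F := fun (n : ℕ) x => (radSq ^ n * u : SmoothBall d R) x) (f := fun _ => 0)
    (fun x => ‖u x‖) (fun n => (integrableOn _).aestronglyMeasurable) u.integrableOn.norm ?_ ?_
  · simpa [ballInt_apply] using h
  · intro n
    refine (ae_restrict_iff' measurableSet_ball).2 (Eventually.of_forall fun x hx => ?_)
    have hx' := ball_subset_closedBall hx
    have hxR : ‖x‖ ≤ R := by simpa using hx'
    rw [mul_apply _ _ hx', pow_apply _ _ hx', radSq_apply hx', norm_mul, norm_pow,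
      Complex.norm_real, Real.norm_of_nonneg (by positivity), ← div_pow]
    refine mul_le_of_le_one_left (norm_nonneg _) (pow_le_one₀ (by positivity) ?_)
    exact pow_le_one₀ (div_nonneg (norm_nonneg _) hR.out.le) ((div_le_one hR.out).2 hxR)
  · refine (ae_restrict_iff' measurableSet_ball).2 (Eventually.of_forall fun x hx => ?_)
    have hx' := ball_subset_closedBall hx
    have hxR : ‖x‖ < R := by simpa using hx
    have hq : Tendsto (fun n : ℕ => ((‖x‖ ^ 2 / R ^ 2 : ℝ) : ℂ) ^ n * u x) atTop
        (nhds (0 * u x)) := by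
      refine (tendsto_pow_atTop_nhds_zero_of_norm_lt_one ?_).mul_const _
      rw [Complex.norm_real, Real.norm_of_nonneg (by positivity), ← div_pow]
      exact pow_lt_one₀ (div_nonneg (norm_nonneg _) hR.out.le) ((div_lt_one hR.out).2 hxR)
        two_ne_zero
    rw [zero_mul] at hq
    refine hq.congr fun n => ?_
    rw [mul_apply _ _ hx', pow_apply _ _ hx', radSq_apply hx']

/-- The divergence theorem on the ball. -/
theorem ballInt_der (i : Fin d) (u : SmoothBall d R) :
    ballInt (der i u) = (R : ℂ)⁻¹ * sphereInt (coord i * u) := by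
  have hR0 : (R : ℂ) ≠ 0 := by exact_mod_cast hR.out.ne'
  set v : SmoothBall d R := coord i * u with hv
  -- The function `(1 - radSq ^ (n + 1)) u` vanishes on the sphere, so its derivative has mean zero.
  -- The derivative of the cutoff contributes `2(n + 1) R⁻² radSq ^ n v`, whose integral is computed
  -- by the radial divergence theorem for `radSq ^ n v`. The factor `n` is absorbed there, and every
  -- remaining volume integral carries a power of `radSq` and tends to zero.
  have hid : ∀ n : ℕ, ballInt (der i u) = ballInt (radSq ^ (n + 1) * der i u)
      + ((R : ℂ) ^ 2)⁻¹ * (R * sphereInt v - ballInt (radSq ^ n * ((d : ℂ) • v + euler v))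
        + 2 * ballInt (radSq ^ n * v)) := by
    intro n
    have h1 := ballInt_der_eq_zero i ((1 - radSq ^ (n + 1)) * u) (fun x hx => by
      have hx' := mem_closedBall_of_norm_eq hx
      rw [mul_apply _ _ hx', sub_apply _ _ hx', one_apply hx', pow_apply _ _ hx', radSq_apply hx',
        hx, div_self (pow_ne_zero 2 hR.out.ne')]
      simp)
    have h2 : der i ((1 - radSq ^ (n + 1)) * u) = der i u - radSq ^ (n + 1) * der i u
        - (((R : ℂ) ^ 2)⁻¹ * (2 * (n + 1))) • (radSq ^ n * v) := by
      rw [Derivation.leibniz, map_sub, Derivation.leibniz_pow, der_radSq, hv]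
      simp only [smul_eq_mul, nsmul_eq_mul]
      simp only [Algebra.smul_def, map_mul, map_add, map_one,
        map_natCast, Derivation.map_one_eq_zero, Nat.add_sub_cancel]
      push_cast
      ring
    have h3 := ballInt_radial (radSq ^ n * v)
    rw [euler_mul, euler_radSq_pow] at h3
    have h4 : sphereInt (radSq ^ n * v) = sphereInt v := sphereInt_eq fun x hx => by
      have hx' := mem_closedBall_of_norm_eq hx
      rw [mul_apply _ _ hx', pow_apply _ _ hx', radSq_apply hx', hx,
        div_self (pow_ne_zero 2 hR.out.ne')]
      simp
    rw [h4] at h3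
    rw [h2, map_sub, map_sub, map_smul, smul_eq_mul] at h1
    rw [mul_add (radSq ^ n), map_add, Algebra.mul_smul_comm, map_smul, smul_eq_mul]
    rw [Algebra.mul_smul_comm, map_add, map_add, map_smul, map_smul, smul_eq_mul, smul_eq_mul,
      mul_comm v] at h3
    linear_combination h1 + ((R : ℂ) ^ 2)⁻¹ * h3
  have hlim : Tendsto (fun n : ℕ => ballInt (radSq ^ (n + 1) * der i u)
      + ((R : ℂ) ^ 2)⁻¹ * (R * sphereInt v - ballInt (radSq ^ n * ((d : ℂ) • v + euler v))
        + 2 * ballInt (radSq ^ n * v))) atTop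
      (nhds (0 + ((R : ℂ) ^ 2)⁻¹ * (R * sphereInt v - 0 + 2 * 0))) :=
    ((tendsto_add_atTop_iff_nat 1).2 (tendsto_ballInt_radSq_pow (der i u))).add
      (((tendsto_const_nhds.sub (tendsto_ballInt_radSq_pow _)).add
        ((tendsto_ballInt_radSq_pow v).const_mul 2)).const_mul _)
  have := tendsto_nhds_unique (tendsto_const_nhds.congr hid) hlim
  rw [this]
  field_simp
  ring

end SmoothBall
end WaveFlow
end

/-! ### Commutator and energy identities in an abstract differential ring. -/

noncomputable section

namespace WaveFlow

/-- A commutative algebra with commuting derivations, coordinates `ξ i` and a height function `h`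
for which `w = 1 - ∂^i h ∂_i h` is invertible. -/
structure HeightAlgebra (d : ℕ) (A : Type*) [CommRing A] [Algebra ℂ A] where
  /-- the partial derivatives -/
  D : Fin d → Derivation ℂ A A
  /-- the coordinates -/
  ξ : Fin d → A
  /-- the height function -/
  h : A
  /-- the inverse of `1 - ∂^i h ∂_i h` -/
  winv : A
  D_comm : ∀ i j u, D i (D j u) = D j (D i u)
  D_ξ : ∀ i j, D i (ξ j) = if i = j then 1 else 0
  w_mul_winv : (1 - ∑ i, D i h * D i h) * winv = 1

namespace HeightAlgebra

variable {d : ℕ} {A : Type*} [CommRing A] [Algebra ℂ A] (S : HeightAlgebra d A)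

/-- The Laplacian. -/
def lap (u : A) : A := ∑ i, S.D i (S.D i u)

/-- The product of gradients. -/
def Γ (u v : A) : A := ∑ i, S.D i u * S.D i v

/-- The Euler operator. -/
def eul (u : A) : A := ∑ i, S.ξ i * S.D i u

/-- The coefficient `w`. -/
def w : A := 1 - S.Γ S.h S.h

/-- The coefficient `c`. -/
def c : A := S.eul S.h - S.h

theorem w_winv : S.w * S.winv = 1 := S.w_mul_winv

/-- The second time derivative according to the wave equation. -/
def X (f : A × A) : A := S.winv * (S.lap f.1 - S.lap S.h * f.2 - 2 * S.Γ S.h f.2)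

/-- The wave evolution operator. -/
def L (f : A × A) : A × A :=
  (-S.eul f.1 + S.c * f.2, -f.2 - S.eul f.2 + S.c * S.X f)

/-- The time derivative. -/
def DT (f : A × A) : A × A := (f.2, S.X f)

/-- The spatial derivatives. -/
def DX (i : Fin d) (f : A × A) : A × A :=
  (S.D i f.1 - S.D i S.h * f.2, S.D i f.2 - S.D i S.h * S.X f)

section rules

variable (u v t : A) (i : Fin d)

theorem D_mul : S.D i (u * v) = u * S.D i v + v * S.D i u := (S.D i).leibniz u v

theorem eul_sub : S.eul (u - v) = S.eul u - S.eul v := by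
  simp [eul, mul_sub, Finset.sum_sub_distrib]

theorem eul_mul : S.eul (u * v) = u * S.eul v + v * S.eul u := by
  simp only [eul, D_mul, Finset.mul_sum, ← Finset.sum_add_distrib]
  exact Finset.sum_congr rfl fun i _ => by ring

theorem D_two : S.D i 2 = 0 := by
  rw [← one_add_one_eq_two, map_add, Derivation.map_one_eq_zero, add_zero]

theorem eul_two : S.eul 2 = 0 := by
  simp [eul, D_two]

theorem lap_add : S.lap (u + v) = S.lap u + S.lap v := by
  simp [lap, Finset.sum_add_distrib]

theorem lap_sub : S.lap (u - v) = S.lap u - S.lap v := by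
  simp [lap, Finset.sum_sub_distrib]

theorem lap_neg : S.lap (-u) = -S.lap u := by
  simp [lap]

theorem lap_mul : S.lap (u * v) = u * S.lap v + v * S.lap u + 2 * S.Γ u v := by
  simp only [lap, Γ, D_mul, map_add, Finset.mul_sum, ← Finset.sum_add_distrib]
  exact Finset.sum_congr rfl fun i _ => by ring

theorem Γ_comm : S.Γ u v = S.Γ v u :=
  Finset.sum_congr rfl fun _ _ => mul_comm _ _

theorem Γ_add : S.Γ u (v + t) = S.Γ u v + S.Γ u t := by
  simp [Γ, mul_add, Finset.sum_add_distrib]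

theorem Γ_sub : S.Γ u (v - t) = S.Γ u v - S.Γ u t := by
  simp [Γ, mul_sub, Finset.sum_sub_distrib]

theorem Γ_neg : S.Γ u (-v) = -S.Γ u v := by
  simp [Γ]

theorem Γ_mul : S.Γ u (v * t) = v * S.Γ u t + t * S.Γ u v := by
  simp only [Γ, D_mul, Finset.mul_sum, ← Finset.sum_add_distrib]
  exact Finset.sum_congr rfl fun i _ => by ring

theorem D_eul : S.D i (S.eul u) = S.D i u + S.eul (S.D i u) := by
  simp only [eul, map_sum, D_mul, D_ξ, Finset.sum_add_distrib, mul_ite, mul_one, mul_zero,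
    Finset.sum_ite_eq, Finset.mem_univ, if_true]
  rw [add_comm]
  congr 1
  exact Finset.sum_congr rfl fun j _ => by rw [S.D_comm]

theorem D_lap : S.D i (S.lap u) = S.lap (S.D i u) := by
  simp only [lap, map_sum]
  exact Finset.sum_congr rfl fun j _ => by rw [S.D_comm, S.D_comm i j]

theorem D_Γ : S.D i (S.Γ u v) = S.Γ (S.D i u) v + S.Γ u (S.D i v) := by
  simp only [Γ, map_sum, D_mul, ← Finset.sum_add_distrib]
  exact Finset.sum_congr rfl fun j _ => by rw [S.D_comm i j, S.D_comm i j]; ring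

theorem lap_eul : S.lap (S.eul u) = 2 * S.lap u + S.eul (S.lap u) := by
  have : S.eul (S.lap u) = ∑ i, S.eul (S.D i (S.D i u)) := by
    simp only [eul, lap, map_sum, Finset.mul_sum]
    exact Finset.sum_comm
  rw [this]
  simp only [lap, D_eul, map_add, Finset.sum_add_distrib]
  ring

theorem eul_Γ : S.eul (S.Γ u v) = S.Γ (S.eul u) v + S.Γ u (S.eul v) - 2 * S.Γ u v := by
  have : S.eul (S.Γ u v) = ∑ i, (S.eul (S.D i u) * S.D i v + S.D i u * S.eul (S.D i v)) := by
    have h1 : ∀ i, S.eul (S.D i u) * S.D i v + S.D i u * S.eul (S.D i v)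
        = S.eul (S.D i u * S.D i v) := fun i => by rw [eul_mul]; ring
    simp only [h1]
    simp only [eul, Γ, map_sum, Finset.mul_sum]
    exact Finset.sum_comm
  rw [this]
  simp only [Γ, D_eul, Finset.mul_sum, ← Finset.sum_add_distrib, ← Finset.sum_sub_distrib]
  exact Finset.sum_congr rfl fun j _ => by ring

theorem sum_D_ξ_mul : ∑ i, S.D i (S.ξ i * u) = d * u + S.eul u := by
  simp only [D_mul, D_ξ, if_true, mul_one, Finset.sum_add_distrib, eul]
  simp [add_comm]

theorem sum_D_mul_D : ∑ i, S.D i (u * S.D i v) = S.Γ u v + u * S.lap v := by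
  simp only [D_mul, Finset.sum_add_distrib, Γ, lap, Finset.mul_sum]
  rw [add_comm]
  congr 1
  exact Finset.sum_congr rfl fun j _ => mul_comm _ _

end rules

theorem w_mul_X (f : A × A) :
    S.w * S.X f = S.lap f.1 - S.lap S.h * f.2 - 2 * S.Γ S.h f.2 := by
  rw [X, ← mul_assoc, w_winv, one_mul]

theorem cancel_w {u v : A} (huv : S.w * u = S.w * v) : u = v := by
  linear_combination S.winv * huv - (u - v) * S.w_winv

/-- This is the second component of `DT (DX i f) = DX i (DT f)`: the Cartesian derivatives commute.
It is the wave equation `w_mul_X` differentiated by `D i`. -/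
theorem X_DX (i : Fin d) (f : A × A) :
    S.X (S.DX i f) = S.D i (S.X f) - S.D i S.h * S.X (S.DT f) := by
  -- Multiplied by `w`, the claim involves only the equation for `w X` and its derivative, so `winv`
  -- is never differentiated.
  apply S.cancel_w
  have h0 := congrArg (S.D i) (S.w_mul_X f)
  have h1 := S.w_mul_X (S.DT f)
  simp only [w, DT, D_mul, map_sub, D_Γ, D_lap, D_two,
    Derivation.map_one_eq_zero] at h0 h1
  rw [w_mul_X]
  simp only [DX, lap_sub, lap_mul, Γ_sub, Γ_mul, w, DT]
  rw [S.Γ_comm (S.D i S.h) S.h] at h0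
  linear_combination -h0 + S.D i S.h * h1

/-- The same method with `eul` in place of `D i`. The term `-2 X f` reflects that the Laplacian has
degree two under scaling; this is what gives both components of `L` the same commutator with `DT`.
-/
theorem X_L (f : A × A) :
    S.X (S.L f) = -2 * S.X f - S.eul (S.X f) + S.c * S.X (S.DT f) := by
  apply S.cancel_w
  have h := S.w_mul_X f
  have h0 := congrArg S.eul h
  have h1 := S.w_mul_X (S.DT f)
  have he1 : S.eul 1 = 0 := by simp [eul]
  have hc := S.Γ_comm S.h (S.eul S.h)
  simp only [w, DT, eul_mul, eul_sub, eul_two, eul_Γ, he1] at h h0 h1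
  rw [w_mul_X]
  simp only [L, lap_add, lap_sub, lap_neg, lap_mul, lap_eul, Γ_add, Γ_sub, Γ_neg, Γ_mul, w, DT, c]
  have hsub : S.Γ (S.eul S.h - S.h) f.2 = S.Γ (S.eul S.h) f.2 - S.Γ S.h f.2 := by
    rw [Γ_comm, Γ_sub, Γ_comm, S.Γ_comm f.2]
  rw [hsub]
  linear_combination (2 * h) + h0 - (S.eul S.h - S.h) * h1 - S.X f * hc

theorem DT_L (f : A × A) : S.DT (S.L f) = S.L (S.DT f) - S.DT f := by
  refine Prod.ext ?_ ?_
  · simp only [DT, L, Prod.fst_sub]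
    ring
  · rw [DT, Prod.snd_sub, X_L]
    simp only [L, DT]
    ring

theorem D_c (i : Fin d) : S.D i S.c = S.eul (S.D i S.h) := by
  rw [c, map_sub, D_eul]
  ring

/-- The Euler part of `L` gives the shift by `-DX i f` through `D_eul`. The terms from
differentiating the coefficients cancel because `D i c` is the Euler derivative of `D i h`. -/
theorem DX_L (i : Fin d) (f : A × A) : S.DX i (S.L f) = S.L (S.DX i f) - S.DX i f := by
  refine Prod.ext ?_ ?_
  · simp only [DX, L, Prod.fst_sub, map_add, map_neg, D_mul, D_eul, eul_sub, eul_mul, D_c]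
    ring
  · rw [DX, Prod.snd_sub, X_L]
    simp only [L, X_DX]
    simp only [DX, map_add, map_sub, map_neg, D_mul, D_eul, eul_sub, eul_mul, D_c]
    ring

/-- The density of the first energy. -/
def density (f g : A × A) : A := S.Γ f.1 g.1 + S.w * (f.2 * g.2)

/-- The energy flux. -/
def flux (f g : A × A) (i : Fin d) : A :=
  -(S.ξ i * S.Γ f.1 g.1) + S.c * (f.2 * S.D i g.1 + g.2 * S.D i f.1)
    - (S.w * S.ξ i + 2 * S.c * S.D i S.h) * (f.2 * g.2)

/-- The flux is sorted into fields of the form `u ξ` and `u ∂v`, whose divergences are `sum_D_ξ_mul`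
and `sum_D_mul_D`. -/
theorem sum_D_flux (f g : A × A) :
    ∑ i, S.D i (S.flux f g i) = -(d * S.Γ f.1 g.1 + S.eul (S.Γ f.1 g.1))
      + (S.Γ (S.c * f.2) g.1 + S.c * f.2 * S.lap g.1)
      + (S.Γ (S.c * g.2) f.1 + S.c * g.2 * S.lap f.1)
      - (d * (S.w * (f.2 * g.2)) + S.eul (S.w * (f.2 * g.2)))
      - 2 * (S.Γ (S.c * (f.2 * g.2)) S.h + S.c * (f.2 * g.2) * S.lap S.h) := by
  rw [← sum_D_ξ_mul, ← sum_D_ξ_mul, ← sum_D_mul_D, ← sum_D_mul_D, ← sum_D_mul_D]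
  simp only [← Finset.sum_neg_distrib, Finset.mul_sum, ← Finset.sum_add_distrib,
    ← Finset.sum_sub_distrib]
  refine Finset.sum_congr rfl fun i _ => ?_
  have h2 : ∀ u, 2 * S.D i u = S.D i (2 * u) := fun u => by rw [D_mul, D_two]; ring
  rw [h2, ← map_neg, ← map_add, ← map_add, ← map_sub, ← map_sub]
  congr 1
  rw [flux]
  ring

/-- Energy conservation with the weight `d - 2` due to scaling. The identity is bilinear; putting
the complex conjugate in the first slot gives the hermitian version, since the coefficients are
real. -/
theorem density_L (f g : A × A) :
    S.density f (S.L g) + S.density (S.L f) g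
      = (d - 2) * S.density f g + ∑ i, S.D i (S.flux f g i) := by
  have hf := S.w_mul_X f
  have hg := S.w_mul_X g
  -- Both sides are `-2 ∂_i h eul(∂_i h)`. This relation lets the second derivatives of `h` coming
  -- from `eul w` cancel those coming from the gradient of `c`.
  have hew : S.eul S.w = -2 * S.Γ S.h S.c := by
    have he1 : S.eul 1 = 0 := by simp [eul]
    rw [w, c, eul_sub, he1, eul_Γ, Γ_sub, S.Γ_comm (S.eul S.h) S.h]
    ring
  have hmul : ∀ a b t : A, S.Γ (a * b) t = a * S.Γ t b + b * S.Γ t a := fun a b t => by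
    rw [Γ_comm, Γ_mul]
  have hLg : S.Γ f.1 (S.L g).1 = -S.Γ f.1 (S.eul g.1) + S.c * S.Γ f.1 g.2 + g.2 * S.Γ f.1 S.c := by
    simp only [L, Γ_add, Γ_neg, Γ_mul]
    ring
  have hLf : S.Γ (S.L f).1 g.1 = -S.Γ (S.eul f.1) g.1 + S.c * S.Γ g.1 f.2 + f.2 * S.Γ g.1 S.c := by
    rw [Γ_comm]
    simp only [L, Γ_add, Γ_neg, Γ_mul]
    rw [S.Γ_comm g.1 (S.eul f.1)]
    ring
  rw [sum_D_flux]
  simp only [density, hLg, hLf]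
  simp only [hmul, Γ_mul, eul_Γ, eul_mul, hew, L]
  linear_combination (S.c * f.2) * hg + (S.c * g.2) * hf

end HeightAlgebra
end WaveFlow
end

/-! ### Realising the abstract algebra on the ball and transferring operators and forms to it. -/

noncomputable section

namespace WaveFlow

open MeasureTheory Set Metric Filter

section real

variable {d : ℕ} {R : ℝ}

theorem contDiff_partialR (i : Fin d) {u : E d → ℝ} (hu : ContDiff ℝ ∞ u) :
    ContDiff ℝ ∞ (partialR i u) :=
  (hu.fderiv_right (m := ∞) (by simp)).clm_apply contDiff_const

theorem sum_partialR_sq {h : E d → ℝ} (hh : ContDiff ℝ ∞ h) (x : E d) :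
    ∑ i, partialR i h x * partialR i h x = ‖gradient h x‖ ^ 2 := by
  rw [EuclideanSpace.norm_sq_eq]
  refine Finset.sum_congr rfl fun i _ => ?_
  have h1 := ((hh.differentiable (by simp)) x).hasGradientAt.hasFDerivAt.fderiv
  have h2 : partialR i h x = gradient h x i := by
    rw [partialR, h1, InnerProductSpace.toDual_apply_apply, EuclideanSpace.inner_single_right]
    simp
  rw [← h2, Real.norm_eq_abs, sq_abs, sq]

theorem IsHeightFunction.coeffW_pos {h : E d → ℝ} (hh : IsHeightFunction h) (x : E d) :
    0 < coeffW h x := by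
  rw [coeffW, sum_partialR_sq hh.smooth]
  have := hh.gradient_lt_one x
  have h0 := norm_nonneg (gradient h x)
  nlinarith

theorem contDiff_coeffW {h : E d → ℝ} (hh : ContDiff ℝ ∞ h) : ContDiff ℝ ∞ (coeffW h) :=
  contDiff_const.sub (ContDiff.sum fun i _ => (contDiff_partialR i hh).mul (contDiff_partialR i hh))

end real

namespace SmoothBall

variable {d : ℕ} {R : ℝ}

theorem contDiffOn_ofReal {u : E d → ℝ} (hu : ContDiff ℝ ∞ u) :
    ContDiffOn ℝ ∞ (fun x => (u x : ℂ)) (closedBall 0 R) :=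
  (Complex.ofRealCLM.contDiff.comp hu).contDiffOn

/-- A smooth real function on `ℝ^d`, restricted to the ball. -/
def ofReal (u : E d → ℝ) (hu : ContDiff ℝ ∞ u) : SmoothBall d R :=
  mk (fun x => (u x : ℂ)) (contDiffOn_ofReal hu)

theorem ofReal_apply {u : E d → ℝ} (hu : ContDiff ℝ ∞ u) {x : E d}
    (hx : x ∈ closedBall (0 : E d) R) : (ofReal u hu : SmoothBall d R) x = u x :=
  mk_apply (contDiffOn_ofReal hu) hx

theorem cj_ofReal {u : E d → ℝ} (hu : ContDiff ℝ ∞ u) :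
    cj (ofReal u hu : SmoothBall d R) = ofReal u hu :=
  ext fun x hx => by rw [cj_apply _ hx, ofReal_apply hu hx, Complex.conj_ofReal]

variable [hR : Fact (0 < R)]

theorem der_ofReal (i : Fin d) {u : E d → ℝ} (hu : ContDiff ℝ ∞ u) :
    der i (ofReal u hu : SmoothBall d R) = ofReal (partialR i u) (contDiff_partialR i hu) := by
  refine ext fun x hx => ?_
  rw [ofReal_apply _ hx, ofReal, der_mk, mk_apply _ hx, partialB]
  have hd := (hu.differentiable (by simp) x).hasFDerivAt
  have := (Complex.ofRealCLM.hasFDerivAt.comp x hd).hasFDerivWithinAt.fderivWithin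
      (uniqueDiffOn_closedBall hR.out x hx)
  exact DFunLike.congr_fun this (EuclideanSpace.single i 1)

end SmoothBall

open SmoothBall

variable {d : ℕ} {R : ℝ} [hR : Fact (0 < R)]

/-- The height algebra of smooth functions on the ball. -/
def ballAlgebra (R : ℝ) [hR : Fact (0 < R)] {h : E d → ℝ} (hh : IsHeightFunction h) :
    HeightAlgebra d (SmoothBall d R) where
  D := der
  ξ := coord
  h := ofReal h hh.smooth
  winv := ofReal (fun x => (coeffW h x)⁻¹)
    ((contDiff_coeffW hh.smooth).inv fun x => (hh.coeffW_pos x).ne')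
  D_comm := der_comm
  D_ξ := der_coord
  w_mul_winv := SmoothBall.ext fun x hx => by
    simp only [der_ofReal]
    rw [mul_apply _ _ hx, sub_apply _ _ hx, sum_apply _ _ hx, ofReal_apply _ hx, one_apply hx]
    simp only [mul_apply _ _ hx, ofReal_apply _ hx]
    have h0 : (coeffW h x : ℂ) ≠ 0 := by exact_mod_cast (hh.coeffW_pos x).ne'
    have h1 : (1 - ∑ i, (partialR i h x : ℂ) * (partialR i h x : ℂ)) = (coeffW h x : ℂ) := by
      rw [coeffW]
      push_cast
      rfl
    rw [h1, Complex.ofReal_inv, mul_inv_cancel₀ h0]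

section coefficients

variable {h : E d → ℝ} (hh : IsHeightFunction h) {x : E d} (hx : x ∈ closedBall (0 : E d) R)
include hx

theorem ballAlgebra_D_h_apply (i : Fin d) :
    (ballAlgebra R hh).D i (ballAlgebra R hh).h x = partialR i h x := by
  simp only [ballAlgebra]
  rw [der_ofReal, ofReal_apply _ hx]

theorem ballAlgebra_w_apply : (ballAlgebra R hh).w x = coeffW h x := by
  rw [HeightAlgebra.w, HeightAlgebra.Γ, sub_apply _ _ hx, one_apply hx, sum_apply _ _ hx, coeffW]
  simp only [mul_apply _ _ hx, ballAlgebra_D_h_apply hh hx]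
  push_cast
  rfl

theorem ballAlgebra_c_apply : (ballAlgebra R hh).c x = coeffC h x := by
  rw [HeightAlgebra.c, HeightAlgebra.eul, sub_apply _ _ hx, sum_apply _ _ hx, coeffC]
  simp only [mul_apply _ _ hx, ballAlgebra_D_h_apply hh hx]
  simp only [ballAlgebra, coord_apply _ hx, ofReal_apply _ hx]
  push_cast
  rfl

theorem ballAlgebra_lap_h_apply :
    (ballAlgebra R hh).lap (ballAlgebra R hh).h x = laplacianR h x := by
  rw [HeightAlgebra.lap, sum_apply _ _ hx, laplacianR]
  simp only [ballAlgebra, der_ofReal, ofReal_apply _ hx]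
  push_cast
  rfl

theorem ballAlgebra_winv_apply : (ballAlgebra R hh).winv x = ((coeffW h x)⁻¹ : ℝ) := by
  simp only [ballAlgebra]
  rw [ofReal_apply _ hx]

theorem ballAlgebra_lap_mk_apply {u : E d → ℂ} (hu : ContDiffOn ℝ ∞ u (closedBall 0 R)) :
    (ballAlgebra R hh).lap (mk u hu) x = laplacianB R u x := by
  rw [HeightAlgebra.lap, sum_apply _ _ hx, laplacianB]
  refine Finset.sum_congr rfl fun i _ => ?_
  simp only [ballAlgebra]
  rw [der_mk, der_mk, mk_apply _ hx]

theorem ballAlgebra_D_mk_apply {u : E d → ℂ} (hu : ContDiffOn ℝ ∞ u (closedBall 0 R))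
    (i : Fin d) : (ballAlgebra R hh).D i (mk u hu) x = partialB R i u x := by
  simp only [ballAlgebra]
  rw [der_mk, mk_apply _ hx]

end coefficients

/-- The element of the algebra given by a smooth pair. -/
def toBall {f : Pair d} (hf : SmoothPair R f) : SmoothBall d R × SmoothBall d R :=
  (mk f.1 hf.1, mk f.2 hf.2)

omit hR in
theorem toBall_eq {f : Pair d} (hf : SmoothPair R f) {g : SmoothBall d R × SmoothBall d R}
    (hfg : ∀ x ∈ closedBall (0 : E d) R, f.1 x = g.1 x ∧ f.2 x = g.2 x) : toBall hf = g :=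
  Prod.ext (SmoothBall.ext fun x hx => (mk_apply hf.1 hx).trans (hfg x hx).1)
    (SmoothBall.ext fun x hx => (mk_apply hf.2 hx).trans (hfg x hx).2)

variable {h : E d → ℝ} (hh : IsHeightFunction h)

theorem X_toBall_apply {f : Pair d} (hf : SmoothPair R f) {x : E d}
    (hx : x ∈ closedBall (0 : E d) R) :
    (ballAlgebra R hh).X (toBall hf) x = ((coeffW h x)⁻¹ : ℝ) * (laplacianB R f.1 x
      - laplacianR h x * f.2 x - 2 * ∑ i, (partialR i h x : ℂ) * partialB R i f.2 x) := by
  have h2 : (2 : SmoothBall d R) x = 2 := by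
    rw [← one_add_one_eq_two, add_apply _ _ hx, one_apply hx, one_add_one_eq_two]
  rw [HeightAlgebra.X, mul_apply _ _ hx, sub_apply _ _ hx, sub_apply _ _ hx, mul_apply _ _ hx,
    mul_apply _ _ hx, ballAlgebra_winv_apply hh hx, HeightAlgebra.Γ, sum_apply _ _ hx, h2,
    ballAlgebra_lap_h_apply hh hx]
  simp only [toBall, mul_apply _ _ hx]
  rw [ballAlgebra_lap_mk_apply hh hx, mk_apply _ hx]
  simp only [ballAlgebra_D_h_apply hh hx, ballAlgebra_D_mk_apply hh hx]

/-- The operators `D_μ` on the algebra. -/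
def HeightAlgebra.Dμ {A : Type*} [CommRing A] [Algebra ℂ A] (S : HeightAlgebra d A)
    (μ : Fin (d + 1)) (f : A × A) : A × A :=
  Fin.cases (S.DT f) (fun i => S.DX i f) μ

theorem waveOp_apply {f : Pair d} (hf : SmoothPair R f) {x : E d}
    (hx : x ∈ closedBall (0 : E d) R) :
    (waveOp h R f).1 x = ((ballAlgebra R hh).L (toBall hf)).1 x ∧
      (waveOp h R f).2 x = ((ballAlgebra R hh).L (toBall hf)).2 x := by
  constructor
  · simp only [HeightAlgebra.L, waveOp]
    rw [add_apply _ _ hx, neg_apply _ hx, mul_apply _ _ hx, HeightAlgebra.eul, sum_apply _ _ hx,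
      ballAlgebra_c_apply hh hx]
    simp only [toBall, mul_apply _ _ hx, ballAlgebra_D_mk_apply hh hx]
    rw [mk_apply _ hx]
    simp only [ballAlgebra, coord_apply _ hx]
  · simp only [HeightAlgebra.L, waveOp]
    rw [add_apply _ _ hx, sub_apply _ _ hx, neg_apply _ hx, mul_apply _ _ hx, HeightAlgebra.eul,
      sum_apply _ _ hx, ballAlgebra_c_apply hh hx, X_toBall_apply hh hf hx]
    simp only [toBall, mul_apply _ _ hx, ballAlgebra_D_mk_apply hh hx]
    rw [mk_apply _ hx]
    simp only [ballAlgebra, coord_apply _ hx]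
    have h0 : ∑ i, ((x i + 2 * (coeffC h x / coeffW h x) * partialR i h x : ℝ) : ℂ)
          * partialB R i f.2 x = ∑ i, (x i : ℂ) * partialB R i f.2 x
        + coeffC h x * ((coeffW h x)⁻¹ : ℝ) *
          (2 * ∑ i, (partialR i h x : ℂ) * partialB R i f.2 x) := by
      simp only [Finset.mul_sum, ← Finset.sum_add_distrib]
      refine Finset.sum_congr rfl fun i _ => ?_
      push_cast
      ring
    rw [h0]
    push_cast
    ring

theorem commOp_apply (μ : Fin (d + 1)) {f : Pair d} (hf : SmoothPair R f) {x : E d}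
    (hx : x ∈ closedBall (0 : E d) R) :
    (commOp h R μ f).1 x = ((ballAlgebra R hh).Dμ μ (toBall hf)).1 x ∧
      (commOp h R μ f).2 x = ((ballAlgebra R hh).Dμ μ (toBall hf)).2 x := by
  have h0 : ∑ i, ((2 * (coeffMu h μ x / coeffW h x) * partialR i h x : ℝ) : ℂ)
        * partialB R i f.2 x = coeffMu h μ x * ((coeffW h x)⁻¹ : ℝ) *
        (2 * ∑ i, (partialR i h x : ℂ) * partialB R i f.2 x) := by
    simp only [Finset.mul_sum]
    refine Finset.sum_congr rfl fun i _ => ?_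
    push_cast
    ring
  have hX := X_toBall_apply hh hf hx
  cases μ using Fin.cases with
  | zero =>
    constructor
    · simp only [commOp, HeightAlgebra.Dμ, Fin.cases_zero, HeightAlgebra.DT, spatialPartial,
        coeffMu, toBall]
      rw [mk_apply _ hx]
      simp
    · simp only [commOp]
      rw [h0]
      simp only [HeightAlgebra.Dμ, Fin.cases_zero, HeightAlgebra.DT, spatialPartial,
        coeffMu]
      rw [hX]
      push_cast
      ring
  | succ i =>
    constructor
    · simp only [commOp, HeightAlgebra.Dμ, Fin.cases_succ, HeightAlgebra.DX, spatialPartial,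
        coeffMu]
      rw [sub_apply _ _ hx, mul_apply _ _ hx, ballAlgebra_D_h_apply hh hx]
      simp only [toBall]
      rw [ballAlgebra_D_mk_apply hh hx, mk_apply _ hx]
      push_cast
      ring
    · simp only [commOp]
      rw [h0]
      simp only [HeightAlgebra.Dμ, Fin.cases_succ, HeightAlgebra.DX, spatialPartial,
        coeffMu]
      rw [sub_apply _ _ hx, mul_apply _ _ hx, ballAlgebra_D_h_apply hh hx, hX]
      simp only [toBall]
      rw [ballAlgebra_D_mk_apply hh hx]
      push_cast
      ring

include hh in
theorem smoothPair_waveOp {f : Pair d} (hf : SmoothPair R f) : SmoothPair R (waveOp h R f) :=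
  ⟨(contDiffOn _).congr fun _ hx => (waveOp_apply hh hf hx).1,
    (contDiffOn _).congr fun _ hx => (waveOp_apply hh hf hx).2⟩

include hh in
theorem smoothPair_commOp (μ : Fin (d + 1)) {f : Pair d} (hf : SmoothPair R f) :
    SmoothPair R (commOp h R μ f) :=
  ⟨(contDiffOn _).congr fun _ hx => (commOp_apply hh μ hf hx).1,
    (contDiffOn _).congr fun _ hx => (commOp_apply hh μ hf hx).2⟩

theorem toBall_waveOp {f : Pair d} (hf : SmoothPair R f) :
    toBall (smoothPair_waveOp hh hf) = (ballAlgebra R hh).L (toBall hf) :=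
  toBall_eq _ fun _ hx => waveOp_apply hh hf hx

theorem toBall_commOp (μ : Fin (d + 1)) {f : Pair d} (hf : SmoothPair R f) :
    toBall (smoothPair_commOp hh μ hf) = (ballAlgebra R hh).Dμ μ (toBall hf) :=
  toBall_eq _ fun _ hx => commOp_apply hh μ hf hx

omit hR in
/-- The complex conjugate of a pair. -/
def cjPair (f : SmoothBall d R × SmoothBall d R) : SmoothBall d R × SmoothBall d R :=
  (cj f.1, cj f.2)

/-- The energy forms on the algebra of smooth functions. -/
def energyA (ε : ℕ → ℝ) :
    ℕ → SmoothBall d R × SmoothBall d R → SmoothBall d R × SmoothBall d R → ℂ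
  | 0, _, _ => 0
  | 1, f, g => ballInt ((ballAlgebra R hh).density (cjPair f) g)
      + ((2 * ε 1 / R : ℝ) : ℂ) * sphereInt (cj f.1 * g.1)
  | k + 2, f, g =>
      (∑ μ, energyA ε (k + 1) ((ballAlgebra R hh).Dμ μ f) ((ballAlgebra R hh).Dμ μ g))
      + if ((k + 2 : ℕ) : ℝ) < (d : ℝ) / 2 + 1 then
          ((2 * ε (k + 2) / R : ℝ) : ℂ) * sphereInt (cj f.1 * g.1)
        else energyA ε (k + 1) f g

omit hR in
theorem cj_mk_mul_mk_apply {u v : E d → ℂ} (hu : ContDiffOn ℝ ∞ u (closedBall 0 R))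
    (hv : ContDiffOn ℝ ∞ v (closedBall 0 R)) {x : E d} (hx : x ∈ closedBall (0 : E d) R) :
    (cj (mk u hu) * mk v hv) x = conj (u x) * v x := by
  rw [mul_apply _ _ hx, cj_apply _ hx, mk_apply _ hx, mk_apply _ hx]

theorem sphereIntegral_toBall {f g : Pair d} (hf : SmoothPair R f) (hg : SmoothPair R g) :
    sphereIntegral R (fun x => conj (f.1 x) * g.1 x)
      = sphereInt (cj (toBall hf).1 * (toBall hg).1) :=
  sphereInt_congr fun _ hx => cj_mk_mul_mk_apply hf.1 hg.1 (mem_closedBall_of_norm_eq hx)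

/-- From here on all estimates can be made for `energyA`, where algebraic identities are equalities
of ring elements and not only equalities on the closed ball. -/
theorem energyForm_eq (ε : ℕ → ℝ) (k : ℕ) {f g : Pair d} (hf : SmoothPair R f)
    (hg : SmoothPair R g) :
    energyForm h R ε k f g = energyA hh ε k (toBall hf) (toBall hg) := by
  induction k using Nat.strong_induction_on generalizing f g with
  | _ k ih =>
    match k, ih with
    | 0, _ => simp [energyForm, energyA]
    | 1, _ =>
      simp only [energyForm, energyA]
      rw [sphereIntegral_toBall hf hg, HeightAlgebra.density, map_add]
      congr 2
      · refine ballInt_congr fun x hx => ?_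
        rw [HeightAlgebra.Γ, sum_apply _ _ hx]
        refine Finset.sum_congr rfl fun i _ => ?_
        rw [mul_apply _ _ hx]
        simp only [toBall, cjPair]
        rw [ballAlgebra_D_mk_apply hh hx]
        simp only [ballAlgebra]
        rw [der_cj, der_mk, cj_apply _ hx, mk_apply _ hx]
      · refine ballInt_congr fun x hx => ?_
        rw [mul_apply _ _ hx, ballAlgebra_w_apply hh hx, mul_comm]
        simp only [cjPair, toBall]
        rw [cj_mk_mul_mk_apply hf.2 hg.2 hx]
    | k + 2, ih =>
      simp only [energyForm, energyA]
      rw [sphereIntegral_toBall hf hg]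
      congr 1
      · refine Finset.sum_congr rfl fun μ _ => ?_
        rw [ih (k + 1) (by omega) (smoothPair_commOp hh μ hf) (smoothPair_commOp hh μ hg),
          toBall_commOp, toBall_commOp]
      · rw [ih (k + 1) (by omega) hf hg]

end WaveFlow
end

/-! ### Geometry of the height function and pointwise inequalities on the sphere. -/

noncomputable section

namespace WaveFlow

open MeasureTheory Set Metric Filter SmoothBall

section height

variable {d : ℕ} {h : E d → ℝ}

/-- A radial function has vanishing derivative in tangential directions. -/
theorem IsHeightFunction.fderiv_eq_zero_of_orthogonal (hh : IsHeightFunction h) {x v : E d}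
    (hxv : inner ℝ x v = 0) : fderiv ℝ h x v = 0 := by
  have hd := (hh.smooth.differentiable (by simp) x).hasFDerivAt
  have hl : ∀ s : ℝ, HasDerivAt (fun t : ℝ => h (x + t • (s • v))) (s * fderiv ℝ h x v) 0 := by
    intro s
    have h1 : HasDerivAt (fun t : ℝ => x + t • (s • v)) (s • v) 0 := by
      simpa using ((hasDerivAt_id (0 : ℝ)).smul_const (s • v)).const_add x
    have h2 : HasFDerivAt h (fderiv ℝ h x) (x + (0 : ℝ) • (s • v)) := by simpa using hd
    refine (h2.comp_hasDerivAt (0 : ℝ) h1).congr_deriv ?_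
    simp
  -- The points `x + tv` and `x - tv` have equal norm when `v` is orthogonal to `x`, so the
  -- derivative along `v` equals its own negative.
  have heq : (fun t : ℝ => h (x + t • ((1 : ℝ) • v))) = fun t : ℝ => h (x + t • ((-1 : ℝ) • v)) := by
    funext t
    apply hh.radial
    have : ‖x + t • v‖ ^ 2 = ‖x - t • v‖ ^ 2 := by
      rw [norm_add_sq_real, norm_sub_sq_real, inner_smul_right, hxv]
      ring
    rw [neg_one_smul, smul_neg, one_smul, ← sub_eq_add_neg]
    exact (pow_left_inj₀ (norm_nonneg _) (norm_nonneg _) two_ne_zero).1 this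
  have h1 := hl 1
  rw [heq] at h1
  have := h1.unique (hl (-1))
  linarith

/-- The gradient is parallel to `x`, so Cauchy–Schwarz is an equality. On the sphere this turns `R²
w` into `R² - (ξ^i ∂_i h)²`. -/
theorem IsHeightFunction.norm_sq_mul_sum_sq (hh : IsHeightFunction h) (x : E d) :
    ‖x‖ ^ 2 * ∑ i, partialR i h x ^ 2 = (∑ i, x i * partialR i h x) ^ 2 := by
  set g := gradient h x
  have hg : ∀ v, fderiv ℝ h x v = inner ℝ g v := fun v => by
    rw [((hh.smooth.differentiable (by simp)) x).hasGradientAt.hasFDerivAt.fderiv,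
      InnerProductSpace.toDual_apply_apply]
  have hgi : ∀ i, partialR i h x = g i := fun i => by
    rw [partialR, hg, EuclideanSpace.inner_single_right]
    simp
  have h1 : inner ℝ x (‖x‖ ^ 2 • g - inner ℝ x g • x) = 0 := by
    rw [inner_sub_right, inner_smul_right, inner_smul_right, real_inner_self_eq_norm_sq]
    ring
  have h2 := hh.fderiv_eq_zero_of_orthogonal h1
  rw [hg, inner_sub_right, inner_smul_right, inner_smul_right, real_inner_self_eq_norm_sq,
    (real_inner_comm _ _ : inner ℝ g x = inner ℝ x g)] at h2
  have h3 : inner ℝ x g = ∑ i, x i * partialR i h x := by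
    rw [PiLp.inner_apply]
    exact Finset.sum_congr rfl fun i _ => by simp [hgi, mul_comm]
  have h4 : ‖g‖ ^ 2 = ∑ i, partialR i h x ^ 2 := by
    rw [EuclideanSpace.norm_sq_eq]
    exact Finset.sum_congr rfl fun i _ => by rw [hgi, Real.norm_eq_abs, sq_abs]
  rw [← h3, ← h4]
  linarith

/-- Since `|∂h| < 1`, moving radially from radius `R₀`, where `|h| = R₀`, out to `R` raises `|h|` by
at most `R - R₀`. -/
theorem IsHeightFunction.sq_le_sq (hh : IsHeightFunction h) {R₀ R : ℝ}
    (h0 : IsLightConeRadius h R₀) (hle : R₀ ≤ R) {x : E d} (hx : ‖x‖ = R) : h x ^ 2 ≤ R ^ 2 := by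
  have hR : 0 < R := h0.1.trans_le hle
  set y := (R₀ / R) • x with hy
  have hyn : ‖y‖ = R₀ := by
    rw [hy, norm_smul, Real.norm_of_nonneg (div_nonneg h0.1.le hR.le), hx, div_mul_cancel₀ _ hR.ne']
  have h1 : |h y| = R₀ := by
    have := h0.2 y hyn
    have h2 : h y ^ 2 = R₀ ^ 2 := by linarith
    rw [← abs_of_pos h0.1]
    exact sq_eq_sq_iff_abs_eq_abs _ _ |>.1 h2
  have h2 : ‖h x - h y‖ ≤ 1 * ‖x - y‖ := by
    refine Convex.norm_image_sub_le_of_norm_fderiv_le (𝕜 := ℝ) (s := univ)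
      (fun z _ => hh.smooth.differentiable (by simp) z) (fun z _ => ?_) convex_univ
      (mem_univ _) (mem_univ _)
    rw [((hh.smooth.differentiable (by simp)) z).hasGradientAt.hasFDerivAt.fderiv,
      LinearIsometryEquiv.norm_map]
    exact (hh.gradient_lt_one z).le
  have h3 : ‖x - y‖ = R - R₀ := by
    have : x - y = (1 - R₀ / R) • x := by rw [hy, sub_smul, one_smul]
    rw [this, norm_smul, hx, Real.norm_of_nonneg (by rw [sub_nonneg, div_le_one hR]; exact hle)]
    field_simp
  rw [h3, Real.norm_eq_abs, one_mul] at h2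
  have h4 : |h x| ≤ R := by
    have := abs_sub_abs_le_abs_sub (h x) (h y)
    linarith
  rw [← sq_abs]
  exact pow_le_pow_left₀ (abs_nonneg _) h4 2

end height

section pointwise

variable {d : ℕ}

theorem normSq_sum_le (x : Fin d → ℝ) (a : Fin d → ℂ) :
    Complex.normSq (∑ i, (x i : ℂ) * a i)
      ≤ (∑ i, x i ^ 2) * ∑ i, Complex.normSq (a i) := by
  simp only [Complex.normSq_eq_norm_sq]
  have h1 : ‖∑ i, (x i : ℂ) * a i‖ ≤ ∑ i, |x i| * ‖a i‖ :=
    (norm_sum_le _ _).trans_eq (Finset.sum_congr rfl fun i _ => by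
      rw [norm_mul, Complex.norm_real, Real.norm_eq_abs])
  have h2 := Finset.sum_mul_sq_le_sq_mul_sq Finset.univ (fun i => |x i|) fun i => ‖a i‖
  simp only [sq_abs] at h2
  exact (pow_le_pow_left₀ (norm_nonneg _) h1 2).trans h2

theorem flux_boundary_le {R P h ε N : ℝ} (hh : h ^ 2 ≤ R ^ 2) {A u v : ℂ}
    (hN : Complex.normSq A ≤ R ^ 2 * N) :
    -(R ^ 2 * N) + 2 * (P - h) * (conj v * A).re
      - (R ^ 2 - P ^ 2 + 2 * (P - h) * P) * Complex.normSq v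
      + 4 * ε * (conj (-A + ((P - h : ℝ) : ℂ) * v) * u).re ≤ 4 * ε ^ 2 * Complex.normSq u := by
  have key : 0 ≤ Complex.normSq (A - ((P - h : ℝ) : ℂ) * v + ((2 * ε : ℝ) : ℂ) * u)
      + (R ^ 2 - h ^ 2) * Complex.normSq v :=
    add_nonneg (Complex.normSq_nonneg _) (mul_nonneg (by linarith) (Complex.normSq_nonneg _))
  refine le_of_sub_nonneg (key.trans ?_)
  have hN' : 0 ≤ R ^ 2 * N - Complex.normSq A := by linarith
  refine le_of_sub_nonneg (hN'.trans_eq ?_)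
  simp only [Complex.normSq_apply, Complex.add_re, Complex.add_im, Complex.sub_re, Complex.sub_im,
    Complex.mul_re, Complex.mul_im, Complex.ofReal_re, Complex.ofReal_im, Complex.conj_re,
    Complex.conj_im, Complex.neg_re, Complex.neg_im]
  ring

/-- Now `A = ξ^i (D_i f)₁` and `v = (D_0 f)₁`, so `-(A + hv)` is `(L f)₁`. Cauchy–Schwarz with `|h|
≤ R` bounds its square by `2R²` times the sum of the `|(D_μ f)₁|²`, and Young's inequality does the
rest. -/
theorem commutator_boundary_le {R h ε N : ℝ} (hR : 0 < R) (hh : h ^ 2 ≤ R ^ 2) {A u v : ℂ}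
    (hN : Complex.normSq A ≤ R ^ 2 * N) :
    ε / R ^ 2 * (conj (-(A + (h : ℂ) * v)) * u).re
      ≤ (Complex.normSq v + N) + ε ^ 2 / R ^ 2 * Complex.normSq u := by
  have h1 : Complex.normSq (A + (h : ℂ) * v) ≤ 2 * R ^ 2 * (Complex.normSq v + N) := by
    have h2 : 0 ≤ Complex.normSq (A - (h : ℂ) * v) := Complex.normSq_nonneg _
    have h3 : 0 ≤ (R ^ 2 - h ^ 2) * Complex.normSq v :=
      mul_nonneg (by linarith) (Complex.normSq_nonneg _)
    simp only [Complex.normSq_apply, Complex.add_re, Complex.add_im, Complex.sub_re,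
      Complex.sub_im, Complex.mul_re, Complex.mul_im, Complex.ofReal_re, Complex.ofReal_im]
      at h2 h3 hN ⊢
    nlinarith
  set B := A + (h : ℂ) * v
  have h4 : ε * (conj (-B) * u).re
      ≤ R ^ 2 * (Complex.normSq v + N) + ε ^ 2 * Complex.normSq u := by
    have h5 : 0 ≤ Complex.normSq (B + ((ε : ℝ) : ℂ) * u) := Complex.normSq_nonneg _
    have h6 : 0 ≤ ε ^ 2 * Complex.normSq u := mul_nonneg (sq_nonneg _) (Complex.normSq_nonneg _)
    simp only [Complex.normSq_apply, Complex.add_re, Complex.add_im, Complex.mul_re,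
      Complex.mul_im, Complex.ofReal_re, Complex.ofReal_im, Complex.conj_re, Complex.conj_im,
      Complex.neg_re, Complex.neg_im] at h1 h5 h6 ⊢
    nlinarith
  have hR2 : 0 < R ^ 2 := by positivity
  rw [div_mul_eq_mul_div, div_mul_eq_mul_div, div_le_iff₀ hR2, add_mul,
    div_mul_cancel₀ _ hR2.ne']
  linarith

end pointwise

end WaveFlow
end

/-! ### Commutators for all `D_μ`; hermitian symmetry, linearity and positivity of the forms. -/

noncomputable section

namespace WaveFlow

open MeasureTheory Set Metric Filter SmoothBall

namespace HeightAlgebra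

variable {d : ℕ} {A : Type*} [CommRing A] [Algebra ℂ A] (S : HeightAlgebra d A)

theorem lap_smul (a : ℂ) (u : A) : S.lap (a • u) = a • S.lap u := by
  simp [lap, Finset.smul_sum, Derivation.map_smul]

theorem Γ_smul (a : ℂ) (u v : A) : S.Γ u (a • v) = a • S.Γ u v := by
  simp [Γ, Finset.smul_sum, Derivation.map_smul]

theorem X_add (f g : A × A) : S.X (f + g) = S.X f + S.X g := by
  simp only [X, Prod.fst_add, Prod.snd_add, lap_add, Γ_add]
  ring

theorem X_smul (a : ℂ) (f : A × A) : S.X (a • f) = a • S.X f := by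
  simp only [X, Prod.smul_fst, Prod.smul_snd, lap_smul, Γ_smul]
  simp only [Algebra.smul_def]
  ring

theorem Dμ_zero (f : A × A) : S.Dμ 0 f = S.DT f := rfl

theorem Dμ_succ (i : Fin d) (f : A × A) : S.Dμ i.succ f = S.DX i f := rfl

theorem Dμ_add (μ : Fin (d + 1)) (f g : A × A) : S.Dμ μ (f + g) = S.Dμ μ f + S.Dμ μ g := by
  cases μ using Fin.cases with
  | zero => simp only [Dμ_zero, DT, X_add]; rfl
  | succ i =>
    simp only [Dμ_succ, DX, X_add]
    refine Prod.ext ?_ ?_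
    · simp only [Prod.fst_add, Prod.snd_add, map_add]
      ring
    · simp only [Prod.snd_add, map_add]
      ring

theorem Dμ_smul (μ : Fin (d + 1)) (a : ℂ) (f : A × A) : S.Dμ μ (a • f) = a • S.Dμ μ f := by
  cases μ using Fin.cases with
  | zero => simp only [Dμ_zero, DT, X_smul]; rfl
  | succ i =>
    simp only [Dμ_succ, DX, X_smul]
    refine Prod.ext ?_ ?_
    · simp only [Prod.smul_fst, Prod.smul_snd, Derivation.map_smul]
      simp only [Algebra.smul_def]
      ring
    · simp only [Prod.smul_snd, Derivation.map_smul]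
      simp only [Algebra.smul_def]
      ring

theorem Dμ_L (μ : Fin (d + 1)) (f : A × A) :
    S.Dμ μ (S.L f) = S.L (S.Dμ μ f) - S.Dμ μ f := by
  cases μ using Fin.cases with
  | zero => exact S.DT_L f
  | succ i => exact S.DX_L i f

end HeightAlgebra

variable {d : ℕ} {R : ℝ} [hR : Fact (0 < R)] {h : E d → ℝ} (hh : IsHeightFunction h)

section conjugation

theorem cj_D (i : Fin d) (u : SmoothBall d R) : cj ((ballAlgebra R hh).D i u) = (ballAlgebra R hh).D i (cj u) :=
  (der_cj i u).symm

theorem cj_h : cj (ballAlgebra R hh).h = (ballAlgebra R hh).h := cj_ofReal hh.smooth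

theorem cj_Γ (u v : SmoothBall d R) : cj ((ballAlgebra R hh).Γ u v) = (ballAlgebra R hh).Γ (cj u) (cj v) := by
  simp only [HeightAlgebra.Γ, map_sum, map_mul, cj_D]

theorem cj_lap (u : SmoothBall d R) : cj ((ballAlgebra R hh).lap u) = (ballAlgebra R hh).lap (cj u) := by
  simp only [HeightAlgebra.lap, map_sum, cj_D]

theorem cj_eul (u : SmoothBall d R) : cj ((ballAlgebra R hh).eul u) = (ballAlgebra R hh).eul (cj u) := by
  have : ∀ i, cj ((ballAlgebra R hh).ξ i) = (ballAlgebra R hh).ξ i := cj_coord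
  simp only [HeightAlgebra.eul, map_sum, map_mul, cj_D, this]

theorem cj_w : cj (ballAlgebra R hh).w = (ballAlgebra R hh).w := by
  simp only [HeightAlgebra.w, map_sub, map_one, cj_Γ, cj_h]

theorem cj_c : cj (ballAlgebra R hh).c = (ballAlgebra R hh).c := by
  simp only [HeightAlgebra.c, map_sub, cj_eul, cj_h]

theorem cj_winv : cj (ballAlgebra R hh).winv = (ballAlgebra R hh).winv := cj_ofReal _

theorem cj_X (f : SmoothBall d R × SmoothBall d R) : cj ((ballAlgebra R hh).X f) = (ballAlgebra R hh).X (cjPair f) := by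
  simp only [HeightAlgebra.X, map_sub, map_mul, cj_Γ, cj_lap, cj_winv, cj_h, cjPair, map_ofNat]

theorem cjPair_L (f : SmoothBall d R × SmoothBall d R) :
    cjPair ((ballAlgebra R hh).L f) = (ballAlgebra R hh).L (cjPair f) := by
  refine Prod.ext ?_ ?_
  · simp only [HeightAlgebra.L, cjPair, map_add, map_neg, map_mul, cj_c, cj_eul]
  · simp only [HeightAlgebra.L]
    simp only [cjPair, map_add, map_sub, map_neg, map_mul, cj_c, cj_eul, cj_X]

theorem cj_density (f g : SmoothBall d R × SmoothBall d R) :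
    cj ((ballAlgebra R hh).density (cjPair f) g) = (ballAlgebra R hh).density (cjPair g) f := by
  simp only [HeightAlgebra.density, cjPair, map_add, map_mul, cj_Γ, cj_w, cj_cj]
  rw [HeightAlgebra.Γ_comm, mul_comm f.2]

theorem density_add_right (f g g' : SmoothBall d R × SmoothBall d R) :
    (ballAlgebra R hh).density f (g + g') = (ballAlgebra R hh).density f g + (ballAlgebra R hh).density f g' := by
  simp only [HeightAlgebra.density, Prod.fst_add, Prod.snd_add, HeightAlgebra.Γ_add]
  ring

theorem density_smul_right (a : ℂ) (f g : SmoothBall d R × SmoothBall d R) :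
    (ballAlgebra R hh).density f (a • g) = a • (ballAlgebra R hh).density f g := by
  simp only [HeightAlgebra.density, Prod.smul_fst, Prod.smul_snd, HeightAlgebra.Γ_smul]
  simp only [Algebra.smul_def]
  ring

end conjugation

variable (ε : ℕ → ℝ)

theorem energyA_conj (k : ℕ) (f g : SmoothBall d R × SmoothBall d R) :
    conj (energyA hh ε k f g) = energyA hh ε k g f := by
  have hs : conj (sphereInt (cj f.1 * g.1)) = sphereInt (cj g.1 * f.1) := by
    rw [← sphereInt_cj, map_mul, cj_cj, mul_comm]
  induction k using Nat.strong_induction_on generalizing f g with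
  | _ k ih =>
    match k, ih with
    | 0, _ => simp [energyA]
    | 1, _ =>
      rw [energyA, energyA, map_add, map_mul, hs, Complex.conj_ofReal, ← ballInt_cj, cj_density]
    | k + 2, ih =>
      rw [energyA, energyA, map_add, map_sum]
      congr 1
      · refine Finset.sum_congr rfl fun μ _ => ih (k + 1) (by omega) _ _ ?_
        rw [← sphereInt_cj, map_mul, cj_cj, mul_comm]
      · split_ifs
        · rw [map_mul, hs, Complex.conj_ofReal]
        · exact ih (k + 1) (by omega) f g hs

theorem energyA_add_right (k : ℕ) (f g g' : SmoothBall d R × SmoothBall d R) :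
    energyA hh ε k f (g + g') = energyA hh ε k f g + energyA hh ε k f g' := by
  induction k using Nat.strong_induction_on generalizing f g g' with
  | _ k ih =>
    match k, ih with
    | 0, _ => simp [energyA]
    | 1, _ =>
      simp only [energyA, density_add_right, Prod.fst_add, mul_add, map_add]
      ring
    | k + 2, ih =>
      simp only [energyA, HeightAlgebra.Dμ_add, ih (k + 1) (by omega), Finset.sum_add_distrib]
      split_ifs
      · simp only [Prod.fst_add, mul_add, map_add]
        ring
      · ring

theorem energyA_smul_right (k : ℕ) (a : ℂ) (f g : SmoothBall d R × SmoothBall d R) :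
    energyA hh ε k f (a • g) = a * energyA hh ε k f g := by
  induction k using Nat.strong_induction_on generalizing f g with
  | _ k ih =>
    match k, ih with
    | 0, _ => simp [energyA]
    | 1, _ =>
      simp only [energyA, density_smul_right, Prod.smul_fst, Algebra.mul_smul_comm, map_smul,
        smul_eq_mul]
      ring
    | k + 2, ih =>
      simp only [energyA, HeightAlgebra.Dμ_smul, ih (k + 1) (by omega), ← Finset.mul_sum]
      split_ifs
      · simp only [Prod.smul_fst, Algebra.mul_smul_comm, map_smul, smul_eq_mul]
        ring
      · ring

theorem energyA_re_comm (k : ℕ) (f g : SmoothBall d R × SmoothBall d R) :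
    (energyA hh ε k f g).re = (energyA hh ε k g f).re := by
  rw [← energyA_conj, Complex.conj_re]

theorem energyA_sub_left_re (k : ℕ) (f f' g : SmoothBall d R × SmoothBall d R) :
    (energyA hh ε k (f - f') g).re = (energyA hh ε k f g).re - (energyA hh ε k f' g).re := by
  have : f - f' = f + (-1 : ℂ) • f' := by rw [neg_one_smul, sub_eq_add_neg]
  rw [energyA_re_comm, this, energyA_add_right, energyA_smul_right, neg_one_mul, Complex.add_re,
    Complex.neg_re, energyA_re_comm, energyA_re_comm hh ε k g f']
  ring

/-- The boundary integral `∫ |u|²`. -/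
def bdry (u : SmoothBall d R) : ℝ := (sphereInt (cj u * u)).re

/-- The integral `∫ |u|²`. -/
def sqInt (u : SmoothBall d R) : ℝ := (ballInt (cj u * u)).re

omit hR in
theorem cj_mul_self_apply (u : SmoothBall d R) {x : E d} (hx : x ∈ closedBall (0 : E d) R) :
    (cj u * u) x = (Complex.normSq (u x) : ℂ) := by
  rw [mul_apply _ _ hx, cj_apply _ hx, Complex.normSq_eq_conj_mul_self]

omit hR in
theorem cj_mul_self_apply_re (u : SmoothBall d R) {x : E d} (hx : x ∈ closedBall (0 : E d) R) :
    ((cj u * u) x).re = Complex.normSq (u x) := by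
  rw [cj_mul_self_apply u hx, Complex.ofReal_re]

theorem sphereInt_re_nonneg {u : SmoothBall d R} (hu : ∀ x, ‖x‖ = R → 0 ≤ (u x).re) :
    0 ≤ (sphereInt u).re := by
  have := sphereInt_re_mono (u := 0) (v := u) fun x hx => by
    rw [zero_apply (mem_closedBall_of_norm_eq hx)]
    exact hu x hx
  simpa using this

omit hR in
theorem ballInt_re_nonneg {u : SmoothBall d R}
    (hu : ∀ x ∈ closedBall (0 : E d) R, 0 ≤ (u x).re) : 0 ≤ (ballInt u).re := by
  have := ballInt_re_mono (u := 0) (v := u) fun x hx => by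
    rw [zero_apply hx]
    exact hu x hx
  simpa using this

theorem bdry_nonneg (u : SmoothBall d R) : 0 ≤ bdry u :=
  sphereInt_re_nonneg fun x hx => by
    rw [cj_mul_self_apply_re u (mem_closedBall_of_norm_eq hx)]
    exact Complex.normSq_nonneg _

omit hR in
theorem sqInt_nonneg (u : SmoothBall d R) : 0 ≤ sqInt u :=
  ballInt_re_nonneg fun x hx => by
    rw [cj_mul_self_apply_re u hx]
    exact Complex.normSq_nonneg _

theorem density_self_apply_re (f : SmoothBall d R × SmoothBall d R) {x : E d}
    (hx : x ∈ closedBall (0 : E d) R) :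
    ((ballAlgebra R hh).density (cjPair f) f x).re
      = ∑ i, Complex.normSq (der i f.1 x) + coeffW h x * Complex.normSq (f.2 x) := by
  rw [HeightAlgebra.density, add_apply _ _ hx, mul_apply _ _ hx, ballAlgebra_w_apply hh hx]
  simp only [cjPair, HeightAlgebra.Γ, ← cj_D]
  rw [cj_mul_self_apply _ hx, sum_apply _ _ hx]
  simp only [cj_mul_self_apply _ hx]
  rw [Complex.add_re, Complex.re_sum, ← Complex.ofReal_mul, Complex.ofReal_re]
  rfl

theorem energyA_one_re (f : SmoothBall d R × SmoothBall d R) :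
    (energyA hh ε 1 f f).re = (ballInt ((ballAlgebra R hh).density (cjPair f) f)).re
      + 2 * ε 1 / R * bdry f.1 := by
  rw [energyA, Complex.add_re, Complex.re_ofReal_mul, bdry]

theorem energyA_succ_re_of_lt {k : ℕ} (hk : 1 ≤ k) (hkd : ((k + 1 : ℕ) : ℝ) < (d : ℝ) / 2 + 1)
    (f g : SmoothBall d R × SmoothBall d R) :
    (energyA hh ε (k + 1) f g).re = ∑ μ, (energyA hh ε k ((ballAlgebra R hh).Dμ μ f)
      ((ballAlgebra R hh).Dμ μ g)).re + 2 * ε (k + 1) / R * (sphereInt (cj f.1 * g.1)).re := by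
  obtain ⟨k, rfl⟩ : ∃ m, k = m + 1 := ⟨k - 1, by omega⟩
  rw [energyA, if_pos hkd, Complex.add_re, Complex.re_ofReal_mul, Complex.re_sum]

theorem energyA_succ_re_of_le {k : ℕ} (hk : 1 ≤ k) (hkd : (d : ℝ) / 2 + 1 ≤ ((k + 1 : ℕ) : ℝ))
    (f g : SmoothBall d R × SmoothBall d R) :
    (energyA hh ε (k + 1) f g).re = ∑ μ, (energyA hh ε k ((ballAlgebra R hh).Dμ μ f)
      ((ballAlgebra R hh).Dμ μ g)).re + (energyA hh ε k f g).re := by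
  obtain ⟨k, rfl⟩ : ∃ m, k = m + 1 := ⟨k - 1, by omega⟩
  rw [energyA, if_neg hkd.not_gt, Complex.add_re, Complex.re_sum]

theorem ballInt_density_nonneg (f : SmoothBall d R × SmoothBall d R) :
    0 ≤ (ballInt ((ballAlgebra R hh).density (cjPair f) f)).re :=
  ballInt_re_nonneg fun x hx => by
    rw [density_self_apply_re hh f hx]
    exact add_nonneg (Finset.sum_nonneg fun i _ => Complex.normSq_nonneg _)
      (mul_nonneg (hh.coeffW_pos x).le (Complex.normSq_nonneg _))

variable {ε}

theorem energyA_nonneg [NeZero d] (hε : ∀ j : ℕ, 1 ≤ j → (j : ℝ) < (d : ℝ) / 2 + 1 → 0 ≤ ε j) {k : ℕ}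
    (hk : 1 ≤ k) (f : SmoothBall d R × SmoothBall d R) : 0 ≤ (energyA hh ε k f f).re := by
  induction k, hk using Nat.le_induction generalizing f with
  | base =>
    rw [energyA_one_re]
    refine add_nonneg (ballInt_density_nonneg hh f) ?_
    have h1 : ((1 : ℕ) : ℝ) < (d : ℝ) / 2 + 1 := by
      have : (0 : ℝ) < d := by exact_mod_cast NeZero.pos d
      push_cast
      linarith
    exact mul_nonneg (div_nonneg (mul_nonneg zero_le_two (hε 1 le_rfl h1)) hR.out.le)
      (bdry_nonneg _)
  | succ k hk ih =>
    rcases lt_or_ge ((k + 1 : ℕ) : ℝ) ((d : ℝ) / 2 + 1) with hkd | hkd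
    · rw [energyA_succ_re_of_lt hh ε hk hkd]
      exact add_nonneg (Finset.sum_nonneg fun μ _ => ih _)
        (mul_nonneg (div_nonneg (mul_nonneg zero_le_two (hε _ (by omega) hkd)) hR.out.le)
          (bdry_nonneg _))
    · rw [energyA_succ_re_of_le hh ε hk hkd]
      exact add_nonneg (Finset.sum_nonneg fun μ _ => ih _) (ih f)

/-- Every energy below the threshold `d/2 + 1` contains its own boundary term. This bound absorbs
leftover boundary terms in the dissipative estimate and feeds the Poincaré inequality. -/
theorem bdry_le_energyA [NeZero d] (hε : ∀ j : ℕ, 1 ≤ j → (j : ℝ) < (d : ℝ) / 2 + 1 → 0 ≤ ε j) {k : ℕ}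
    (hk : 1 ≤ k) (hkd : (k : ℝ) < (d : ℝ) / 2 + 1) (f : SmoothBall d R × SmoothBall d R) :
    2 * ε k / R * bdry f.1 ≤ (energyA hh ε k f f).re := by
  obtain ⟨k, rfl⟩ : ∃ m, k = m + 1 := ⟨k - 1, by omega⟩
  rcases Nat.eq_zero_or_pos k with rfl | hk0
  · rw [energyA_one_re]
    exact le_add_of_nonneg_left (ballInt_density_nonneg hh f)
  · rw [energyA_succ_re_of_lt hh ε hk0 hkd]
    exact le_add_of_nonneg_left (Finset.sum_nonneg fun μ _ => energyA_nonneg hh hε hk0 _)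

end WaveFlow
end

/-! ### The dissipative estimates and the choice of the parameters. -/

noncomputable section

namespace WaveFlow

open MeasureTheory Set Metric Filter SmoothBall

variable {d : ℕ} {R : ℝ} [hR : Fact (0 < R)] {h : E d → ℝ} (hh : IsHeightFunction h)

omit hR in
theorem sum_coord_sq {x : E d} (hx : ‖x‖ = R) : ∑ i, x i ^ 2 = R ^ 2 := by
  rw [← hx, EuclideanSpace.norm_sq_eq]
  exact Finset.sum_congr rfl fun i _ => by rw [Real.norm_eq_abs, sq_abs]

theorem eul_apply (u : SmoothBall d R) {x : E d} (hx : x ∈ closedBall (0 : E d) R) :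
    (ballAlgebra R hh).eul u x = ∑ i, (x i : ℂ) * der i u x := by
  rw [HeightAlgebra.eul, sum_apply _ _ hx]
  refine Finset.sum_congr rfl fun i _ => ?_
  rw [mul_apply _ _ hx]
  simp only [ballAlgebra, coord_apply _ hx]

theorem L_fst_apply (f : SmoothBall d R × SmoothBall d R) {x : E d}
    (hx : x ∈ closedBall (0 : E d) R) :
    ((ballAlgebra R hh).L f).1 x
      = -(∑ i, (x i : ℂ) * der i f.1 x) + (coeffC h x : ℂ) * f.2 x := by
  simp only [HeightAlgebra.L]
  rw [add_apply _ _ hx, neg_apply _ hx, mul_apply _ _ hx, eul_apply hh _ hx,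
    ballAlgebra_c_apply hh hx]

/-- The normal component of the flux, times `R`, in the form required by `flux_boundary_le`. Radial
symmetry of `h` enters here, through the value of `w R²`. -/
theorem sum_coord_flux_apply_re (f : SmoothBall d R × SmoothBall d R) {x : E d} (hx : ‖x‖ = R) :
    ((∑ i, coord i * (ballAlgebra R hh).flux (cjPair f) f i : SmoothBall d R) x).re
      = -(R ^ 2 * ∑ i, Complex.normSq (der i f.1 x))
        + 2 * coeffC h x * (conj (f.2 x) * ∑ i, (x i : ℂ) * der i f.1 x).re
        - (R ^ 2 - (∑ i, x i * partialR i h x) ^ 2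
          + 2 * coeffC h x * ∑ i, x i * partialR i h x) * Complex.normSq (f.2 x) := by
  have hx' := mem_closedBall_of_norm_eq hx
  have hw : coeffW h x * R ^ 2 = R ^ 2 - (∑ i, x i * partialR i h x) ^ 2 := by
    rw [← hh.norm_sq_mul_sum_sq x, hx, coeffW]
    simp only [sq]
    ring
  have h1 : ∀ i, ((coord i * (ballAlgebra R hh).flux (cjPair f) f i : SmoothBall d R) x).re
      = -(x i ^ 2 * ∑ j, Complex.normSq (der j f.1 x))
        + 2 * coeffC h x * (conj (f.2 x) * ((x i : ℂ) * der i f.1 x)).re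
        - (coeffW h x * x i ^ 2 + 2 * coeffC h x * (x i * partialR i h x))
          * Complex.normSq (f.2 x) := by
    intro i
    have h2 : (2 : SmoothBall d R) x = 2 := by
      rw [← one_add_one_eq_two, add_apply _ _ hx', one_apply hx', one_add_one_eq_two]
    have hΓ : (ballAlgebra R hh).Γ (cj f.1) f.1 x
        = ((∑ j, Complex.normSq (der j f.1 x) : ℝ) : ℂ) := by
      simp only [HeightAlgebra.Γ, ← cj_D]
      rw [sum_apply _ _ hx']
      simp only [cj_mul_self_apply _ hx']
      push_cast
      rfl
    have hD : ∀ u, (ballAlgebra R hh).D i u = der i u := fun _ => rfl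
    have hξ : (ballAlgebra R hh).ξ i x = ((x i : ℝ) : ℂ) := coord_apply i hx'
    simp only [HeightAlgebra.flux, cjPair]
    rw [mul_apply _ _ hx', sub_apply _ _ hx', add_apply _ _ hx', neg_apply _ hx',
      mul_apply _ _ hx', mul_apply _ _ hx', mul_apply _ _ hx', add_apply _ _ hx',
      add_apply _ _ hx', mul_apply _ _ hx', mul_apply _ _ hx', mul_apply _ _ hx',
      mul_apply _ _ hx', mul_apply _ _ hx', cj_mul_self_apply _ hx', hΓ,
      ballAlgebra_D_h_apply hh hx', hD, hD, der_cj, cj_apply _ hx', cj_apply _ hx',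
      ballAlgebra_c_apply hh hx', ballAlgebra_w_apply hh hx', hξ, coord_apply _ hx', h2]
    simp only [Complex.normSq_apply, Complex.add_re, Complex.add_im, Complex.sub_re,
      Complex.sub_im, Complex.mul_re, Complex.mul_im, Complex.ofReal_re, Complex.ofReal_im,
      Complex.conj_re, Complex.conj_im, Complex.neg_re, Complex.neg_im, Complex.re_ofNat,
      Complex.im_ofNat]
    ring
  rw [sum_apply _ _ hx', Complex.re_sum, Finset.sum_congr rfl fun i _ => h1 i,
    Finset.sum_sub_distrib, Finset.sum_add_distrib, Finset.sum_neg_distrib, ← Finset.sum_mul,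
    ← Finset.sum_mul, sum_coord_sq hx, Finset.sum_add_distrib, ← Finset.mul_sum, ← Finset.mul_sum,
    ← Finset.mul_sum, sum_coord_sq hx, hw, Finset.mul_sum (f := fun i => (x i : ℂ) * der i f.1 x),
    Complex.re_sum]

variable [NeZero d]

theorem energyA_one_L_re (ε : ℕ → ℝ) (f : SmoothBall d R × SmoothBall d R) :
    2 * (energyA hh ε 1 ((ballAlgebra R hh).L f) f).re
      = ((d : ℝ) - 2) * (ballInt ((ballAlgebra R hh).density (cjPair f) f)).re
        + R⁻¹ * (sphereInt (∑ i, coord i * (ballAlgebra R hh).flux (cjPair f) f i)).re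
        + 4 * ε 1 / R * (sphereInt (cj ((ballAlgebra R hh).L f).1 * f.1)).re := by
  have h1 := congrArg ballInt ((ballAlgebra R hh).density_L (cjPair f) f)
  rw [map_add, map_add, map_sum] at h1
  have hdiv : ∀ i, ballInt ((ballAlgebra R hh).D i ((ballAlgebra R hh).flux (cjPair f) f i))
      = (R : ℂ)⁻¹ * sphereInt (coord i * (ballAlgebra R hh).flux (cjPair f) f i) :=
    fun i => ballInt_der i _
  simp only [hdiv] at h1
  have hd : ((d : SmoothBall d R) - 2) * (ballAlgebra R hh).density (cjPair f) f
      = ((d : ℂ) - 2) • (ballAlgebra R hh).density (cjPair f) f := by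
    rw [Algebra.smul_def, map_sub, map_natCast, map_ofNat]
  rw [hd, map_smul, smul_eq_mul, ← Finset.mul_sum, ← map_sum, ← cjPair_L] at h1
  -- Hermitian symmetry makes the two terms of `density_L` equal in real part, hence the factor 2 on
  -- the left of the statement.
  have h2 : (ballInt ((ballAlgebra R hh).density (cjPair f) ((ballAlgebra R hh).L f))).re
      = (ballInt ((ballAlgebra R hh).density (cjPair ((ballAlgebra R hh).L f)) f)).re := by
    rw [← cj_density, ballInt_cj, Complex.conj_re]
  have h3 := congrArg Complex.re h1
  rw [Complex.add_re, h2, Complex.add_re, ← Complex.ofReal_inv, Complex.re_ofReal_mul] at h3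
  have hdc : ((d : ℂ) - 2) = (((d : ℝ) - 2 : ℝ) : ℂ) := by push_cast; rfl
  rw [hdc, Complex.re_ofReal_mul] at h3
  rw [energyA, Complex.add_re, Complex.re_ofReal_mul]
  linear_combination h3

/-- The bulk contributes exactly `d/2 - 1` times the density, and the boundary at most `2 ε₁² / R`
times the integral of `|f₁|²`. The last coefficient in the statement compensates for the boundary
part of the full energy. -/
theorem energyA_one_L_le (hb : ∀ x : E d, ‖x‖ = R → h x ^ 2 ≤ R ^ 2) (ε : ℕ → ℝ)
    (f : SmoothBall d R × SmoothBall d R) :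
    (energyA hh ε 1 ((ballAlgebra R hh).L f) f).re
      ≤ ((d : ℝ) / 2 - 1) * (energyA hh ε 1 f f).re
        + (-((d : ℝ) / 2) + 1 + ε 1) * (2 * ε 1 / R) * bdry f.1 := by
  have h1 := energyA_one_L_re hh ε f
  have h2 : (sphereInt ((∑ i, coord i * (ballAlgebra R hh).flux (cjPair f) f i)
      + ((4 * ε 1 : ℝ) : ℂ) • (cj ((ballAlgebra R hh).L f).1 * f.1))).re
      ≤ (sphereInt (((4 * ε 1 ^ 2 : ℝ) : ℂ) • (cj f.1 * f.1))).re := by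
    refine sphereInt_re_mono fun x hx => ?_
    have hx' := mem_closedBall_of_norm_eq hx
    rw [add_apply _ _ hx', smul_apply _ _ hx', smul_apply _ _ hx', Complex.add_re,
      Complex.re_ofReal_mul, Complex.re_ofReal_mul, cj_mul_self_apply_re _ hx',
      sum_coord_flux_apply_re hh f hx, mul_apply _ _ hx', cj_apply _ hx', L_fst_apply hh f hx']
    have h4 := normSq_sum_le x (fun i => der i f.1 x)
    rw [sum_coord_sq hx] at h4
    exact flux_boundary_le (P := ∑ i, x i * partialR i h x) (hb x hx) h4
  rw [map_add, Complex.add_re, map_smul, map_smul, smul_eq_mul, smul_eq_mul,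
    Complex.re_ofReal_mul, Complex.re_ofReal_mul] at h2
  have h3 := mul_le_mul_of_nonneg_left h2 (inv_nonneg.2 hR.out.le)
  rw [energyA_one_re, bdry]
  simp only [div_eq_mul_inv] at h1 ⊢
  linarith

-- The new boundary term produced at each order is paid for by the boundary integrals of the `(D_μ
-- f)₁`, up to a multiple of that of `f₁`.
omit [NeZero d] in
theorem sum_bdry_Dμ_le (hb : ∀ x : E d, ‖x‖ = R → h x ^ 2 ≤ R ^ 2) (ε : ℝ)
    (f : SmoothBall d R × SmoothBall d R) :
    ε / R ^ 2 * (sphereInt (cj ((ballAlgebra R hh).L f).1 * f.1)).re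
      ≤ ∑ μ, bdry ((ballAlgebra R hh).Dμ μ f).1 + ε ^ 2 / R ^ 2 * bdry f.1 := by
  have h2 : (sphereInt (((ε / R ^ 2 : ℝ) : ℂ) • (cj ((ballAlgebra R hh).L f).1 * f.1))).re
      ≤ (sphereInt ((∑ μ, cj ((ballAlgebra R hh).Dμ μ f).1 * ((ballAlgebra R hh).Dμ μ f).1)
        + ((ε ^ 2 / R ^ 2 : ℝ) : ℂ) • (cj f.1 * f.1))).re := by
    refine sphereInt_re_mono fun x hx => ?_
    have hx' := mem_closedBall_of_norm_eq hx
    rw [add_apply _ _ hx', smul_apply _ _ hx', smul_apply _ _ hx', Complex.add_re,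
      Complex.re_ofReal_mul, Complex.re_ofReal_mul, cj_mul_self_apply_re _ hx',
      sum_apply _ _ hx', Complex.re_sum, Fin.sum_univ_succ, cj_mul_self_apply_re _ hx',
      mul_apply _ _ hx', cj_apply _ hx', L_fst_apply hh f hx']
    simp only [cj_mul_self_apply_re _ hx', HeightAlgebra.Dμ_zero, HeightAlgebra.Dμ_succ,
      HeightAlgebra.DT]
    have h4 := normSq_sum_le x (fun i => ((ballAlgebra R hh).DX i f).1 x)
    rw [sum_coord_sq hx] at h4
    refine le_trans (le_of_eq ?_) (commutator_boundary_le hR.out (hb x hx) h4)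
    congr 4
    have h5 : ∀ i, ((ballAlgebra R hh).DX i f).1 x
        = der i f.1 x - (partialR i h x : ℂ) * f.2 x := by
      intro i
      simp only [HeightAlgebra.DX]
      rw [sub_apply _ _ hx', mul_apply _ _ hx', ballAlgebra_D_h_apply hh hx']
      rfl
    simp only [h5, mul_sub, Finset.sum_sub_distrib, ← mul_assoc, ← Finset.sum_mul, coeffC]
    push_cast
    ring
  rw [map_add, Complex.add_re, map_smul, map_smul, smul_eq_mul, smul_eq_mul,
    Complex.re_ofReal_mul, Complex.re_ofReal_mul, map_sum, Complex.re_sum] at h2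
  exact h2

omit hR [NeZero d] in
theorem epsSeq_one (ε : ℝ) : epsSeq d R ε 1 = ε := by
  simp [epsSeq]

omit hR [NeZero d] in
theorem epsSeq_succ (ε : ℝ) {k : ℕ} (hk : 1 ≤ k) :
    epsSeq d R ε (k + 1) = epsSeq d R ε k * (((d : ℝ) / 2 - k - ε) * ε / R ^ 2) := by
  obtain ⟨k, rfl⟩ : ∃ m, k = m + 1 := ⟨k - 1, by omega⟩
  simp only [epsSeq, Nat.add_sub_cancel]
  rw [Finset.prod_Icc_succ_top (by omega), mul_assoc]

-- Integrality: an integer below `d/2` is at most `d/2 - 1/2`. This gap is why `ε₁ ≤ 1/2` suffices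
-- throughout.
omit hR [NeZero d] in
theorem add_half_le {j : ℕ} (hj : ((j + 1 : ℕ) : ℝ) < (d : ℝ) / 2 + 1) :
    (j : ℝ) + 1 / 2 ≤ (d : ℝ) / 2 := by
  have h1 : (2 * j : ℝ) < d := by push_cast at hj; linarith
  have h2 : 2 * j + 1 ≤ d := by exact_mod_cast h1
  have h3 : (2 * j + 1 : ℝ) ≤ d := by exact_mod_cast h2
  linarith

omit hR [NeZero d] in
theorem epsSeq_nonneg {ε : ℝ} (h0 : 0 < ε) (h1 : ε ≤ 1 / 2) {j : ℕ} (hj : 1 ≤ j)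
    (hjd : (j : ℝ) < (d : ℝ) / 2 + 1) : 0 ≤ epsSeq d R ε j := by
  induction j, hj using Nat.le_induction with
  | base => rw [epsSeq_one]; exact h0.le
  | succ j hj ih =>
    have h2 := add_half_le hjd
    rw [epsSeq_succ ε hj]
    refine mul_nonneg (ih (by push_cast at hjd; linarith)) (div_nonneg (mul_nonneg ?_ h0.le) ?_)
    · linarith
    · positivity

-- The only factor that can vanish is the last one, `d/2 - (j - 1) - ε₁`, and only for `ε₁ = 1/2`
-- and `2j = d + 1`.
omit [NeZero d] in
theorem epsSeq_pos {ε : ℝ} (h0 : 0 < ε) (h1 : ε ≤ 1 / 2) {j : ℕ} (hj : 1 ≤ j)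
    (hjd : (j : ℝ) < (d : ℝ) / 2 + 1) (hor : ε < 1 / 2 ∨ 2 * j ≠ d + 1) :
    0 < epsSeq d R ε j := by
  induction j, hj using Nat.le_induction with
  | base => rwa [epsSeq_one]
  | succ j hj ih =>
    have h2 := add_half_le hjd
    have hR2 : 0 < R ^ 2 := pow_pos hR.out 2
    rw [epsSeq_succ ε hj]
    refine mul_pos (ih (by push_cast at hjd; linarith) ?_)
      (div_pos (mul_pos ?_ h0) hR2)
    -- The exceptional case cannot occur at an index `j` whose successor is still admissible, since
    -- then `2j < d`.
    · right
      intro h3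
      have : (2 * j : ℝ) = d + 1 := by exact_mod_cast h3
      linarith
    · rcases hor with h3 | h3
      · linarith
      · have h4 : 2 * j + 1 ≠ d := by omega
        have h5 : 2 * j + 1 ≤ d := by
          have : (2 * j + 1 : ℝ) ≤ d := by linarith
          exact_mod_cast this
        have h6 : 2 * j + 2 ≤ d := by omega
        have h7 : (2 * j + 2 : ℝ) ≤ d := by exact_mod_cast h6
        linarith

theorem energyA_L_le_of_lt (hb : ∀ x : E d, ‖x‖ = R → h x ^ 2 ≤ R ^ 2) {ε : ℝ} (h0 : 0 < ε)
    (h1 : ε ≤ 1 / 2) {k : ℕ} (hk : 1 ≤ k) (hkd : (k : ℝ) < (d : ℝ) / 2 + 1)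
    (f : SmoothBall d R × SmoothBall d R) :
    (energyA hh (epsSeq d R ε) k ((ballAlgebra R hh).L f) f).re
      ≤ ((d : ℝ) / 2 - k) * (energyA hh (epsSeq d R ε) k f f).re
        + (-((d : ℝ) / 2) + k + ε) * (2 * epsSeq d R ε k / R) * bdry f.1 := by
  induction k, hk using Nat.le_induction generalizing f with
  | base =>
    have := energyA_one_L_le hh hb (epsSeq d R ε) f
    rw [epsSeq_one] at this ⊢
    simpa using this
  | succ k hk ih =>
    have hkd' : (k : ℝ) < (d : ℝ) / 2 + 1 := by push_cast at hkd; linarith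
    have hkh := add_half_le hkd
    have he := epsSeq_nonneg (R := R) h0 h1 hk hkd'
    have hstep : ∀ μ, (energyA hh (epsSeq d R ε) k
        ((ballAlgebra R hh).Dμ μ ((ballAlgebra R hh).L f)) ((ballAlgebra R hh).Dμ μ f)).re
        ≤ ((d : ℝ) / 2 - k - 1) * (energyA hh (epsSeq d R ε) k
          ((ballAlgebra R hh).Dμ μ f) ((ballAlgebra R hh).Dμ μ f)).re
        + (-((d : ℝ) / 2) + k + ε) * (2 * epsSeq d R ε k / R)
          * bdry ((ballAlgebra R hh).Dμ μ f).1 := by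
      intro μ
      rw [HeightAlgebra.Dμ_L, energyA_sub_left_re]
      linarith [ih hkd' ((ballAlgebra R hh).Dμ μ f)]
    have hsum := Finset.sum_le_sum fun μ (_ : μ ∈ Finset.univ) => hstep μ
    rw [Finset.sum_add_distrib, ← Finset.mul_sum, ← Finset.mul_sum] at hsum
    rw [energyA_succ_re_of_lt hh _ hk hkd, energyA_succ_re_of_lt hh _ hk hkd]
    -- The factor `d/2 - k - ε` is nonnegative because `k + 1/2 ≤ d/2`. Hence the boundary integrals
    -- in `hsum` have a nonpositive coefficient and can absorb the new boundary term.
    have hbd := mul_le_mul_of_nonneg_left (sum_bdry_Dμ_le hh hb ε f)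
      (mul_nonneg (by linarith : 0 ≤ (d : ℝ) / 2 - k - ε)
        (div_nonneg (mul_nonneg zero_le_two he) hR.out.le))
    have hb' : (sphereInt (cj f.1 * f.1)).re = bdry f.1 := rfl
    rw [hb', epsSeq_succ ε hk]
    push_cast
    -- This balance dictates the recursion of `epsSeq`: the new boundary coefficient is `ε / R²`
    -- times the available one, exactly the constant in `sum_bdry_Dμ_le`.
    have e1 : 2 * (epsSeq d R ε k * (((d : ℝ) / 2 - k - ε) * ε / R ^ 2)) / R
        = ((d : ℝ) / 2 - k - ε) * (2 * epsSeq d R ε k / R) * (ε / R ^ 2) := by ring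
    rw [e1]
    have e2 : ε ^ 2 / R ^ 2 = ε * (ε / R ^ 2) := by ring
    rw [e2] at hbd
    linarith

/-- The range starts at `d/2` and not at `d/2 + 1`: the induction descends to the last order with a
boundary term, which satisfies `d/2 ≤ k < d/2 + 1`. There the boundary coefficient `k - d/2 + ε` is
positive, and replacing the boundary term by the energy gives `(d/2 - k) + (k - d/2 + ε) = ε`. -/
theorem energyA_L_le_of_half_le (hb : ∀ x : E d, ‖x‖ = R → h x ^ 2 ≤ R ^ 2) {ε : ℝ} (h0 : 0 < ε)
    (h1 : ε ≤ 1 / 2) {k : ℕ} (hk : 1 ≤ k) (hkd : (d : ℝ) / 2 ≤ k)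
    (f : SmoothBall d R × SmoothBall d R) :
    (energyA hh (epsSeq d R ε) k ((ballAlgebra R hh).L f) f).re
      ≤ ε * (energyA hh (epsSeq d R ε) k f f).re := by
  have hε : ∀ j : ℕ, 1 ≤ j → (j : ℝ) < (d : ℝ) / 2 + 1 → 0 ≤ epsSeq d R ε j :=
    fun j hj hjd => epsSeq_nonneg h0 h1 hj hjd
  have hlt : ∀ {k : ℕ}, 1 ≤ k → (d : ℝ) / 2 ≤ k → (k : ℝ) < (d : ℝ) / 2 + 1 →
      ∀ f : SmoothBall d R × SmoothBall d R,
      (energyA hh (epsSeq d R ε) k ((ballAlgebra R hh).L f) f).re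
        ≤ ε * (energyA hh (epsSeq d R ε) k f f).re := by
    intro k hk hkd hkd' f
    have h2 := energyA_L_le_of_lt hh hb h0 h1 hk hkd' f
    have h3 := mul_le_mul_of_nonneg_left (bdry_le_energyA hh hε hk hkd' f)
      (by linarith : 0 ≤ -((d : ℝ) / 2) + k + ε)
    linarith
  induction k, hk using Nat.le_induction generalizing f with
  | base =>
    refine hlt le_rfl hkd ?_ f
    have : (0 : ℝ) < d := by exact_mod_cast NeZero.pos d
    push_cast
    linarith
  | succ k hk ih =>
    rcases lt_or_ge ((k + 1 : ℕ) : ℝ) ((d : ℝ) / 2 + 1) with hkd' | hkd'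
    · exact hlt (by omega) hkd hkd' f
    · have hk2 : (d : ℝ) / 2 ≤ k := by push_cast at hkd'; linarith
      rw [energyA_succ_re_of_le hh _ hk hkd', energyA_succ_re_of_le hh _ hk hkd']
      have hstep : ∀ μ, (energyA hh (epsSeq d R ε) k
          ((ballAlgebra R hh).Dμ μ ((ballAlgebra R hh).L f)) ((ballAlgebra R hh).Dμ μ f)).re
          ≤ ε * (energyA hh (epsSeq d R ε) k
            ((ballAlgebra R hh).Dμ μ f) ((ballAlgebra R hh).Dμ μ f)).re := by
        intro μ
        rw [HeightAlgebra.Dμ_L, energyA_sub_left_re]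
        -- The commutator gives the better rate `ε - 1` for the `D_μ f`; nonnegativity of the energy
        -- weakens it to `ε`, the rate available for `f` itself.
        linarith [ih hk2 ((ballAlgebra R hh).Dμ μ f),
          energyA_nonneg hh hε hk ((ballAlgebra R hh).Dμ μ f)]
      have hsum := Finset.sum_le_sum fun μ (_ : μ ∈ Finset.univ) => hstep μ
      rw [← Finset.mul_sum] at hsum
      linarith [ih hk2 f]

end WaveFlow
end

/-! ### Sobolev norms by iterated derivatives; trace and Poincaré inequalities. -/

noncomputable section

namespace WaveFlow

open MeasureTheory Set Metric Filter SmoothBall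

variable {d : ℕ} {R : ℝ}

theorem sqInt_le_of_apply_le {u v : SmoothBall d R} {C : ℝ}
    (h : ∀ x ∈ closedBall (0 : E d) R, Complex.normSq (u x) ≤ C * Complex.normSq (v x)) :
    sqInt u ≤ C * sqInt v := by
  have := ballInt_re_mono (u := cj u * u) (v := (C : ℂ) • (cj v * v)) fun x hx => by
    rw [smul_apply _ _ hx, Complex.re_ofReal_mul, cj_mul_self_apply_re _ hx,
      cj_mul_self_apply_re _ hx]
    exact h x hx
  rwa [map_smul, smul_eq_mul, Complex.re_ofReal_mul] at this

theorem normSq_sum_le_card {ι : Type*} (s : Finset ι) (z : ι → ℂ) :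
    Complex.normSq (∑ i ∈ s, z i) ≤ s.card * ∑ i ∈ s, Complex.normSq (z i) := by
  simp only [Complex.normSq_eq_norm_sq]
  exact (pow_le_pow_left₀ (norm_nonneg _) (norm_sum_le _ _) 2).trans sq_sum_le_card_mul_sum_sq

theorem sqInt_sum_le {ι : Type*} (s : Finset ι) (u : ι → SmoothBall d R) :
    sqInt (∑ i ∈ s, u i) ≤ s.card * ∑ i ∈ s, sqInt (u i) := by
  have := ballInt_re_mono (u := cj (∑ i ∈ s, u i) * (∑ i ∈ s, u i))
    (v := ((s.card : ℝ) : ℂ) • ∑ i ∈ s, cj (u i) * u i) fun x hx => by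
      rw [smul_apply _ _ hx, Complex.re_ofReal_mul, cj_mul_self_apply_re _ hx, sum_apply _ _ hx,
        sum_apply _ _ hx, Complex.re_sum]
      simp only [cj_mul_self_apply_re _ hx]
      exact normSq_sum_le_card s _
  have h1 : (ballInt (∑ i ∈ s, cj (u i) * u i)).re = ∑ i ∈ s, sqInt (u i) := by
    rw [map_sum, Complex.re_sum]
    rfl
  rwa [map_smul, smul_eq_mul, Complex.re_ofReal_mul, h1] at this

theorem exists_normSq_le (a : SmoothBall d R) :
    ∃ C, 0 ≤ C ∧ ∀ x ∈ closedBall (0 : E d) R, Complex.normSq (a x) ≤ C := by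
  obtain ⟨C, hC⟩ := (isCompact_closedBall (0 : E d) R).exists_bound_of_continuousOn a.continuousOn
  refine ⟨C ^ 2, sq_nonneg _, fun x hx => ?_⟩
  rw [Complex.normSq_eq_norm_sq]
  exact pow_le_pow_left₀ (norm_nonneg _) (hC x hx) 2

variable [hR : Fact (0 < R)]

/-- The squared Sobolev norm, with repeated derivatives counted separately. -/
def sobA : ℕ → SmoothBall d R → ℝ
  | 0, u => sqInt u
  | k + 1, u => sqInt u + ∑ i, sobA k (der i u)

theorem sobA_nonneg (k : ℕ) (u : SmoothBall d R) : 0 ≤ sobA k u := by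
  induction k generalizing u with
  | zero => exact sqInt_nonneg u
  | succ k ih => exact add_nonneg (sqInt_nonneg u) (Finset.sum_nonneg fun i _ => ih _)

theorem sqInt_le_sobA (k : ℕ) (u : SmoothBall d R) : sqInt u ≤ sobA k u := by
  cases k with
  | zero => exact le_rfl
  | succ k => exact le_add_of_nonneg_right (Finset.sum_nonneg fun i _ => sobA_nonneg _ _)

theorem sobA_der_le (k : ℕ) (i : Fin d) (u : SmoothBall d R) :
    sobA k (der i u) ≤ sobA (k + 1) u := by
  have h1 := Finset.single_le_sum (f := fun i => sobA k (der i u))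
    (fun i _ => sobA_nonneg k (der i u)) (Finset.mem_univ i)
  exact h1.trans (le_add_of_nonneg_left (sqInt_nonneg u))

theorem sobA_le_succ (k : ℕ) (u : SmoothBall d R) : sobA k u ≤ sobA (k + 1) u := by
  induction k generalizing u with
  | zero => exact sqInt_le_sobA 1 u
  | succ k ih =>
    rw [sobA, sobA]
    have := Finset.sum_le_sum fun i (_ : i ∈ Finset.univ) => ih (der i u)
    linarith

theorem sobA_sum_le {ι : Type*} (k : ℕ) (s : Finset ι) (u : ι → SmoothBall d R) :
    sobA k (∑ i ∈ s, u i) ≤ s.card * ∑ i ∈ s, sobA k (u i) := by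
  induction k generalizing u with
  | zero => exact sqInt_sum_le s u
  | succ k ih =>
    simp only [sobA, map_sum, Finset.sum_add_distrib, mul_add]
    refine add_le_add (sqInt_sum_le s u) ?_
    rw [Finset.sum_comm (s := s), Finset.mul_sum]
    exact Finset.sum_le_sum fun i _ => ih _

theorem sobA_add_le (k : ℕ) (u v : SmoothBall d R) :
    sobA k (u + v) ≤ 2 * (sobA k u + sobA k v) := by
  have := sobA_sum_le k (Finset.univ : Finset (Fin 2)) ![u, v]
  simpa using this

/-- Induction on the order by the product rule; the coefficient and its derivatives are bounded by
compactness of the closed ball. It makes every coefficient built from `h` harmless. -/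
theorem sobA_mul_le (k : ℕ) (a : SmoothBall d R) :
    ∃ C, 0 ≤ C ∧ ∀ u, sobA k (a * u) ≤ C * sobA k u := by
  induction k generalizing a with
  | zero =>
    obtain ⟨C, hC, hCa⟩ := exists_normSq_le a
    refine ⟨C, hC, fun u => sqInt_le_of_apply_le fun x hx => ?_⟩
    rw [mul_apply _ _ hx, Complex.normSq_mul]
    exact mul_le_mul_of_nonneg_right (hCa x hx) (Complex.normSq_nonneg _)
  | succ k ih =>
    obtain ⟨C, hC, hCa⟩ := exists_normSq_le a
    obtain ⟨Ca, hCa0, hCak⟩ := ih a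
    choose Ci hCi0 hCik using fun i => ih (der i a)
    refine ⟨C + (2 * Ca + ∑ i, 2 * Ci i), add_nonneg hC (add_nonneg (by positivity)
      (Finset.sum_nonneg fun i _ => mul_nonneg zero_le_two (hCi0 i))), fun u => ?_⟩
    have h0 : sqInt (a * u) ≤ C * sqInt u := sqInt_le_of_apply_le fun x hx => by
      rw [mul_apply _ _ hx, Complex.normSq_mul]
      exact mul_le_mul_of_nonneg_right (hCa x hx) (Complex.normSq_nonneg _)
    have h1 : ∀ i, sobA k (der i (a * u))
        ≤ 2 * Ca * sobA k (der i u) + 2 * Ci i * sobA (k + 1) u := by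
      intro i
      rw [Derivation.leibniz, smul_eq_mul, smul_eq_mul, mul_comm u]
      refine (sobA_add_le k _ _).trans ?_
      have h2 := hCak (der i u)
      have h3 := (hCik i u).trans (mul_le_mul_of_nonneg_left (sobA_le_succ k u) (hCi0 i))
      linarith
    have h2 := Finset.sum_le_sum fun i (_ : i ∈ Finset.univ) => h1 i
    rw [Finset.sum_add_distrib, ← Finset.mul_sum, ← Finset.sum_mul] at h2
    have h3 : ∑ i, sobA k (der i u) ≤ sobA (k + 1) u := le_add_of_nonneg_left (sqInt_nonneg u)
    have h4 := mul_le_mul_of_nonneg_left h3 (mul_nonneg zero_le_two hCa0)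
    have h5 := mul_le_mul_of_nonneg_left (sqInt_le_sobA (k + 1) u) hC
    rw [sobA]
    linarith

theorem sobA_neg (k : ℕ) (u : SmoothBall d R) : sobA k (-u) = sobA k u := by
  induction k generalizing u with
  | zero => simp [sobA, sqInt]
  | succ k ih => simp [sobA, sqInt, ih]

theorem sobA_sub_le (k : ℕ) (u v : SmoothBall d R) :
    sobA k (u - v) ≤ 2 * (sobA k u + sobA k v) := by
  rw [sub_eq_add_neg, ← sobA_neg k v]
  exact sobA_add_le k u (-v)

/-- Young's inequality with weight `δ` for `ξ^i ∂_i |u|² = 2 Re(ū ξ^i ∂_i u)`. Together with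
`mul_bdry_eq` it yields both the trace and the Poincaré inequality. -/
theorem abs_ballInt_euler_le (u : SmoothBall d R) {δ : ℝ} (hδ : 0 < δ) :
    |(ballInt (euler (cj u * u))).re| ≤ δ * sqInt u + R ^ 2 / δ * ∑ i, sqInt (der i u) := by
  have hpt : ∀ x ∈ closedBall (0 : E d) R, |(euler (cj u * u) x).re|
      ≤ δ * Complex.normSq (u x) + R ^ 2 / δ * ∑ i, Complex.normSq (der i u x) := by
    intro x hx
    have h1 : euler (cj u * u) x = ∑ i, (x i : ℂ) *
        (conj (u x) * der i u x + u x * conj (der i u x)) := by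
      rw [euler, sum_apply _ _ hx]
      refine Finset.sum_congr rfl fun i _ => ?_
      rw [mul_apply _ _ hx, Derivation.leibniz, add_apply _ _ hx, smul_eq_mul, smul_eq_mul,
        mul_apply _ _ hx, mul_apply _ _ hx, der_cj, cj_apply _ hx, cj_apply _ hx,
        coord_apply _ hx]
    have h2 : (euler (cj u * u) x).re = 2 * (conj (u x) * ∑ i, (x i : ℂ) * der i u x).re := by
      rw [h1, Complex.re_sum, Finset.mul_sum, Complex.re_sum, Finset.mul_sum]
      refine Finset.sum_congr rfl fun i _ => ?_
      simp only [Complex.add_re, Complex.add_im, Complex.mul_re, Complex.mul_im,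
        Complex.ofReal_re, Complex.ofReal_im, Complex.conj_re, Complex.conj_im]
      ring
    have hx2 : ∑ i, x i ^ 2 ≤ R ^ 2 := by
      have h3 : ‖x‖ ≤ R := by simpa using hx
      rw [sum_coord_sq (R := ‖x‖) rfl]
      exact pow_le_pow_left₀ (norm_nonneg _) h3 2
    set A := ∑ i, (x i : ℂ) * der i u x
    have hA : Complex.normSq A ≤ R ^ 2 * ∑ i, Complex.normSq (der i u x) :=
      (normSq_sum_le x _).trans
        (mul_le_mul_of_nonneg_right hx2 (Finset.sum_nonneg fun i _ => Complex.normSq_nonneg _))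
    have hp : ∀ z : ℂ, Complex.normSq z = z.re ^ 2 + z.im ^ 2 := fun z => by
      rw [Complex.normSq_apply]; ring
    have h3 : δ * |2 * (conj (u x) * A).re| ≤ δ ^ 2 * Complex.normSq (u x) + Complex.normSq A := by
      rw [← abs_of_pos hδ, ← abs_mul, abs_of_pos hδ, abs_le, hp, hp, Complex.mul_re,
        Complex.conj_re, Complex.conj_im]
      constructor
      · nlinarith [sq_nonneg (δ * (u x).re + A.re), sq_nonneg (δ * (u x).im + A.im)]
      · nlinarith [sq_nonneg (δ * (u x).re - A.re), sq_nonneg (δ * (u x).im - A.im)]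
    rw [h2, div_mul_eq_mul_div, ← sub_le_iff_le_add', le_div_iff₀ hδ]
    linarith
  set v : SmoothBall d R := (δ : ℂ) • (cj u * u)
    + ((R ^ 2 / δ : ℝ) : ℂ) • ∑ i, cj (der i u) * der i u with hv
  have hvx : ∀ x ∈ closedBall (0 : E d) R, (v x).re
      = δ * Complex.normSq (u x) + R ^ 2 / δ * ∑ i, Complex.normSq (der i u x) := by
    intro x hx
    rw [hv, add_apply _ _ hx, smul_apply _ _ hx, smul_apply _ _ hx, Complex.add_re,
      Complex.re_ofReal_mul, Complex.re_ofReal_mul, cj_mul_self_apply_re _ hx, sum_apply _ _ hx,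
      Complex.re_sum]
    simp only [cj_mul_self_apply_re _ hx]
  have hvi : (ballInt v).re = δ * sqInt u + R ^ 2 / δ * ∑ i, sqInt (der i u) := by
    rw [hv, map_add, map_smul, map_smul, smul_eq_mul, smul_eq_mul, Complex.add_re,
      Complex.re_ofReal_mul, Complex.re_ofReal_mul, map_sum, Complex.re_sum]
    rfl
  rw [← hvi, abs_le]
  constructor
  · have := ballInt_re_mono (u := -v) (v := euler (cj u * u)) fun x hx => by
      rw [neg_apply _ hx, Complex.neg_re, hvx x hx]
      exact neg_le_of_abs_le (hpt x hx)
    rwa [map_neg, Complex.neg_re] at this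
  · exact ballInt_re_mono fun x hx => by
      rw [hvx x hx]
      exact le_of_abs_le (hpt x hx)

section trace

variable [NeZero d]

theorem mul_bdry_eq (u : SmoothBall d R) :
    R * bdry u = d * sqInt u + (ballInt (euler (cj u * u))).re := by
  have h := congrArg Complex.re (ballInt_radial (cj u * u))
  rw [map_add, map_smul, smul_eq_mul, Complex.add_re, Complex.re_ofReal_mul] at h
  have hd : (d : ℂ) = ((d : ℝ) : ℂ) := by push_cast; rfl
  rw [hd, Complex.re_ofReal_mul] at h
  exact h.symm

/-- The trace inequality. -/
theorem bdry_le_sobA : ∃ C, 0 ≤ C ∧ ∀ u : SmoothBall d R, bdry u ≤ C * sobA 1 u := by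
  refine ⟨(d + 1 + R ^ 2) / R, div_nonneg (by positivity) hR.out.le, fun u => ?_⟩
  have h1 := le_of_abs_le (abs_ballInt_euler_le u one_pos)
  have h2 := mul_bdry_eq u
  have h3 : sobA 1 u = sqInt u + ∑ i, sqInt (der i u) := rfl
  have h4 : 0 ≤ ∑ i, sqInt (der i u) := Finset.sum_nonneg fun i _ => sqInt_nonneg _
  have h5 := sqInt_nonneg u
  rw [div_mul_eq_mul_div, le_div_iff₀ hR.out, h3]
  have h6 : (0 : ℝ) ≤ d := Nat.cast_nonneg d
  nlinarith [mul_nonneg h6 h4, mul_nonneg (sq_nonneg R) h5]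

/-- A Poincaré inequality with a boundary term. -/
theorem sqInt_le_bdry : ∃ C, 0 ≤ C ∧ ∀ u : SmoothBall d R,
    sqInt u ≤ C * (bdry u + ∑ i, sqInt (der i u)) := by
  have hd : (0 : ℝ) < d := by exact_mod_cast NeZero.pos d
  have hR0 := hR.out
  refine ⟨2 / d * (R + R ^ 2 / (d / 2)), by positivity, fun u => ?_⟩
  -- With `δ = d/2`, half of the term `d ∫|u|²` in `mul_bdry_eq` remains after absorption.
  have h1 := neg_le_of_abs_le (abs_ballInt_euler_le u (half_pos hd))
  have h2 := mul_bdry_eq u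
  have h4 : 0 ≤ ∑ i, sqInt (der i u) := Finset.sum_nonneg fun i _ => sqInt_nonneg _
  have h6 : 0 ≤ R ^ 2 / (d / 2) := by positivity
  have h7 : (d : ℝ) / 2 * sqInt u ≤ (R + R ^ 2 / (d / 2)) * (bdry u + ∑ i, sqInt (der i u)) := by
    nlinarith [mul_nonneg hR0.le h4, mul_nonneg h6 (bdry_nonneg u)]
  calc sqInt u = 2 / d * ((d : ℝ) / 2 * sqInt u) := by field_simp
    _ ≤ 2 / d * ((R + R ^ 2 / (d / 2)) * (bdry u + ∑ i, sqInt (der i u))) :=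
        mul_le_mul_of_nonneg_left h7 (by positivity)
    _ = _ := by ring

end trace

end WaveFlow
end

/-! ### Equivalence of the energies with the iterated Sobolev norms. -/

noncomputable section

namespace WaveFlow

open MeasureTheory Set Metric Filter SmoothBall

variable {d : ℕ} {R : ℝ} [hR : Fact (0 < R)]

/-- The squared norm of a pair in `H^k × H^(k-1)`. -/
def sobPair (k : ℕ) (f : SmoothBall d R × SmoothBall d R) : ℝ := sobA k f.1 + sobA (k - 1) f.2

theorem sobPair_nonneg (k : ℕ) (f : SmoothBall d R × SmoothBall d R) : 0 ≤ sobPair k f :=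
  add_nonneg (sobA_nonneg _ _) (sobA_nonneg _ _)

theorem sobPair_le_succ {k : ℕ} (hk : 1 ≤ k) (f : SmoothBall d R × SmoothBall d R) :
    sobPair k f ≤ sobPair (k + 1) f := by
  obtain ⟨k, rfl⟩ : ∃ m, k = m + 1 := ⟨k - 1, by omega⟩
  exact add_le_add (sobA_le_succ _ _) (sobA_le_succ _ _)

variable {h : E d → ℝ} (hh : IsHeightFunction h)

/-- `X` is of second order in `f₁` and first order in `f₂`, which is why the second slot of
`sobPair` is one order lower. -/
theorem sobA_X_le (k : ℕ) : ∃ C, 0 ≤ C ∧ ∀ f : SmoothBall d R × SmoothBall d R,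
    sobA k ((ballAlgebra R hh).X f) ≤ C * sobPair (k + 2) f := by
  obtain ⟨C₁, hC₁, h₁⟩ := sobA_mul_le k (ballAlgebra R hh).winv
  obtain ⟨C₂, hC₂, h₂⟩ := sobA_mul_le k ((ballAlgebra R hh).lap (ballAlgebra R hh).h)
  obtain ⟨C₃, hC₃, h₃⟩ := sobA_mul_le k (2 : SmoothBall d R)
  choose C₄ hC₄ h₄ using fun i => sobA_mul_le k ((ballAlgebra R hh).D i (ballAlgebra R hh).h)
  have hs4 : 0 ≤ ∑ i, C₄ i := Finset.sum_nonneg fun i _ => hC₄ i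
  refine ⟨C₁ * (2 * (2 * (d * d + C₂) + C₃ * (d * ∑ i, C₄ i))), by positivity, fun f => ?_⟩
  have hM1 : sobA (k + 2) f.1 ≤ sobPair (k + 2) f := le_add_of_nonneg_right (sobA_nonneg _ _)
  have hM2 : sobA (k + 1) f.2 ≤ sobPair (k + 2) f := le_add_of_nonneg_left (sobA_nonneg _ _)
  have hlap : sobA k ((ballAlgebra R hh).lap f.1) ≤ d * d * sobPair (k + 2) f := by
    refine (sobA_sum_le k _ _).trans ?_
    rw [Finset.card_univ, Fintype.card_fin, mul_assoc]
    refine mul_le_mul_of_nonneg_left ?_ (Nat.cast_nonneg d)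
    refine (Finset.sum_le_sum fun i _ => (sobA_der_le k i (der i f.1)).trans
      ((sobA_der_le (k + 1) i f.1).trans hM1)).trans ?_
    simp
  have hlh : sobA k ((ballAlgebra R hh).lap (ballAlgebra R hh).h * f.2)
      ≤ C₂ * sobPair (k + 2) f :=
    (h₂ _).trans (mul_le_mul_of_nonneg_left ((sobA_le_succ k _).trans hM2) hC₂)
  have hΓ : sobA k ((ballAlgebra R hh).Γ (ballAlgebra R hh).h f.2)
      ≤ d * (∑ i, C₄ i) * sobPair (k + 2) f := by
    refine (sobA_sum_le k _ _).trans ?_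
    rw [Finset.card_univ, Fintype.card_fin, mul_assoc, Finset.sum_mul]
    refine mul_le_mul_of_nonneg_left ?_ (Nat.cast_nonneg d)
    exact Finset.sum_le_sum fun i _ => (h₄ i _).trans
      (mul_le_mul_of_nonneg_left ((sobA_der_le k i f.2).trans hM2) (hC₄ i))
  have h2Γ : sobA k (2 * (ballAlgebra R hh).Γ (ballAlgebra R hh).h f.2)
      ≤ C₃ * (d * (∑ i, C₄ i) * sobPair (k + 2) f) :=
    (h₃ _).trans (mul_le_mul_of_nonneg_left hΓ hC₃)
  have hA := sobA_sub_le k ((ballAlgebra R hh).lap f.1)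
    ((ballAlgebra R hh).lap (ballAlgebra R hh).h * f.2)
  have hB := sobA_sub_le k ((ballAlgebra R hh).lap f.1
    - (ballAlgebra R hh).lap (ballAlgebra R hh).h * f.2)
    (2 * (ballAlgebra R hh).Γ (ballAlgebra R hh).h f.2)
  rw [mul_assoc]
  refine (h₁ _).trans (mul_le_mul_of_nonneg_left ?_ hC₁)
  linarith

theorem sobPair_Dμ_le {k : ℕ} (hk : 1 ≤ k) : ∃ C, 0 ≤ C ∧
    ∀ (μ : Fin (d + 1)) (f : SmoothBall d R × SmoothBall d R),
      sobPair k ((ballAlgebra R hh).Dμ μ f) ≤ C * sobPair (k + 1) f := by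
  obtain ⟨k, rfl⟩ : ∃ m, k = m + 1 := ⟨k - 1, by omega⟩
  obtain ⟨CX, hCX, hX⟩ := sobA_X_le (R := R) hh k
  choose C₁ hC₁ h₁ using fun i => sobA_mul_le (k + 1) ((ballAlgebra R hh).D i (ballAlgebra R hh).h)
  choose C₂ hC₂ h₂ using fun i => sobA_mul_le k ((ballAlgebra R hh).D i (ballAlgebra R hh).h)
  have hs1 : 0 ≤ ∑ i, C₁ i := Finset.sum_nonneg fun i _ => hC₁ i
  have hs2 : 0 ≤ ∑ i, C₂ i := Finset.sum_nonneg fun i _ => hC₂ i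
  refine ⟨4 + CX + 2 * ∑ i, C₁ i + 2 * ((∑ i, C₂ i) * CX), by positivity, fun μ f => ?_⟩
  have hM0 := sobPair_nonneg (k + 2) f
  have hM1 : sobA (k + 2) f.1 ≤ sobPair (k + 2) f := le_add_of_nonneg_right (sobA_nonneg _ _)
  have hM2 : sobA (k + 1) f.2 ≤ sobPair (k + 2) f := le_add_of_nonneg_left (sobA_nonneg _ _)
  have hXf := hX f
  have e1 := mul_nonneg hs1 hM0
  have e2 := mul_nonneg (mul_nonneg hs2 hCX) hM0
  have e3 := mul_nonneg hCX hM0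
  cases μ using Fin.cases with
  | zero =>
    have : sobPair (k + 1) ((ballAlgebra R hh).Dμ 0 f)
        = sobA (k + 1) f.2 + sobA k ((ballAlgebra R hh).X f) := rfl
    rw [this]
    linarith
  | succ i =>
    have h3 : sobPair (k + 1) ((ballAlgebra R hh).Dμ i.succ f)
        = sobA (k + 1) (der i f.1 - (ballAlgebra R hh).D i (ballAlgebra R hh).h * f.2)
          + sobA k (der i f.2 - (ballAlgebra R hh).D i (ballAlgebra R hh).h
            * (ballAlgebra R hh).X f) := rfl
    rw [h3]
    have h4 := sobA_sub_le (k + 1) (der i f.1)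
      ((ballAlgebra R hh).D i (ballAlgebra R hh).h * f.2)
    have h5 := sobA_sub_le k (der i f.2)
      ((ballAlgebra R hh).D i (ballAlgebra R hh).h * (ballAlgebra R hh).X f)
    have h6 := (sobA_der_le (k + 1) i f.1).trans hM1
    have h7 := (sobA_der_le k i f.2).trans hM2
    have hi1 : C₁ i ≤ ∑ i, C₁ i := Finset.single_le_sum (fun i _ => hC₁ i) (Finset.mem_univ i)
    have hi2 : C₂ i ≤ ∑ i, C₂ i := Finset.single_le_sum (fun i _ => hC₂ i) (Finset.mem_univ i)
    have h8 := (h₁ i f.2).trans (mul_le_mul hi1 hM2 (sobA_nonneg _ _) hs1)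
    have h9 := (h₂ i ((ballAlgebra R hh).X f)).trans (mul_le_mul hi2 hXf (sobA_nonneg _ _) hs2)
    linarith

variable [NeZero d]

omit [NeZero d] in
theorem ballInt_density_le (f : SmoothBall d R × SmoothBall d R) :
    (ballInt ((ballAlgebra R hh).density (cjPair f) f)).re ≤ sobPair 1 f := by
  have := ballInt_re_mono (u := (ballAlgebra R hh).density (cjPair f) f)
    (v := ∑ i, cj (der i f.1) * der i f.1 + cj f.2 * f.2) fun x hx => by
      rw [density_self_apply_re hh f hx, add_apply _ _ hx, sum_apply _ _ hx, Complex.add_re,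
        Complex.re_sum, cj_mul_self_apply_re _ hx]
      simp only [cj_mul_self_apply_re _ hx]
      have hw : coeffW h x ≤ 1 := by
        rw [coeffW]
        have := Finset.sum_nonneg fun i (_ : i ∈ Finset.univ) => mul_self_nonneg (partialR i h x)
        linarith
      have := mul_le_of_le_one_left (Complex.normSq_nonneg (f.2 x)) hw
      linarith
  refine this.trans ?_
  rw [map_add, Complex.add_re, map_sum, Complex.re_sum]
  exact add_le_add (le_add_of_nonneg_left (sqInt_nonneg _)) le_rfl

/-- No sign of `ε` is assumed, so the boundary coefficients enter through their absolute values. The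
trace inequality bounds the boundary integrals, and `sobPair_Dμ_le` runs the induction. -/
theorem energyA_le_sobPair (ε : ℕ → ℝ) {k : ℕ} (hk : 1 ≤ k) :
    ∃ C, 0 ≤ C ∧ ∀ f : SmoothBall d R × SmoothBall d R,
      (energyA hh ε k f f).re ≤ C * sobPair k f := by
  obtain ⟨Ct, hCt, ht⟩ := bdry_le_sobA (d := d) (R := R)
  have hbd : ∀ (e : ℝ) {k : ℕ}, 1 ≤ k → ∀ f : SmoothBall d R × SmoothBall d R,
      e * bdry f.1 ≤ |e| * Ct * sobPair k f := by
    intro e k hk f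
    have h1 : sobPair 1 f ≤ sobPair k f := by
      induction k, hk using Nat.le_induction with
      | base => exact le_rfl
      | succ k hk ih => exact ih.trans (sobPair_le_succ hk f)
    have h2 : sobA 1 f.1 ≤ sobPair k f := (le_add_of_nonneg_right (sobA_nonneg _ _)).trans h1
    calc e * bdry f.1 ≤ |e| * bdry f.1 := mul_le_mul_of_nonneg_right (le_abs_self e) (bdry_nonneg _)
      _ ≤ |e| * (Ct * sobPair k f) := mul_le_mul_of_nonneg_left
          ((ht f.1).trans (mul_le_mul_of_nonneg_left h2 hCt)) (abs_nonneg e)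
      _ = _ := by ring
  induction k, hk using Nat.le_induction with
  | base =>
    refine ⟨1 + |2 * ε 1 / R| * Ct, by positivity, fun f => ?_⟩
    rw [energyA_one_re]
    have := ballInt_density_le hh f
    have := hbd (2 * ε 1 / R) le_rfl f
    linarith
  | succ k hk ih =>
    obtain ⟨C, hC, hCf⟩ := ih
    obtain ⟨CD, hCD, hD⟩ := sobPair_Dμ_le (R := R) hh hk
    refine ⟨(d + 1) * (C * CD) + (|2 * ε (k + 1) / R| * Ct + C), by positivity, fun f => ?_⟩
    have h1 : ∑ μ, (energyA hh ε k ((ballAlgebra R hh).Dμ μ f) ((ballAlgebra R hh).Dμ μ f)).re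
        ≤ (d + 1) * (C * CD) * sobPair (k + 1) f := by
      refine (Finset.sum_le_sum fun μ _ => (hCf _).trans
        (mul_le_mul_of_nonneg_left (hD μ f) hC)).trans_eq ?_
      rw [Finset.sum_const, Finset.card_univ, Fintype.card_fin, nsmul_eq_mul]
      push_cast
      ring
    have h2 : 0 ≤ |2 * ε (k + 1) / R| * Ct * sobPair (k + 1) f :=
      mul_nonneg (by positivity) (sobPair_nonneg _ _)
    have h3 : 0 ≤ C * sobPair (k + 1) f := mul_nonneg hC (sobPair_nonneg _ _)
    rcases lt_or_ge ((k + 1 : ℕ) : ℝ) ((d : ℝ) / 2 + 1) with hkd | hkd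
    · rw [energyA_succ_re_of_lt hh ε hk hkd]
      have h4 : 2 * ε (k + 1) / R * (sphereInt (cj f.1 * f.1)).re ≤ _ :=
        hbd (2 * ε (k + 1) / R) (k := k + 1) (by omega) f
      linarith
    · rw [energyA_succ_re_of_le hh ε hk hkd]
      have h4 := (hCf f).trans (mul_le_mul_of_nonneg_left (sobPair_le_succ hk f) hC)
      linarith

omit [NeZero d] in
include hh in
theorem exists_coeffW_lower : ∃ w₀ > 0, ∀ x ∈ closedBall (0 : E d) R, w₀ ≤ coeffW h x := by
  obtain ⟨x, -, hx⟩ := (isCompact_closedBall (0 : E d) R).exists_isMinOn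
    ⟨0, mem_closedBall_self hR.out.le⟩ (contDiff_coeffW hh.smooth).continuous.continuousOn
  exact ⟨coeffW h x, hh.coeffW_pos x, fun y hy => hx hy⟩

/-- Only the first components of the `D_μ f` are needed to go up one order: they control `f₂` and
the gradient of `f₁` in `H^k`. What is missing is the `L²` norm of `f₁`. -/
theorem sobPair_le_energyA {ε : ℕ → ℝ}
    (hε : ∀ j : ℕ, 1 ≤ j → (j : ℝ) < (d : ℝ) / 2 + 1 → 0 < ε j) {k : ℕ} (hk : 1 ≤ k) :
    ∃ C, 0 ≤ C ∧ ∀ f : SmoothBall d R × SmoothBall d R,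
      sobPair k f ≤ C * (energyA hh ε k f f).re := by
  have hε0 : ∀ j : ℕ, 1 ≤ j → (j : ℝ) < (d : ℝ) / 2 + 1 → 0 ≤ ε j :=
    fun j hj hjd => (hε j hj hjd).le
  obtain ⟨Cp, hCp, hp⟩ := sqInt_le_bdry (d := d) (R := R)
  have hbd : ∀ {k : ℕ}, 1 ≤ k → (k : ℝ) < (d : ℝ) / 2 + 1 →
      ∀ f : SmoothBall d R × SmoothBall d R,
        bdry f.1 ≤ R / (2 * ε k) * (energyA hh ε k f f).re := by
    intro k hk hkd f
    have h1 := bdry_le_energyA hh hε0 hk hkd f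
    have h2 := hε k hk hkd
    have h3 := hR.out
    calc bdry f.1 = R / (2 * ε k) * (2 * ε k / R * bdry f.1) := by field_simp
      _ ≤ _ := mul_le_mul_of_nonneg_left h1 (by positivity)
  induction k, hk using Nat.le_induction with
  | base =>
    have h1d : ((1 : ℕ) : ℝ) < (d : ℝ) / 2 + 1 := by
      have : (0 : ℝ) < d := by exact_mod_cast NeZero.pos d
      push_cast
      linarith
    obtain ⟨w₀, hw₀, hw⟩ := exists_coeffW_lower (R := R) hh
    have he1 := hε 1 le_rfl h1d
    have hRpos := hR.out
    have hB0 : 0 ≤ R / (2 * ε 1) := by positivity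
    -- The three summands bound, in turn, `f₁` by the Poincaré inequality, its gradient directly,
    -- and `f₂` by the minimum `w₀` of the weight on the closed ball.
    refine ⟨Cp * (R / (2 * ε 1) + 1) + 1 + w₀⁻¹, by positivity, fun f => ?_⟩
    have hb1 := hbd le_rfl h1d f
    have hN := energyA_nonneg hh hε0 le_rfl f
    have hden : (ballInt ((ballAlgebra R hh).density (cjPair f) f)).re
        ≤ (energyA hh ε 1 f f).re := by
      rw [energyA_one_re]
      exact le_add_of_nonneg_right (mul_nonneg (by positivity) (bdry_nonneg _))
    have hlow : ∑ i, sqInt (der i f.1) + w₀ * sqInt f.2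
        ≤ (ballInt ((ballAlgebra R hh).density (cjPair f) f)).re := by
      have := ballInt_re_mono (v := (ballAlgebra R hh).density (cjPair f) f)
        (u := ∑ i, cj (der i f.1) * der i f.1 + (w₀ : ℂ) • (cj f.2 * f.2)) fun x hx => by
          rw [density_self_apply_re hh f hx, add_apply _ _ hx, sum_apply _ _ hx, Complex.add_re,
            Complex.re_sum, smul_apply _ _ hx, Complex.re_ofReal_mul, cj_mul_self_apply_re _ hx]
          simp only [cj_mul_self_apply_re _ hx]
          have := mul_le_mul_of_nonneg_right (hw x hx) (Complex.normSq_nonneg (f.2 x))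
          linarith
      rwa [map_add, Complex.add_re, map_sum, Complex.re_sum, map_smul, smul_eq_mul,
        Complex.re_ofReal_mul] at this
    have hs1 : ∑ i, sqInt (der i f.1) ≤ (energyA hh ε 1 f f).re := by
      have := mul_nonneg hw₀.le (sqInt_nonneg f.2)
      linarith
    have hs2 : sqInt f.2 ≤ w₀⁻¹ * (energyA hh ε 1 f f).re := by
      have h0 : 0 ≤ ∑ i, sqInt (der i f.1) := Finset.sum_nonneg fun i _ => sqInt_nonneg _
      rw [inv_mul_eq_div, le_div_iff₀ hw₀]
      linarith
    have hs3 := (hp f.1).trans (mul_le_mul_of_nonneg_left (add_le_add hb1 hs1) hCp)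
    have : sobPair 1 f = sqInt f.1 + ∑ i, sqInt (der i f.1) + sqInt f.2 := rfl
    rw [this]
    linarith
  | succ k hk ih =>
    obtain ⟨C, hC, hCf⟩ := ih
    choose C₁ hC₁ h₁ using fun i => sobA_mul_le k ((ballAlgebra R hh).D i (ballAlgebra R hh).h)
    have hs1 : 0 ≤ ∑ i, C₁ i := Finset.sum_nonneg fun i _ => hC₁ i
    have hRpos := hR.out
    -- The `L²` norm of `f₁` comes from its boundary term below the threshold, and from the
    -- lower-order energy included in the form above it.
    have hcases : ∃ B, 0 ≤ B ∧ ∀ f : SmoothBall d R × SmoothBall d R,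
        sqInt f.1 ≤ B * ((energyA hh ε (k + 1) f f).re + ∑ i, sobA k (der i f.1)) := by
      rcases lt_or_ge ((k + 1 : ℕ) : ℝ) ((d : ℝ) / 2 + 1) with hkd | hkd
      · have he := hε (k + 1) (by omega) hkd
        refine ⟨Cp * (R / (2 * ε (k + 1)) + 1), by positivity, fun f => ?_⟩
        have h2 := hbd (k := k + 1) (by omega) hkd f
        have h3 : ∑ i, sqInt (der i f.1) ≤ ∑ i, sobA k (der i f.1) :=
          Finset.sum_le_sum fun i _ => sqInt_le_sobA k _
        have h4 : 0 ≤ ∑ i, sobA k (der i f.1) := Finset.sum_nonneg fun i _ => sobA_nonneg _ _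
        have h5 := energyA_nonneg hh hε0 (k := k + 1) (by omega) f
        have h6 : 0 ≤ R / (2 * ε (k + 1)) := by positivity
        rw [mul_assoc]
        refine (hp f.1).trans (mul_le_mul_of_nonneg_left ?_ hCp)
        nlinarith [mul_nonneg h6 h4]
      · refine ⟨C, hC, fun f => ?_⟩
        have h2 : sqInt f.1 ≤ sobPair k f :=
          (sqInt_le_sobA k f.1).trans (le_add_of_nonneg_right (sobA_nonneg _ _))
        refine (h2.trans (hCf f)).trans (mul_le_mul_of_nonneg_left ?_ hC)
        rw [energyA_succ_re_of_le hh ε hk hkd]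
        have h3 : 0 ≤ ∑ μ, (energyA hh ε k ((ballAlgebra R hh).Dμ μ f)
            ((ballAlgebra R hh).Dμ μ f)).re :=
          Finset.sum_nonneg fun μ _ => energyA_nonneg hh hε0 hk _
        have h4 : 0 ≤ ∑ i, sobA k (der i f.1) := Finset.sum_nonneg fun i _ => sobA_nonneg _ _
        linarith
    obtain ⟨B, hB, hBf⟩ := hcases
    set K := d * (2 * C) + 2 * (∑ i, C₁ i) * C with hK
    have hK0 : 0 ≤ K := by positivity
    -- The summands bound `f₁` in `L²`, its gradient in `H^k`, and `f₂` in `H^k`.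
    refine ⟨B * (1 + K) + K + C, by positivity, fun f => ?_⟩
    set N := (energyA hh ε (k + 1) f f).re with hN
    have hN0 : 0 ≤ N := energyA_nonneg hh hε0 (by omega) f
    have hsumN : ∑ μ, (energyA hh ε k ((ballAlgebra R hh).Dμ μ f)
        ((ballAlgebra R hh).Dμ μ f)).re ≤ N := by
      rw [hN]
      rcases lt_or_ge ((k + 1 : ℕ) : ℝ) ((d : ℝ) / 2 + 1) with hkd | hkd
      · rw [energyA_succ_re_of_lt hh ε hk hkd]
        have he := hε (k + 1) (by omega) hkd
        exact le_add_of_nonneg_right (mul_nonneg (by positivity) (bdry_nonneg f.1))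
      · rw [energyA_succ_re_of_le hh ε hk hkd]
        exact le_add_of_nonneg_right (energyA_nonneg hh hε0 hk f)
    have hμ : ∀ μ, sobA k ((ballAlgebra R hh).Dμ μ f).1 ≤ C * N := by
      intro μ
      have h2 : sobA k ((ballAlgebra R hh).Dμ μ f).1 ≤ sobPair k ((ballAlgebra R hh).Dμ μ f) :=
        le_add_of_nonneg_right (sobA_nonneg _ _)
      refine (h2.trans (hCf _)).trans (mul_le_mul_of_nonneg_left (le_trans ?_ hsumN) hC)
      exact Finset.single_le_sum (f := fun μ => (energyA hh ε k ((ballAlgebra R hh).Dμ μ f)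
        ((ballAlgebra R hh).Dμ μ f)).re) (fun μ _ => energyA_nonneg hh hε0 hk _)
        (Finset.mem_univ μ)
    -- The first component of `Dμ 0 f` is `f₂` by definition.
    have hf2 : sobA k f.2 ≤ C * N := hμ 0
    have hder : ∀ i, sobA k (der i f.1) ≤ 2 * C * N + 2 * C₁ i * (C * N) := by
      intro i
      have h2 : der i f.1 = ((ballAlgebra R hh).Dμ i.succ f).1
          + (ballAlgebra R hh).D i (ballAlgebra R hh).h * f.2 := by
        rw [HeightAlgebra.Dμ_succ, HeightAlgebra.DX, sub_add_cancel]
        rfl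
      have h3 := sobA_add_le k ((ballAlgebra R hh).Dμ i.succ f).1
        ((ballAlgebra R hh).D i (ballAlgebra R hh).h * f.2)
      rw [← h2] at h3
      have h4 := (h₁ i f.2).trans (mul_le_mul_of_nonneg_left hf2 (hC₁ i))
      have h5 := hμ i.succ
      linarith
    have hsum : ∑ i, sobA k (der i f.1) ≤ K * N := by
      refine (Finset.sum_le_sum fun i _ => hder i).trans_eq ?_
      have h2 : ∑ i, 2 * C₁ i * (C * N) = 2 * (∑ i, C₁ i) * (C * N) := by
        rw [Finset.mul_sum, Finset.sum_mul]
      rw [Finset.sum_add_distrib, h2, Finset.sum_const, Finset.card_univ, Fintype.card_fin,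
        nsmul_eq_mul, hK]
      ring
    have hsq := (hBf f).trans
      (mul_le_mul_of_nonneg_left (add_le_add_right hsum _) hB)
    have : sobPair (k + 1) f = sqInt f.1 + ∑ i, sobA k (der i f.1) + sobA k f.2 := rfl
    rw [this]
    linarith

end WaveFlow
end

/-! ### Iterated derivatives versus multi-indices. -/

noncomputable section

namespace WaveFlow

open MeasureTheory Set Metric Filter SmoothBall

section multiIndex

variable {d : ℕ}

/-- Raising the `i`-th entry is a bijection from the multi-indices of order `j` onto those of order
`j + 1` with positive `i`-th entry. -/
theorem sum_piAntidiag_succ (j : ℕ) (i : Fin d) (g : (Fin d → ℕ) → ℝ) :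
    ∑ β ∈ Finset.piAntidiag Finset.univ j, g (β + Pi.single i 1)
      = ∑ α ∈ Finset.piAntidiag Finset.univ (j + 1), if 0 < α i then g α else 0 := by
  rw [← Finset.sum_filter]
  refine Finset.sum_bij' (fun β _ => β + Pi.single i 1) (fun α _ => α - Pi.single i 1)
    ?_ ?_ ?_ ?_ ?_
  · intro β hβ
    rw [Finset.mem_piAntidiag] at hβ
    rw [Finset.mem_filter, Finset.mem_piAntidiag]
    refine ⟨⟨?_, fun _ _ => Finset.mem_univ _⟩, by simp⟩
    have := hβ.1
    simp [Finset.sum_add_distrib, this]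
  · intro α hα
    rw [Finset.mem_filter, Finset.mem_piAntidiag] at hα
    rw [Finset.mem_piAntidiag]
    refine ⟨?_, fun _ _ => Finset.mem_univ _⟩
    have h1 : α - Pi.single i 1 + Pi.single i 1 = α := by
      funext j
      by_cases h : j = i
      · subst h
        have := hα.2
        simp
        omega
      · simp [h]
    have h2 : ∑ j, (α - Pi.single i 1 + Pi.single i 1 : Fin d → ℕ) j = j + 1 := by
      rw [h1]
      exact hα.1.1
    simp only [Pi.add_apply, Finset.sum_add_distrib] at h2
    simpa using h2
  · intro β _
    funext j
    simp
  · intro α hα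
    rw [Finset.mem_filter] at hα
    funext j
    by_cases h : j = i
    · subst h
      have := hα.2
      simp
      omega
    · simp [h]
  · intro β _
    rfl

theorem sum_piAntidiag_le (j : ℕ) {g : (Fin d → ℕ) → ℝ} (hg : ∀ α, 0 ≤ g α) :
    ∑ α ∈ Finset.piAntidiag Finset.univ (j + 1), g α
      ≤ ∑ i, ∑ β ∈ Finset.piAntidiag Finset.univ j, g (β + Pi.single i 1) := by
  simp only [sum_piAntidiag_succ]
  rw [Finset.sum_comm]
  refine Finset.sum_le_sum fun α hα => ?_
  rw [Finset.mem_piAntidiag] at hα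
  obtain ⟨i, -, hi⟩ : ∃ i ∈ (Finset.univ : Finset (Fin d)), α i ≠ 0 := by
    refine Finset.exists_ne_zero_of_sum_ne_zero ?_
    rw [hα.1]
    exact Nat.succ_ne_zero j
  have := Finset.single_le_sum (f := fun i => if 0 < α i then g α else 0)
    (fun i _ => by
      split_ifs
      exacts [hg α, le_rfl]) (Finset.mem_univ i)
  simpa [Nat.pos_of_ne_zero hi] using this

theorem sum_piAntidiag_ge (j : ℕ) {g : (Fin d → ℕ) → ℝ} (hg : ∀ α, 0 ≤ g α) (i : Fin d) :
    ∑ β ∈ Finset.piAntidiag Finset.univ j, g (β + Pi.single i 1)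
      ≤ ∑ α ∈ Finset.piAntidiag Finset.univ (j + 1), g α := by
  rw [sum_piAntidiag_succ]
  refine Finset.sum_le_sum fun α _ => ?_
  split_ifs
  exacts [le_rfl, hg α]

end multiIndex

variable {d : ℕ} {R : ℝ} [hR : Fact (0 < R)]

/-- The multi-index derivative along the indices of a list. -/
def derList (l : List (Fin d)) (α : Fin d → ℕ) (u : SmoothBall d R) : SmoothBall d R :=
  l.foldr (fun i v => (der i)^[α i] v) u

theorem iterate_der_comm (i j : Fin d) (n : ℕ) (u : SmoothBall d R) :
    (der i)^[n] (der j u) = der j ((der i)^[n] u) :=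
  Function.Commute.iterate_left (fun u => der_comm i j u) n u

theorem derList_der (l : List (Fin d)) (α : Fin d → ℕ) (i : Fin d) (u : SmoothBall d R) :
    derList l α (der i u) = der i (derList l α u) := by
  induction l with
  | nil => rfl
  | cons j l ih =>
    simp only [derList, List.foldr_cons] at ih ⊢
    rw [ih, iterate_der_comm]

/-- Without repetitions in the list the index `i` is visited at most once, so the extra derivative
is taken at most once; commutation brings it to the front. -/
theorem derList_add_single (l : List (Fin d)) (hl : l.Nodup) (α : Fin d → ℕ) (i : Fin d)
    (u : SmoothBall d R) : derList l (α + Pi.single i 1) u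
      = if i ∈ l then der i (derList l α u) else derList l α u := by
  induction l with
  | nil => rfl
  | cons j l ih =>
    have hl' := List.nodup_cons.1 hl
    have ih' := ih hl'.2
    simp only [derList, List.foldr_cons] at ih' ⊢
    rw [ih']
    by_cases hij : i = j
    · subst hij
      simp only [hl'.1, if_false, List.mem_cons, true_or, if_true, Pi.add_apply, Pi.single_eq_same]
      rw [Function.iterate_succ_apply']
    · have hji : (Pi.single i 1 : Fin d → ℕ) j = 0 := Pi.single_eq_of_ne (Ne.symm hij) 1
      simp only [List.mem_cons, hij, false_or, Pi.add_apply, hji, add_zero]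
      split_ifs
      · rw [iterate_der_comm]
      · rfl

/-- The squared Sobolev norm, as a sum over multi-indices. -/
def sobM (k : ℕ) (u : SmoothBall d R) : ℝ :=
  ∑ j ∈ Finset.range (k + 1), ∑ α ∈ Finset.piAntidiag Finset.univ j,
    sqInt (derList (List.finRange d) α u)

theorem derList_finRange_add_single (α : Fin d → ℕ) (i : Fin d) (u : SmoothBall d R) :
    derList (List.finRange d) (α + Pi.single i 1) u = derList (List.finRange d) α (der i u) := by
  rw [derList_add_single _ (List.nodup_finRange d), if_pos (List.mem_finRange i), derList_der]

theorem derList_zero (u : SmoothBall d R) (l : List (Fin d)) : derList l 0 u = u := by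
  induction l with
  | nil => rfl
  | cons j l ih =>
    simp only [derList, List.foldr_cons] at ih ⊢
    rw [ih]
    rfl

theorem sobM_zero (u : SmoothBall d R) : sobM 0 u = sqInt u := by
  simp [sobM, derList_zero]

theorem sobM_succ (k : ℕ) (u : SmoothBall d R) : sobM (k + 1) u = sqInt u +
    ∑ j ∈ Finset.range (k + 1), ∑ α ∈ Finset.piAntidiag Finset.univ (j + 1),
      sqInt (derList (List.finRange d) α u) := by
  rw [sobM, Finset.sum_range_succ']
  simp [derList_zero, add_comm]

theorem sobM_nonneg (k : ℕ) (u : SmoothBall d R) : 0 ≤ sobM k u :=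
  Finset.sum_nonneg fun _ _ => Finset.sum_nonneg fun _ _ => sqInt_nonneg _

theorem sobM_le_sobA (k : ℕ) (u : SmoothBall d R) : sobM k u ≤ sobA k u := by
  induction k generalizing u with
  | zero => exact (sobM_zero u).le
  | succ k ih =>
    rw [sobM_succ, sobA]
    refine add_le_add le_rfl (le_trans ?_ (Finset.sum_le_sum fun i _ => ih (der i u)))
    simp only [sobM, ← derList_finRange_add_single]
    rw [Finset.sum_comm (s := Finset.univ)]
    exact Finset.sum_le_sum fun j _ =>
      sum_piAntidiag_le j (g := fun α => sqInt (derList (List.finRange d) α u))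
        fun α => sqInt_nonneg _

/-- The factor `(d + 1) ^ k` bounds the multiplicity with which `sobA` counts each multi-index: each
level adds the function itself and `d` derivatives. -/
theorem sobA_le_sobM (k : ℕ) (u : SmoothBall d R) : sobA k u ≤ ((d : ℝ) + 1) ^ k * sobM k u := by
  induction k generalizing u with
  | zero => simp [sobM_zero, sobA]
  | succ k ih =>
    have h1 : ∀ i, sobM k (der i u) ≤ sobM (k + 1) u := by
      intro i
      rw [sobM_succ]
      refine le_trans ?_ (le_add_of_nonneg_left (sqInt_nonneg u))
      simp only [sobM, ← derList_finRange_add_single]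
      exact Finset.sum_le_sum fun j _ =>
        sum_piAntidiag_ge j (g := fun α => sqInt (derList (List.finRange d) α u))
          (fun α => sqInt_nonneg _) i
    have h2 : sqInt u ≤ sobM (k + 1) u := by
      rw [sobM_succ]
      exact le_add_of_nonneg_right
        (Finset.sum_nonneg fun _ _ => Finset.sum_nonneg fun _ _ => sqInt_nonneg _)
    have hp : (1 : ℝ) ≤ (d + 1 : ℝ) ^ k := one_le_pow₀ (by linarith [Nat.cast_nonneg (α := ℝ) d])
    have h3 : ∑ i, sobA k (der i u) ≤ d * ((d + 1 : ℝ) ^ k * sobM (k + 1) u) := by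
      refine (Finset.sum_le_sum fun i _ => (ih (der i u)).trans
        (mul_le_mul_of_nonneg_left (h1 i) (by positivity))).trans_eq ?_
      rw [Finset.sum_const, Finset.card_univ, Fintype.card_fin, nsmul_eq_mul]
    have h4 := mul_le_mul_of_nonneg_right hp (sobM_nonneg (k + 1) u)
    rw [sobA, pow_succ]
    linarith

theorem iterate_der_apply (i : Fin d) (n : ℕ) {v : SmoothBall d R} {w : E d → ℂ}
    (hvw : EqOn v w (closedBall 0 R)) :
    EqOn ((der i)^[n] v) ((partialB R i)^[n] w) (closedBall 0 R) := by
  induction n with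
  | zero => exact hvw
  | succ n ih =>
    intro x hx
    rw [Function.iterate_succ_apply', Function.iterate_succ_apply', der_apply _ _ hx,
      partialB_congr ih hx]

theorem derList_apply (l : List (Fin d)) (α : Fin d → ℕ) {u : E d → ℂ}
    (hu : ContDiffOn ℝ ∞ u (closedBall 0 R)) :
    EqOn (derList l α (SmoothBall.mk u hu)) (l.foldr (fun i v => (partialB R i)^[α i] v) u)
      (closedBall 0 R) := by
  induction l with
  | nil => exact fun x hx => mk_apply hu hx
  | cons j l ih =>
    simp only [derList, List.foldr_cons] at ih ⊢
    exact iterate_der_apply j (α j) ih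

omit hR in
theorem integral_norm_sq_eq {u : E d → ℂ} {v : SmoothBall d R}
    (h : EqOn v u (closedBall 0 R)) :
    ∫ x in ball (0 : E d) R, ‖u x‖ ^ 2 = sqInt v := by
  rw [sqInt, ballInt_re]
  refine setIntegral_congr_fun measurableSet_ball fun x hx => ?_
  have hx' := ball_subset_closedBall hx
  rw [cj_mul_self_apply_re v hx', h hx', Complex.normSq_eq_norm_sq]

theorem sobolevNormSq_eq (k : ℕ) {u : E d → ℂ} (hu : ContDiffOn ℝ ∞ u (closedBall 0 R)) :
    sobolevNormSq R k u = sobM k (SmoothBall.mk u hu) :=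
  Finset.sum_congr rfl fun _ _ => Finset.sum_congr rfl fun α _ =>
    integral_norm_sq_eq (derList_apply (List.finRange d) α hu)

variable {f : Pair d} (hf : SmoothPair R f)
include hf

theorem sobolevPairNorm_sq_le_sobPair (k : ℕ) :
    sobolevNormSq R k f.1 + sobolevNormSq R (k - 1) f.2 ≤ sobPair k (toBall hf) := by
  rw [sobolevNormSq_eq k hf.1, sobolevNormSq_eq (k - 1) hf.2]
  exact add_le_add (sobM_le_sobA _ _) (sobM_le_sobA _ _)

theorem sobPair_le_sobolevPairNorm_sq (k : ℕ) :
    sobPair k (toBall hf)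
      ≤ ((d : ℝ) + 1) ^ k * (sobolevNormSq R k f.1 + sobolevNormSq R (k - 1) f.2) := by
  rw [sobolevNormSq_eq k hf.1, sobolevNormSq_eq (k - 1) hf.2, mul_add]
  refine add_le_add (sobA_le_sobM _ _) ((sobA_le_sobM _ _).trans ?_)
  refine mul_le_mul_of_nonneg_right ?_ (sobM_nonneg _ _)
  exact pow_le_pow_right₀ (by linarith [Nat.cast_nonneg (α := ℝ) d]) (Nat.sub_le k 1)

-- A continuous function vanishing almost everywhere on the open ball vanishes there, and then on
-- the closure.
omit hf in
theorem eq_zero_of_sqInt_eq_zero {u : SmoothBall d R} (hu : sqInt u = 0) {x : E d}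
    (hx : x ∈ closedBall (0 : E d) R) : u x = 0 := by
  have h1 : ∫ x in ball (0 : E d) R, ‖u x‖ ^ 2 = 0 := by
    rw [integral_norm_sq_eq (fun x _ => rfl), hu]
  have hc : ContinuousOn (fun x => ‖u x‖ ^ 2) (closedBall 0 R) := u.continuousOn.norm.pow 2
  rw [integral_eq_zero_iff_of_nonneg (fun x => by positivity)
    (integrableOn_ball_of_continuousOn hc)] at h1
  have h2 := Measure.eqOn_open_of_ae_eq h1 isOpen_ball (hc.mono ball_subset_closedBall)
    continuousOn_const
  have h3 : EqOn u 0 (ball 0 R) := fun y hy => by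
    have h4 : ‖u y‖ ^ 2 = 0 := h2 hy
    simpa using h4
  rw [← closure_ball _ hR.out.ne'] at hx
  exact h3.of_subset_closure u.continuousOn continuousOn_const ball_subset_closedBall
    (closure_ball (0 : E d) hR.out.ne').ge (by rwa [closure_ball _ hR.out.ne'] at hx)

end WaveFlow
end

/-! ### Transfer back to pairs of functions and assembly of the result. -/

noncomputable section

namespace WaveFlow

open MeasureTheory Set Metric Filter SmoothBall

variable {d : ℕ} {R : ℝ} [hR : Fact (0 < R)]

omit hR in
theorem SmoothPair.add {f g : Pair d} (hf : SmoothPair R f) (hg : SmoothPair R g) :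
    SmoothPair R (f + g) := ⟨hf.1.add hg.1, hf.2.add hg.2⟩

omit hR in
theorem SmoothPair.smul (a : ℂ) {f : Pair d} (hf : SmoothPair R f) : SmoothPair R (a • f) :=
  ⟨contDiffOn_const.smul hf.1, contDiffOn_const.smul hf.2⟩

omit hR in
theorem toBall_add {f g : Pair d} (hf : SmoothPair R f) (hg : SmoothPair R g) :
    toBall (hf.add hg) = toBall hf + toBall hg :=
  toBall_eq _ fun x hx => by
    constructor
    · rw [Prod.fst_add, Prod.fst_add, add_apply _ _ hx, toBall, toBall, mk_apply hf.1 hx,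
        mk_apply hg.1 hx]
      rfl
    · rw [Prod.snd_add, Prod.snd_add, add_apply _ _ hx, toBall, toBall, mk_apply hf.2 hx,
        mk_apply hg.2 hx]
      rfl

omit hR in
theorem toBall_smul (a : ℂ) {f : Pair d} (hf : SmoothPair R f) :
    toBall (hf.smul a) = a • toBall hf :=
  toBall_eq _ fun x hx => by
    constructor
    · rw [Prod.smul_fst, Prod.smul_fst, smul_apply _ _ hx, toBall, mk_apply hf.1 hx]
      rfl
    · rw [Prod.smul_snd, Prod.smul_snd, smul_apply _ _ hx, toBall, mk_apply hf.2 hx]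
      rfl

theorem sphereIntegral_norm_sq {f : Pair d} (hf : SmoothPair R f) :
    sphereIntegral R (fun x => ‖f.1 x‖ ^ 2) = bdry (toBall hf).1 := by
  rw [bdry, sphereInt_re]
  refine sphereIntegral_congr fun x hx => ?_
  have hx' := mem_closedBall_of_norm_eq hx
  rw [cj_mul_self_apply_re _ hx', toBall, mk_apply hf.1 hx', Complex.normSq_eq_norm_sq]

variable [NeZero d] {h : E d → ℝ} (hh : IsHeightFunction h)
include hh

theorem energyNorm_sq {ε : ℕ → ℝ} (hε : ∀ j : ℕ, 1 ≤ j → (j : ℝ) < (d : ℝ) / 2 + 1 → 0 ≤ ε j)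
    {k : ℕ} (hk : 1 ≤ k) {f : Pair d} (hf : SmoothPair R f) :
    energyNorm h R ε k f ^ 2 = (energyA hh ε k (toBall hf) (toBall hf)).re := by
  rw [energyNorm, energyForm_eq hh ε k hf hf, Real.sq_sqrt (energyA_nonneg hh hε hk _)]

theorem isInnerProduct_energyForm {ε : ℕ → ℝ}
    (hε : ∀ j : ℕ, 1 ≤ j → (j : ℝ) < (d : ℝ) / 2 + 1 → 0 < ε j) {k : ℕ} (hk : 1 ≤ k) :
    IsInnerProduct R (energyForm h R ε k) where
  conj_symm f g hf hg := by
    rw [energyForm_eq hh ε k hf hg, energyForm_eq hh ε k hg hf, energyA_conj]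
  add_right f g g' hf hg hg' := by
    rw [energyForm_eq hh ε k hf (hg.add hg'), energyForm_eq hh ε k hf hg,
      energyForm_eq hh ε k hf hg', toBall_add, energyA_add_right]
  smul_right a f g hf hg := by
    rw [energyForm_eq hh ε k hf (hg.smul a), energyForm_eq hh ε k hf hg, toBall_smul,
      energyA_smul_right]
  nonneg f hf := by
    rw [energyForm_eq hh ε k hf hf]
    exact energyA_nonneg hh (fun j hj hjd => (hε j hj hjd).le) hk _
  definite f hf h0 x hx := by
    -- Definiteness is inherited from the Sobolev norm, which the energy dominates.
    obtain ⟨C, -, hC⟩ := sobPair_le_energyA (R := R) hh hε hk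
    have h1 := hC (toBall hf)
    rw [← energyForm_eq hh ε k hf hf, h0, Complex.zero_re, mul_zero] at h1
    have h2 := sqInt_le_sobA k (toBall hf).1
    have h3 := sqInt_le_sobA (k - 1) (toBall hf).2
    have h4 := sqInt_nonneg (toBall hf).1
    have h5 := sqInt_nonneg (toBall hf).2
    have h6 : sobA k (toBall hf).1 + sobA (k - 1) (toBall hf).2 ≤ 0 := h1
    have e1 := eq_zero_of_sqInt_eq_zero (u := (toBall hf).1) (by linarith) hx
    have e2 := eq_zero_of_sqInt_eq_zero (u := (toBall hf).2) (by linarith) hx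
    rw [toBall, mk_apply hf.1 hx] at e1
    rw [toBall, mk_apply hf.2 hx] at e2
    exact ⟨e1, e2⟩

theorem energyNorm_equiv_sobolev {ε : ℕ → ℝ}
    (hε : ∀ j : ℕ, 1 ≤ j → (j : ℝ) < (d : ℝ) / 2 + 1 → 0 < ε j) {k : ℕ} (hk : 1 ≤ k) :
    ∃ C₁ > 0, ∃ C₂ > 0, ∀ f : Pair d, SmoothPair R f →
      energyNorm h R ε k f ≤ C₁ * sobolevPairNorm R k f ∧
      sobolevPairNorm R k f ≤ C₂ * energyNorm h R ε k f := by
  obtain ⟨C, hC0, hC⟩ := energyA_le_sobPair (R := R) hh ε hk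
  obtain ⟨C', hC0', hC'⟩ := sobPair_le_energyA (R := R) hh hε hk
  have hp1 : 0 < C * ((d : ℝ) + 1) ^ k + 1 := by positivity
  have hp2 : 0 < C' + 1 := by positivity
  refine ⟨√(C * ((d : ℝ) + 1) ^ k + 1), Real.sqrt_pos.2 hp1, √(C' + 1), Real.sqrt_pos.2 hp2,
    fun f hf => ?_⟩
  have h1 := hC (toBall hf)
  have h2 := mul_le_mul_of_nonneg_left (sobPair_le_sobolevPairNorm_sq hf k) hC0
  have h3 := (sobolevPairNorm_sq_le_sobPair hf k).trans (hC' (toBall hf))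
  have h4 : 0 ≤ sobolevNormSq R k f.1 + sobolevNormSq R (k - 1) f.2 := by
    rw [sobolevNormSq_eq k hf.1, sobolevNormSq_eq (k - 1) hf.2]
    exact add_nonneg (sobM_nonneg _ _) (sobM_nonneg _ _)
  have h5 := energyA_nonneg hh (fun j hj hjd => (hε j hj hjd).le) hk (toBall hf)
  rw [energyNorm, energyForm_eq hh ε k hf hf, sobolevPairNorm, ← Real.sqrt_mul hp1.le,
    ← Real.sqrt_mul hp2.le]
  constructor
  · exact Real.sqrt_le_sqrt (by linarith)
  · exact Real.sqrt_le_sqrt (by linarith)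

end WaveFlow
end

theorem propositionB (d : ℕ) (hd : 1 ≤ d) (k : ℕ) (hk : 1 ≤ k)
    (h : E d → ℝ) (hh : IsHeightFunction h) (R : ℝ) (hR : 0 < R) :
    -- the forms are inner products and their norms are equivalent to the Sobolev norms
    (∀ ε : ℕ → ℝ, (∀ j : ℕ, 1 ≤ j → (j : ℝ) < (d : ℝ) / 2 + 1 → 0 < ε j) →
      IsInnerProduct R (energyForm h R ε k) ∧
      ∃ C₁ > 0, ∃ C₂ > 0, ∀ f : Pair d, SmoothPair R f →
        energyNorm h R ε k f ≤ C₁ * sobolevPairNorm R k f ∧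
        sobolevPairNorm R k f ≤ C₂ * energyNorm h R ε k f) ∧
    -- the dissipative estimates
    (∀ R₀ : ℝ, IsLightConeRadius h R₀ → R₀ ≤ R →
      ∀ ε₁ : ℝ, 0 < ε₁ → ε₁ ≤ 1 / 2 →
        (∀ j : ℕ, 1 ≤ j → (j : ℝ) < (d : ℝ) / 2 + 1 →
          0 ≤ epsSeq d R ε₁ j ∧ (ε₁ < 1 / 2 ∨ 2 * j ≠ d + 1 → 0 < epsSeq d R ε₁ j)) ∧
        ∀ f : Pair d, SmoothPair R f →
          ((k : ℝ) < (d : ℝ) / 2 + 1 →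
            (energyForm h R (epsSeq d R ε₁) k (waveOp h R f) f).re ≤
              ((d : ℝ) / 2 - k) * energyNorm h R (epsSeq d R ε₁) k f ^ 2
              + (-((d : ℝ) / 2) + k + ε₁) * (2 * epsSeq d R ε₁ k / R)
                * sphereIntegral R (fun x => ‖f.1 x‖ ^ 2)) ∧
          ((d : ℝ) / 2 + 1 ≤ k →
            (energyForm h R (epsSeq d R ε₁) k (waveOp h R f) f).re ≤
              ε₁ * energyNorm h R (epsSeq d R ε₁) k f ^ 2)) := by
  have : NeZero d := ⟨by omega⟩
  have : Fact (0 < R) := ⟨hR⟩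
  refine ⟨fun ε hε => ⟨isInnerProduct_energyForm hh hε hk, energyNorm_equiv_sobolev hh hε hk⟩,
    fun R₀ hR₀ hle ε₁ h0 h1 => ⟨fun j hj hjd => ⟨epsSeq_nonneg h0 h1 hj hjd,
      epsSeq_pos h0 h1 hj hjd⟩, fun f hf => ?_⟩⟩
  have hb : ∀ x : E d, ‖x‖ = R → h x ^ 2 ≤ R ^ 2 := fun x hx => hh.sq_le_sq hR₀ hle hx
  rw [energyNorm_sq hh (fun j hj hjd => epsSeq_nonneg h0 h1 hj hjd) hk hf,
    sphereIntegral_norm_sq hf, energyForm_eq hh _ k (smoothPair_waveOp hh hf) hf, toBall_waveOp hh hf]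
  exact ⟨fun hkd => energyA_L_le_of_lt hh hb h0 h1 hk hkd _,
    fun hkd => energyA_L_le_of_half_le hh hb h0 h1 hk (by linarith) _⟩
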